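/- Let $K$ be a field of characteristic different from $2$ with absolute Galois group $G_K$, and let $f\in K[x]$ be a separable polynomial of positive even degree $2d$. Let $X$ be the smooth projective curve over $K$ with affine model $y^2=f(x)$ (a hyperelliptic curve when $2d\ge 6$), and let $\infty^+,\infty^-$ be its two geometric points at infinity. Let $J_{\mathfrak m}$ be the generalised Jacobian of $X$ for the modulus $\mathfrak m=\infty^++\infty^-$: its geometric points are the divisors of degree $0$ on $X_{\overline K}$ that are prime to $\mathfrak m$, modulo the divisors of functions $h$ with $h\equiv 1 \bmod \mathfrak m$. Put $$K_{f,2}=K\big[x,y,\tfrac1{x-y}\big]/(f(x),f(y)),$$ and let $K_f^{(2)}$ be the subalgebra of $K_{f,2}$ fixed by the interchange of $x$ and $y$. Let $\mathrm{Ind}_K^{K_f^{(2)}}\mathbb F_2$ be the $\mathbb F_2$-vector space on the geometric points of $K_f^{(2)}$, i.e. on the unordered pairs $\{\alpha,\beta\}$ of distinct roots of $f$ in $\overline K$, with basis vectors $e_{\alpha\beta}$ permuted by $G_K$. Let $$\varphi:\ \mathrm{Ind}_K^{K_f^{(2)}}\mathbb F_2\longrightarrow J_{\mathfrak m}[2],\qquad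 e_{\alpha\beta}\longmapsto [(\alpha,0)-(\beta,0)],$$ which is a well-defined homomorphism of $G_K$-modules. Then there is an isomorphism of $\mathbb F_2$-vector spaces $$H^1\big(K,\wedge^2J_{\mathfrak m}[2]\big)\ \simeq\ \mathrm{Ker}\Big(H^1\big(K,\mathrm{Ind}_K^{K_f^{(2)}}\mathbb F_2\big)\xrightarrow{\ \varphi_*\ }H^1\big(K,J_{\mathfrak m}[2]\big)\Big).$$ More precisely, there is a homomorphism of $G_K$-modules $\iota:\wedge^2J_{\mathfrak m}[2]\to \mathrm{Ind}_K^{K_f^{(2)}}\mathbb F_2$ with $$\iota\big([(\beta,0)-(\gamma,0)]\wedge[(\gamma,0)-(\alpha,0)]\big)=e_{\alpha\beta}+e_{\beta\gamma}+e_{\gamma\alpha}$$ for all pairwise distinct roots $\alpha,\beta,\gamma$ of $f$, and the isomorphism is induced by $\iota_*$ on $H^1$. -/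

import Mathlib

open Polynomial


namespace EvenHyperelliptic
noncomputable section
universe u

/-- The absolute Galois group `G_K`, with its Krull topology, as the group of `K`-automorphisms of an
algebraic closure of `K` (restriction to the separable closure is an isomorphism). -/
abbrev GalK (K : Type u) [Field K] : Type u := AlgebraicClosure K ≃ₐ[K] AlgebraicClosure K

section Cohomology

variable {K : Type u} [Field K] {V W : Type u} [AddCommGroup V] [Module (ZMod 2) V]
  [AddCommGroup W] [Module (ZMod 2) W]

lemma continuousSMul_discrete [TopologicalSpace V] [DiscreteTopology V] :
    ContinuousSMul (ZMod 2) V := ⟨continuous_of_discreteTopology⟩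

/-- A `G_K`-module over `𝔽₂` with the discrete topology, as a topological representation. -/
def discreteTopRep (ρ : Representation (ZMod 2) (GalK K) V) : TopRep.{u} (ZMod 2) (GalK K) :=
  letI : TopologicalSpace V := ⊥
  haveI : DiscreteTopology V := ⟨rfl⟩
  haveI : ContinuousSMul (ZMod 2) V := continuousSMul_discrete
  TopRep.of (X := V) (ContRepresentation.ofMonoidHom
    { toFun := fun g => ⟨ρ g, continuous_of_discreteTopology⟩
      map_one' := by ext v; simp
      map_mul' := fun g h => by ext v; simp })

/-- A homomorphism of `G_K`-modules as a morphism of topological representations. -/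
def discreteTopRepMap {ρ : Representation (ZMod 2) (GalK K) V}
    {σ : Representation (ZMod 2) (GalK K) W} (φ : ρ.IntertwiningMap σ) :
    discreteTopRep ρ ⟶ discreteTopRep σ :=
  letI : TopologicalSpace V := ⊥
  haveI : DiscreteTopology V := ⟨rfl⟩
  haveI : ContinuousSMul (ZMod 2) V := continuousSMul_discrete
  letI : TopologicalSpace W := ⊥
  haveI : DiscreteTopology W := ⟨rfl⟩
  haveI : ContinuousSMul (ZMod 2) W := continuousSMul_discrete
  TopRep.ofHom ⟨⟨φ.toLinearMap, continuous_of_discreteTopology⟩, fun g => by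
    ext v; exact congr($(φ.isIntertwining' g) v)⟩

/-- `H¹(K, V)`: continuous cohomology of `G_K` with values in the discrete module `V`. -/
abbrev H1 (ρ : Representation (ZMod 2) (GalK K) V) : TopModuleCat.{u} (ZMod 2) :=
  continuousCohomology.{0, u, u} 1 (discreteTopRep ρ)

/-- The map on `H¹` induced by a homomorphism of `G_K`-modules. -/
def H1map {ρ : Representation (ZMod 2) (GalK K) V}
    {σ : Representation (ZMod 2) (GalK K) W} (φ : ρ.IntertwiningMap σ) :
    H1 ρ →ₗ[ZMod 2] H1 σ :=
  (ContinuousCohomology.map.{0, u, u} (ContinuousMonoidHom.id (GalK K))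
    (X := discreteTopRep ρ) (Y := discreteTopRep σ) (discreteTopRepMap φ) 1).hom.toLinearMap

end Cohomology

section Curve

variable {K : Type u} [Field K] (f : K[X])

/-- `f` as a polynomial over the algebraic closure of `K`. -/
abbrev fbar : (AlgebraicClosure K)[X] := f.map (algebraMap K (AlgebraicClosure K))

/-- The defining polynomial `Y ^ 2 - f(x)` of the curve, over the rational function field. -/
abbrev curvePoly : (RatFunc (AlgebraicClosure K))[X] :=
  X ^ 2 - C (algebraMap (AlgebraicClosure K)[X] (RatFunc (AlgebraicClosure K)) (fbar f))

/-- The function field of the curve `y ^ 2 = f(x)` over the algebraic closure of `K`. -/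
abbrev FunctionField : Type u := AdjoinRoot (curvePoly f)

/-- The function `x`. -/
def xFun : FunctionField f := AdjoinRoot.of _ RatFunc.X

/-- The function `1 / x`. -/
def xInvFun : FunctionField f := AdjoinRoot.of _ (RatFunc.X)⁻¹

/-- The function `y`. -/
def yFun : FunctionField f := AdjoinRoot.root _

/-- Let `s` be the pair of coordinate functions of an affine plane chart of the curve, and `P` the
coordinates of a point in this chart. The local ring at `P` consists of the rational functions
`p(s) / q(s)` with polynomials `p`, `q` such that `q(P) ≠ 0`. -/
def localRing (s : Fin 2 → FunctionField f) (P : Fin 2 → AlgebraicClosure K) :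
    Subalgebra (AlgebraicClosure K) (FunctionField f) where
  carrier := {h | ∃ p q : MvPolynomial (Fin 2) (AlgebraicClosure K),
    MvPolynomial.aeval P q ≠ 0 ∧ h * MvPolynomial.aeval s q = MvPolynomial.aeval s p}
  mul_mem' := by
    rintro a b ⟨p, q, h1, h2⟩ ⟨p', q', h1', h2'⟩
    refine ⟨p * p', q * q', by simpa using ⟨h1, h1'⟩, ?_⟩
    rw [map_mul, map_mul, ← h2, ← h2']; ring
  add_mem' := by
    rintro a b ⟨p, q, h1, h2⟩ ⟨p', q', h1', h2'⟩
    refine ⟨p * q' + p' * q, q * q', by simpa using ⟨h1, h1'⟩, ?_⟩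
    rw [map_mul, map_add, map_mul, map_mul, ← h2, ← h2']; ring
  algebraMap_mem' := fun r => ⟨MvPolynomial.C r, 1, by simp, by simp⟩

/-- The rational function `h` lies in the maximal ideal of the local ring at `P`: it is of the form
`p(s) / q(s)` with `p(P) = 0` and `q(P) ≠ 0`. -/
def VanishesAt (s : Fin 2 → FunctionField f) (P : Fin 2 → AlgebraicClosure K)
    (h : FunctionField f) : Prop :=
  ∃ p q : MvPolynomial (Fin 2) (AlgebraicClosure K), MvPolynomial.aeval P p = 0 ∧
    MvPolynomial.aeval P q ≠ 0 ∧ h * MvPolynomial.aeval s q = MvPolynomial.aeval s p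

/-- `ϖ` generates the maximal ideal of the local ring at `P`. -/
def IsUniformizer (s : Fin 2 → FunctionField f) (P : Fin 2 → AlgebraicClosure K)
    (ϖ : (FunctionField f)ˣ) : Prop :=
  VanishesAt f s P ϖ ∧ ∀ h, VanishesAt f s P h → (↑ϖ⁻¹ : FunctionField f) * h ∈ localRing f s P

/-- A point of the affine curve `y ^ 2 = f(x)` over the algebraic closure of `K`. -/
@[ext]
structure AffinePoint : Type u where
  /-- The `x`-coordinate. -/
  x : AlgebraicClosure K
  /-- The `y`-coordinate. -/
  y : AlgebraicClosure K
  eq : y ^ 2 = (fbar f).eval x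

/-- A point at infinity of the smooth projective curve with affine model `y ^ 2 = f(x)`, where `f`
has even degree `2 d`. In the chart with coordinates `1 / x` and `y / x ^ d` these points are `(0, w)`
with `w ^ 2` the leading coefficient of `f`. -/
@[ext]
structure InfinitePoint : Type u where
  /-- The value of `y / x ^ (deg f / 2)` at the point. -/
  w : AlgebraicClosure K
  eq : w ^ 2 = (fbar f).leadingCoeff

variable {f} in
/-- The rational function `h` has order `n` at the affine point `P`: it is `ϖ ^ n` times a unit of the
local ring, for a uniformizer `ϖ`. -/
def HasOrder (P : AffinePoint f) (h : (FunctionField f)ˣ) (n : ℤ) : Prop :=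
  ∃ ϖ : (FunctionField f)ˣ,
    IsUniformizer f ![xFun f, yFun f] ![P.x, P.y] ϖ ∧
    (↑(h * ϖ ^ (-n)) : FunctionField f) ∈ localRing f ![xFun f, yFun f] ![P.x, P.y] ∧
    (↑(h * ϖ ^ (-n))⁻¹ : FunctionField f) ∈ localRing f ![xFun f, yFun f] ![P.x, P.y]

variable {f} in
/-- The rational function `h` is regular and vanishes at a point at infinity (`f` of even degree). -/
def VanishesAtInfinity (w : InfinitePoint f) (h : FunctionField f) : Prop :=
  VanishesAt f ![xInvFun f, yFun f * xInvFun f ^ (f.natDegree / 2)] ![0, w.w] h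

/-- Divisors of the smooth projective curve, over the algebraic closure of `K`, that are prime to the
modulus `𝔪 = ∞⁺ + ∞⁻`. -/
abbrev Divisor : Type u := AffinePoint f →₀ ℤ

/-- The degree of a divisor. -/
def divisorDegree : Divisor f →+ ℤ := Finsupp.liftAddHom fun _ => AddMonoidHom.id ℤ

/-- The divisors of degree zero that are prime to `𝔪`. -/
abbrev divisorsDegZero : AddSubgroup (Divisor f) := (divisorDegree f).ker

/-- The group of divisors of the rational functions `h` with `h ≡ 1 mod 𝔪`, that is, with `h - 1`
vanishing at both points at infinity. (Such divisors form a group already.) -/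
def principalDivisors : AddSubgroup (Divisor f) :=
  AddSubgroup.closure {D | ∃ h : (FunctionField f)ˣ,
    (∀ P, HasOrder P h (D P)) ∧ ∀ w : InfinitePoint f, VanishesAtInfinity w (↑h - 1)}

/-- The group of geometric points of the generalised Jacobian `J_𝔪` for `𝔪 = ∞⁺ + ∞⁻`: divisors of
degree zero prime to `𝔪`, modulo the divisors of functions `h ≡ 1 mod 𝔪`. -/
abbrev GenJacobian : Type u :=
  divisorsDegZero f ⧸ (principalDivisors f).addSubgroupOf (divisorsDegZero f)

/-- The `2`-torsion `J_𝔪[2]` of the generalised Jacobian. -/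
abbrev GenJacobianTwo : Type u := AddSubgroup.torsionBy (GenJacobian f) 2

instance : Module (ZMod 2) (GenJacobianTwo f) := AddSubgroup.torsionBy.zmodModule (n := 2)


/-- The action of the Galois group on the function field, through the coefficients. -/
def galFunctionField (σ : GalK K) : FunctionField f ≃+* FunctionField f :=
  AdjoinRoot.mapRingEquiv
    (IsFractionRing.ringEquivOfRingEquiv (K := RatFunc (AlgebraicClosure K))
      (L := RatFunc (AlgebraicClosure K)) (Polynomial.mapEquiv σ.toRingEquiv)) _ _ (by
    have h : (fbar f).map (σ.toRingEquiv : AlgebraicClosure K →+* AlgebraicClosure K) = fbar f := by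
      rw [fbar, Polynomial.map_map]
      congr 1
      ext x
      simp
    have h' := IsFractionRing.ringEquivOfRingEquiv_algebraMap
      (K := RatFunc (AlgebraicClosure K)) (L := RatFunc (AlgebraicClosure K))
      (Polynomial.mapEquiv σ.toRingEquiv) (fbar f)
    rw [Polynomial.mapEquiv_apply, h] at h'
    rw [curvePoly, Polynomial.map_sub, Polynomial.map_pow, Polynomial.map_X, Polynomial.map_C]
    erw [h'])

lemma galFunctionField_of (σ : GalK K) (r : RatFunc (AlgebraicClosure K)) :
    galFunctionField f σ (AdjoinRoot.of _ r) = AdjoinRoot.of _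
      (IsFractionRing.ringEquivOfRingEquiv (K := RatFunc (AlgebraicClosure K))
      (L := RatFunc (AlgebraicClosure K)) (Polynomial.mapEquiv σ.toRingEquiv) r) := by
  simp only [galFunctionField, AdjoinRoot.coe_mapRingEquiv, AdjoinRoot.map_of]
  rfl

lemma galRatFunc_X (σ : GalK K) :
    IsFractionRing.ringEquivOfRingEquiv (K := RatFunc (AlgebraicClosure K))
      (L := RatFunc (AlgebraicClosure K)) (Polynomial.mapEquiv σ.toRingEquiv) RatFunc.X
      = RatFunc.X := by
  rw [← RatFunc.algebraMap_X, IsFractionRing.ringEquivOfRingEquiv_algebraMap]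
  simp

lemma galFunctionField_x (σ : GalK K) : galFunctionField f σ (xFun f) = xFun f := by
  rw [xFun, galFunctionField_of, galRatFunc_X]

lemma galFunctionField_xInv (σ : GalK K) : galFunctionField f σ (xInvFun f) = xInvFun f := by
  rw [xInvFun, galFunctionField_of, map_inv₀, galRatFunc_X]

lemma galFunctionField_y (σ : GalK K) : galFunctionField f σ (yFun f) = yFun f := by
  simp [galFunctionField, yFun]

lemma galFunctionField_algebraMap (σ : GalK K) (c : AlgebraicClosure K) :
    galFunctionField f σ (algebraMap _ _ c) = algebraMap _ _ (σ c) := by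
  have e (c : AlgebraicClosure K) : algebraMap (AlgebraicClosure K) (FunctionField f) c =
      AdjoinRoot.of _ (algebraMap (AlgebraicClosure K)[X] _ (C c)) := rfl
  rw [e, e, galFunctionField_of, IsFractionRing.ringEquivOfRingEquiv_algebraMap]
  simp

lemma galFunctionField_aeval (σ : GalK K) {s : Fin 2 → FunctionField f}
    (hs : ∀ i, galFunctionField f σ (s i) = s i) (p : MvPolynomial (Fin 2) (AlgebraicClosure K)) :
    galFunctionField f σ (MvPolynomial.aeval s p) =
      MvPolynomial.aeval s (MvPolynomial.map (σ : AlgebraicClosure K →+* AlgebraicClosure K) p) := by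
  induction p using MvPolynomial.induction_on with
  | C a => simp [galFunctionField_algebraMap]
  | add p q hp hq => simp [hp, hq]
  | mul_X p i hp => simp [hp, hs]

end Curve

section Action

variable {K : Type u} [Field K] (f : K[X])

lemma aeval_point_map (σ : GalK K) (P : Fin 2 → AlgebraicClosure K)
    (p : MvPolynomial (Fin 2) (AlgebraicClosure K)) :
    MvPolynomial.aeval (fun i => σ (P i))
      (MvPolynomial.map (σ : AlgebraicClosure K →+* AlgebraicClosure K) p) =
      σ (MvPolynomial.aeval P p) := by
  induction p using MvPolynomial.induction_on with
  | C a => simp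
  | add p q hp hq => rw [map_add, map_add, map_add, map_add, hp, hq]
  | mul_X p i hp => rw [map_mul, map_mul, map_mul, map_mul, hp]; simp

variable {f}

lemma mem_localRing_gal (σ : GalK K) {s : Fin 2 → FunctionField f}
    (hs : ∀ i, galFunctionField f σ (s i) = s i) {P : Fin 2 → AlgebraicClosure K}
    {h : FunctionField f} (hh : h ∈ localRing f s P) :
    galFunctionField f σ h ∈ localRing f s (fun i => σ (P i)) := by
  obtain ⟨p, q, h1, h2⟩ := hh
  refine ⟨MvPolynomial.map (σ : AlgebraicClosure K →+* AlgebraicClosure K) p,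
    MvPolynomial.map (σ : AlgebraicClosure K →+* AlgebraicClosure K) q, ?_,
    by rw [← galFunctionField_aeval f σ hs, ← map_mul, h2, galFunctionField_aeval f σ hs]⟩
  rw [aeval_point_map]
  simpa using h1

lemma vanishesAt_gal (σ : GalK K) {s : Fin 2 → FunctionField f}
    (hs : ∀ i, galFunctionField f σ (s i) = s i) {P : Fin 2 → AlgebraicClosure K}
    {h : FunctionField f} (hh : VanishesAt f s P h) :
    VanishesAt f s (fun i => σ (P i)) (galFunctionField f σ h) := by
  obtain ⟨p, q, h0, h1, h2⟩ := hh
  refine ⟨MvPolynomial.map (σ : AlgebraicClosure K →+* AlgebraicClosure K) p,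
    MvPolynomial.map (σ : AlgebraicClosure K →+* AlgebraicClosure K) q, ?_, ?_,
    by rw [← galFunctionField_aeval f σ hs, ← map_mul, h2, galFunctionField_aeval f σ hs]⟩
  · rw [aeval_point_map, h0, map_zero]
  · rw [aeval_point_map]
    simpa using h1

lemma galFunctionField_inv (σ : GalK K) (h : FunctionField f) :
    galFunctionField f σ (galFunctionField f σ⁻¹ h) = h := by
  have e : galFunctionField f σ⁻¹ = (galFunctionField f σ).symm := by
    rw [galFunctionField, galFunctionField, AdjoinRoot.symm_mapRingEquiv]
    congr 1
  rw [e, RingEquiv.apply_symm_apply]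

lemma isUniformizer_gal (σ : GalK K) {s : Fin 2 → FunctionField f}
    (hs : ∀ τ i, galFunctionField f τ (s i) = s i) {P : Fin 2 → AlgebraicClosure K}
    {ϖ : (FunctionField f)ˣ} (hϖ : IsUniformizer f s P ϖ) :
    IsUniformizer f s (fun i => σ (P i)) (Units.map (galFunctionField f σ : _ →* _) ϖ) := by
  refine ⟨vanishesAt_gal σ (hs σ) hϖ.1, fun h hh => ?_⟩
  have h1 := vanishesAt_gal σ⁻¹ (hs σ⁻¹) hh
  have e : (fun i => σ⁻¹ (σ (P i))) = P := by
    funext i; exact σ.symm_apply_apply (P i)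
  rw [e] at h1
  have h2 := mem_localRing_gal σ (hs σ) (hϖ.2 _ h1)
  rwa [map_mul, galFunctionField_inv] at h2

/-- The action of the Galois group on points, through the coordinates. -/
instance : MulAction (GalK K) (AffinePoint f) where
  smul σ P := ⟨σ P.x, σ P.y, by
    have h := congr_arg σ P.eq
    rw [Polynomial.eval_map_algebraMap] at h ⊢
    rw [map_pow, ← Polynomial.aeval_algHom_apply] at h
    exact h⟩
  one_smul P := rfl
  mul_smul σ τ P := rfl

lemma chart_gal (τ : GalK K) (i : Fin 2) :
    galFunctionField f τ (![xFun f, yFun f] i) = ![xFun f, yFun f] i := by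
  fin_cases i
  · exact galFunctionField_x f τ
  · exact galFunctionField_y f τ

lemma chartInfinity_gal (τ : GalK K) (i : Fin 2) :
    galFunctionField f τ (![xInvFun f, yFun f * xInvFun f ^ (f.natDegree / 2)] i) =
      ![xInvFun f, yFun f * xInvFun f ^ (f.natDegree / 2)] i := by
  fin_cases i
  · exact galFunctionField_xInv f τ
  · simp [galFunctionField_xInv, galFunctionField_y]

lemma hasOrder_gal (σ : GalK K) {P : AffinePoint f} {h : (FunctionField f)ˣ} {n : ℤ}
    (hh : HasOrder P h n) :
    HasOrder (σ • P) (Units.map (galFunctionField f σ : _ →* _) h) n := by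
  obtain ⟨ϖ, h1, h2, h3⟩ := hh
  have e : (fun i => σ (![P.x, P.y] i)) = ![(σ • P).x, (σ • P).y] := by
    funext i; fin_cases i <;> rfl
  refine ⟨Units.map (galFunctionField f σ : _ →* _) ϖ, e ▸ isUniformizer_gal σ chart_gal h1, ?_, ?_⟩
  · have := mem_localRing_gal σ (chart_gal σ) h2
    rw [e] at this
    rwa [← map_zpow, ← map_mul]
  · have := mem_localRing_gal σ (chart_gal σ) h3
    rw [e] at this
    rwa [← map_zpow, ← map_mul, ← map_inv]

lemma vanishesAtInfinity_gal (σ : GalK K) {h : FunctionField f}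
    (hh : ∀ w : InfinitePoint f, VanishesAtInfinity w h) (w : InfinitePoint f) :
    VanishesAtInfinity w (galFunctionField f σ h) := by
  have hw : (σ⁻¹ w.w) ^ 2 = (fbar f).leadingCoeff := by
    rw [← map_pow, w.eq, fbar, Polynomial.leadingCoeff_map]
    exact AlgEquiv.commutes _ _
  have := vanishesAt_gal σ (chartInfinity_gal σ) (hh ⟨_, hw⟩)
  have e : (fun i => σ ((![0, σ⁻¹ w.w] : Fin 2 → AlgebraicClosure K) i)) = ![0, w.w] := by
    funext i; fin_cases i
    · exact map_zero σ
    · exact σ.apply_symm_apply w.w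
  rw [e] at this
  exact this

variable (f)

/-- The action of the Galois group on divisors. -/
def galDivisor (σ : GalK K) : Divisor f →+ Divisor f :=
  Finsupp.mapDomain.addMonoidHom (σ • ·)

variable {f}

lemma degree_galDivisor (σ : GalK K) (D : Divisor f) : divisorDegree f (galDivisor f σ D) = divisorDegree f D := by
  induction D using Finsupp.induction_linear with
  | zero => simp
  | add D E hD hE => simp [hD, hE]
  | single P n => simp [divisorDegree, galDivisor, Finsupp.mapDomain_single]

lemma galDivisor_apply (σ : GalK K) (D : Divisor f) (P : AffinePoint f) :
    galDivisor f σ D P = D (σ⁻¹ • P) := by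
  conv_lhs => rw [← smul_inv_smul σ P]
  exact Finsupp.mapDomain_apply (MulAction.injective σ) D _

lemma galDivisor_principal (σ : GalK K) {D : Divisor f} (hD : D ∈ principalDivisors f) :
    galDivisor f σ D ∈ principalDivisors f := by
  suffices principalDivisors f ≤ (principalDivisors f).comap (galDivisor f σ) from this hD
  refine (AddSubgroup.closure_le _).2 ?_
  rintro D ⟨h, h1, h2⟩
  refine AddSubgroup.subset_closure ⟨Units.map (galFunctionField f σ : _ →* _) h, fun P => ?_,
    fun w => ?_⟩
  · rw [galDivisor_apply]
    simpa using hasOrder_gal σ (h1 (σ⁻¹ • P))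
  · simpa using vanishesAtInfinity_gal σ h2 w

variable (f)

/-- The action of the Galois group on divisors of degree zero. -/
def galDegZero (σ : GalK K) : divisorsDegZero f →+ divisorsDegZero f :=
  ((galDivisor f σ).comp (divisorsDegZero f).subtype).codRestrict _ fun D => by
    have h : divisorDegree f D.1 = 0 := D.2
    simp [AddMonoidHom.mem_ker, degree_galDivisor, h]

/-- The action of the Galois group on `J_𝔪`. -/
def galJacobian (σ : GalK K) : GenJacobian f →+ GenJacobian f :=
  QuotientAddGroup.map _ _ (galDegZero f σ) fun D hD => by
    rw [AddSubgroup.mem_comap, AddSubgroup.mem_addSubgroupOf]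
    exact galDivisor_principal σ (AddSubgroup.mem_addSubgroupOf.1 hD)

lemma galJacobian_mk (σ : GalK K) (D : divisorsDegZero f) :
    galJacobian f σ (QuotientAddGroup.mk D) = QuotientAddGroup.mk (galDegZero f σ D) := rfl

lemma galDegZero_one (D : divisorsDegZero f) : galDegZero f 1 D = D := by
  refine Subtype.ext (Finsupp.ext fun P => ?_)
  change galDivisor f 1 D.1 P = D.1 P
  rw [galDivisor_apply, inv_one, one_smul]

lemma galDegZero_mul (σ τ : GalK K) (D : divisorsDegZero f) :
    galDegZero f (σ * τ) D = galDegZero f σ (galDegZero f τ D) := by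
  refine Subtype.ext (Finsupp.ext fun P => ?_)
  change galDivisor f (σ * τ) D.1 P = galDivisor f σ (galDivisor f τ D.1) P
  rw [galDivisor_apply, galDivisor_apply, galDivisor_apply, mul_inv_rev, mul_smul]

/-- The action of the Galois group on `J_𝔪[2]`. -/
def galJacobianTwo (σ : GalK K) : GenJacobianTwo f →+ GenJacobianTwo f :=
  ((galJacobian f σ).comp (AddSubgroup.subtype _)).codRestrict _ fun c => by
    refine (AddSubgroup.torsionBy.nsmul_iff (n := 2)).2 ?_
    rw [AddMonoidHom.comp_apply, ← map_nsmul, AddSubgroup.subtype_apply,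
      (AddSubgroup.torsionBy.nsmul_iff (n := 2)).1 c.2, map_zero]

/-- The `G_K`-module `J_𝔪[2]`. -/
def jacobianTwoRep : Representation (ZMod 2) (GalK K) (GenJacobianTwo f) where
  toFun σ := (galJacobianTwo f σ).toZModLinearMap 2
  map_one' := by
    refine LinearMap.ext fun c => Subtype.ext ?_
    change galJacobian f 1 c.1 = c.1
    obtain ⟨D, hD⟩ := QuotientAddGroup.mk_surjective c.1
    rw [← hD, galJacobian_mk, galDegZero_one]
  map_mul' σ τ := by
    refine LinearMap.ext fun c => Subtype.ext ?_
    change galJacobian f (σ * τ) c.1 = galJacobian f σ (galJacobian f τ c.1)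
    obtain ⟨D, hD⟩ := QuotientAddGroup.mk_surjective c.1
    rw [← hD, galJacobian_mk, galJacobian_mk, galJacobian_mk, galDegZero_mul]

/-- The exterior square `∧² V` of a `G_K`-module `V` over `𝔽₂`, with the diagonal action. -/
def wedgeSquareRep {V : Type u} [AddCommGroup V] [Module (ZMod 2) V]
    (ρ : Representation (ZMod 2) (GalK K) V) :
    Representation (ZMod 2) (GalK K) (⋀[ZMod 2]^2 V) where
  toFun σ := exteriorPower.map 2 (ρ σ)
  map_one' := by
    rw [map_one]
    exact exteriorPower.map_id (R := ZMod 2) (M := V)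
  map_mul' σ τ := by
    rw [map_mul]
    exact exteriorPower.map_comp (R := ZMod 2) (n := 2) (ρ τ) (ρ σ)

end Action

section Torsion

variable {K : Type u} [Field K] {f : K[X]}

lemma yFun_sq : yFun f ^ 2 = aeval (xFun f) (fbar f) := by
  have h : aeval (xFun f) (fbar f) = AdjoinRoot.of (curvePoly f)
      (algebraMap (AlgebraicClosure K)[X] (RatFunc (AlgebraicClosure K)) (fbar f)) := by
    have e : (aeval (xFun f) : (AlgebraicClosure K)[X] →ₐ[AlgebraicClosure K] FunctionField f) =
        (IsScalarTower.toAlgHom (AlgebraicClosure K) (RatFunc (AlgebraicClosure K))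
          (FunctionField f)).comp (IsScalarTower.toAlgHom (AlgebraicClosure K)
            (AlgebraicClosure K)[X] (RatFunc (AlgebraicClosure K))) := by
      refine Polynomial.algHom_ext ?_
      simp [xFun, AdjoinRoot.algebraMap_eq]
    rw [e]
    rfl
  have h2 := AdjoinRoot.eval₂_root (curvePoly f)
  rw [curvePoly, Polynomial.eval₂_sub, Polynomial.eval₂_pow, Polynomial.eval₂_X,
    Polynomial.eval₂_C, sub_eq_zero] at h2
  rw [h, yFun, h2]

lemma isUnit_of_ne_zero {r : RatFunc (AlgebraicClosure K)} (hr : r ≠ 0) :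
    IsUnit (AdjoinRoot.of (curvePoly f) r) := hr.isUnit.map _

lemma isUnit_xFun_sub (a : AlgebraicClosure K) :
    IsUnit (xFun f - algebraMap (AlgebraicClosure K) (FunctionField f) a) := by
  have h : (RatFunc.X - RatFunc.C a : RatFunc (AlgebraicClosure K)) ≠ 0 := by
    rw [← RatFunc.algebraMap_X, ← RatFunc.algebraMap_C, ← map_sub]
    exact (map_ne_zero_iff _ (RatFunc.algebraMap_injective _)).2 (Polynomial.X_sub_C_ne_zero a)
  have h1 := isUnit_of_ne_zero (f := f) h
  rwa [map_sub] at h1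

/-- The unit `x - a` of the function field. -/
def xSub (f : K[X]) (a : AlgebraicClosure K) : (FunctionField f)ˣ := (isUnit_xFun_sub (f := f) a).unit

lemma xFun_mul_xInvFun : xFun f * xInvFun f = 1 := by
  rw [xFun, xInvFun, ← map_mul, mul_inv_cancel₀ RatFunc.X_ne_zero, map_one]

lemma isUnit_yFun (hf : f ≠ 0) : IsUnit (yFun f) := by
  have h1 : IsUnit (yFun f ^ 2) := by
    have h2 := AdjoinRoot.eval₂_root (curvePoly f)
    rw [curvePoly, Polynomial.eval₂_sub, Polynomial.eval₂_pow, Polynomial.eval₂_X,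
      Polynomial.eval₂_C, sub_eq_zero] at h2
    rw [yFun, h2]
    refine isUnit_of_ne_zero ?_
    refine (map_ne_zero_iff _ (RatFunc.algebraMap_injective _)).2 ?_
    exact (Polynomial.map_ne_zero_iff (algebraMap K (AlgebraicClosure K)).injective).2 hf
  exact (isUnit_pow_iff two_ne_zero).1 h1

lemma sub_eval_mem (P : Fin 2 → AlgebraicClosure K)
    (p : MvPolynomial (Fin 2) (AlgebraicClosure K)) :
    ∃ p₀ p₁ : MvPolynomial (Fin 2) (AlgebraicClosure K), p = MvPolynomial.C (MvPolynomial.aeval P p)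
      + (MvPolynomial.X 0 - MvPolynomial.C (P 0)) * p₀
      + (MvPolynomial.X 1 - MvPolynomial.C (P 1)) * p₁ := by
  induction p using MvPolynomial.induction_on with
  | C a => exact ⟨0, 0, by simp⟩
  | add p q hp hq =>
    obtain ⟨a, b, h⟩ := hp
    obtain ⟨c, d, h'⟩ := hq
    refine ⟨a + c, b + d, ?_⟩
    rw [map_add, map_add]
    linear_combination h + h'
  | mul_X p i hp =>
    obtain ⟨a, b, h⟩ := hp
    rw [map_mul, MvPolynomial.aeval_X, map_mul]
    fin_cases i
    · refine ⟨a * MvPolynomial.X 0 + MvPolynomial.C (MvPolynomial.aeval P p),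
        b * MvPolynomial.X 0, ?_⟩
      simp only [Fin.zero_eta]
      linear_combination MvPolynomial.X 0 * h
    · refine ⟨a * MvPolynomial.X 1,
        b * MvPolynomial.X 1 + MvPolynomial.C (MvPolynomial.aeval P p), ?_⟩
      simp only [Fin.mk_one]
      linear_combination MvPolynomial.X 1 * h

lemma isUniformizer_of {s : Fin 2 → FunctionField f} {P : Fin 2 → AlgebraicClosure K}
    {ϖ : (FunctionField f)ˣ} (h0 : VanishesAt f s P ϖ)
    (h1 : ∀ i, (↑ϖ⁻¹ : FunctionField f) * (s i - algebraMap _ _ (P i)) ∈ localRing f s P) :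
    IsUniformizer f s P ϖ := by
  refine ⟨h0, ?_⟩
  rintro h ⟨p, q, hp, hq, hpq⟩
  obtain ⟨p₀, p₁, e⟩ := sub_eval_mem P p
  rw [hp, map_zero, zero_add] at e
  have key : (↑ϖ⁻¹ : FunctionField f) * h * MvPolynomial.aeval s q ∈ localRing f s P := by
    have e2 : (↑ϖ⁻¹ : FunctionField f) * h * MvPolynomial.aeval s q =
        (↑ϖ⁻¹ * (s 0 - algebraMap _ _ (P 0))) * MvPolynomial.aeval s p₀ +
        (↑ϖ⁻¹ * (s 1 - algebraMap _ _ (P 1))) * MvPolynomial.aeval s p₁ := by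
      rw [mul_assoc, hpq, e]
      simp only [map_add, map_mul, map_sub, MvPolynomial.aeval_X, MvPolynomial.aeval_C]
      ring
    rw [e2]
    have hr (r : MvPolynomial (Fin 2) (AlgebraicClosure K)) :
        MvPolynomial.aeval s r ∈ localRing f s P := ⟨r, 1, by simp, by simp⟩
    exact add_mem (mul_mem (h1 0) (hr _)) (mul_mem (h1 1) (hr _))
  obtain ⟨p', q', hq', hpq'⟩ := key
  exact ⟨p', q * q', by simpa using ⟨hq, hq'⟩, by rw [map_mul, ← mul_assoc, hpq']⟩

/-- A polynomial in one variable as a polynomial in the first of two variables. -/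
def inFirst (g : (AlgebraicClosure K)[X]) : MvPolynomial (Fin 2) (AlgebraicClosure K) :=
  aeval (MvPolynomial.X 0) g

lemma aeval_inFirst {A : Type*} [CommRing A] [Algebra (AlgebraicClosure K) A]
    (s : Fin 2 → A) (g : (AlgebraicClosure K)[X]) :
    MvPolynomial.aeval s (inFirst g) = aeval (s 0) g := by
  rw [inFirst, ← Polynomial.aeval_algHom_apply, MvPolynomial.aeval_X]

lemma exists_uniformizer [NeZero (2 : K)] (hf : f.Separable) (P : AffinePoint f) :
    ∃ ϖ : (FunctionField f)ˣ, IsUniformizer f ![xFun f, yFun f] ![P.x, P.y] ϖ ∧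
      (P.y = 0 → (ϖ : FunctionField f) = yFun f) := by
  obtain ⟨a, b, hP⟩ := P
  dsimp only
  by_cases hb : b = 0
  · subst hb
    rw [zero_pow two_ne_zero] at hP
    refine ⟨(isUnit_yFun hf.ne_zero).unit, isUniformizer_of
      ⟨MvPolynomial.X 1, 1, by simp, by simp, by simp⟩ ?_, fun _ => rfl⟩
    obtain ⟨g, hg⟩ := Polynomial.dvd_iff_isRoot.2 (show (fbar f).IsRoot a from hP.symm)
    have hga : g.eval a ≠ 0 := by
      have hs : (fbar f).Separable := hf.map
      have := hs.eval₂_derivative_ne_zero (RingHom.id _) (x := a)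
        (by simpa [Polynomial.eval₂_id] using hP.symm)
      rw [hg] at this
      simpa [Polynomial.eval₂_id] using this
    have hy2 := yFun_sq (f := f)
    rw [hg, map_mul, map_sub, Polynomial.aeval_X, Polynomial.aeval_C] at hy2
    intro i
    fin_cases i
    · refine ⟨MvPolynomial.X 1, inFirst g, ?_, ?_⟩
      · rw [aeval_inFirst]
        simpa using hga
      · rw [aeval_inFirst, mul_assoc, Units.inv_mul_eq_iff_eq_mul]
        simp only [Fin.zero_eta, Matrix.cons_val_zero, MvPolynomial.aeval_X, Matrix.cons_val_one,
          Matrix.cons_val_fin_one, IsUnit.unit_spec]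
        rw [← hy2, sq]
    · refine ⟨1, 1, by simp, ?_⟩
      simp
  · refine ⟨xSub f a, isUniformizer_of
      ⟨MvPolynomial.X 0 - MvPolynomial.C a, 1, by simp, by simp, by simp [xSub]⟩ ?_,
      fun h => absurd h hb⟩
    obtain ⟨g, hg⟩ := Polynomial.dvd_iff_isRoot.2
      (show (fbar f - C (b ^ 2)).IsRoot a by simp [hP])
    have hy2 : yFun f ^ 2 - algebraMap _ _ (b ^ 2) =
        (xFun f - algebraMap _ _ a) * aeval (xFun f) g := by
      have := congr_arg (aeval (xFun f)) hg
      rw [map_sub, ← yFun_sq, map_mul, map_sub, Polynomial.aeval_X, Polynomial.aeval_C,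
        Polynomial.aeval_C] at this
      exact this
    intro i
    fin_cases i
    · refine ⟨1, 1, by simp, ?_⟩
      simp [xSub]
    · refine ⟨inFirst g, MvPolynomial.X 1 + MvPolynomial.C b, ?_, ?_⟩
      · have h2 : (2 : AlgebraicClosure K) ≠ 0 := by
          have := (map_ne_zero (algebraMap K (AlgebraicClosure K))).2 (NeZero.ne (2 : K))
          rwa [map_ofNat] at this
        simpa [← two_mul] using ⟨h2, hb⟩
      · rw [aeval_inFirst, mul_assoc, Units.inv_mul_eq_iff_eq_mul]
        simp only [Fin.mk_one, Matrix.cons_val_zero, MvPolynomial.aeval_X, Matrix.cons_val_one,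
          Matrix.cons_val_fin_one, xSub, IsUnit.unit_spec, map_add, MvPolynomial.aeval_C]
        rw [← hy2, map_pow]
        ring

/-- The Weierstrass point `(α, 0)` attached to a root `α` of `f`. -/
def weierstrassPoint (α : AlgebraicClosure K) (hα : (fbar f).eval α = 0) : AffinePoint f :=
  ⟨α, 0, by simpa using hα.symm⟩

open Classical in
lemma order_xSub (hf : f.Separable) {α : AlgebraicClosure K} (hα : (fbar f).eval α = 0)
    (P : AffinePoint f) {ϖ : (FunctionField f)ˣ} (hϖ : P.y = 0 → (ϖ : FunctionField f) = yFun f) :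
    (↑(xSub f α * ϖ ^ (-(if P = weierstrassPoint α hα then 2 else 0 : ℤ))) : FunctionField f) ∈
        localRing f ![xFun f, yFun f] ![P.x, P.y] ∧
    (↑(xSub f α * ϖ ^ (-(if P = weierstrassPoint α hα then 2 else 0 : ℤ)))⁻¹ : FunctionField f) ∈
        localRing f ![xFun f, yFun f] ![P.x, P.y] := by
  split_ifs with h
  · subst h
    specialize hϖ rfl
    obtain ⟨g, hg⟩ := Polynomial.dvd_iff_isRoot.2 (show (fbar f).IsRoot α from hα)
    have hga : g.eval α ≠ 0 := by
      have hs : (fbar f).Separable := hf.map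
      have := hs.eval₂_derivative_ne_zero (RingHom.id _) (x := α)
        (by simpa [Polynomial.eval₂_id] using hα)
      rw [hg] at this
      simpa [Polynomial.eval₂_id] using this
    have hy2 := yFun_sq (f := f)
    rw [hg, map_mul, map_sub, Polynomial.aeval_X, Polynomial.aeval_C] at hy2
    have key : (↑(xSub f α * ϖ ^ (-2 : ℤ)) : FunctionField f) * aeval (xFun f) g = 1 := by
      rw [zpow_neg, Units.val_mul, mul_right_comm, Units.mul_inv_eq_iff_eq_mul, one_mul]
      simp only [xSub, IsUnit.unit_spec, zpow_ofNat, Units.val_pow_eq_pow_val, hϖ]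
      exact hy2.symm
    refine ⟨⟨1, inFirst g, ?_, ?_⟩, ⟨inFirst g, 1, by simp, ?_⟩⟩
    · rw [aeval_inFirst]
      simpa [weierstrassPoint] using hga
    · rw [aeval_inFirst, map_one]
      exact key
    · rw [aeval_inFirst, map_one, mul_one]
      exact Units.inv_eq_of_mul_eq_one_right key
  · have ha : P.x ≠ α := by
      intro ha
      refine h (AffinePoint.ext ha ?_)
      have := P.eq
      rw [ha, hα] at this
      exact pow_eq_zero_iff two_ne_zero |>.1 this
    rw [neg_zero, zpow_zero, mul_one]
    refine ⟨⟨MvPolynomial.X 0 - MvPolynomial.C α, 1, by simp, by simp [xSub]⟩,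
      ⟨1, MvPolynomial.X 0 - MvPolynomial.C α, by simpa [sub_eq_zero] using ha, ?_⟩⟩
    rw [Units.inv_mul_eq_iff_eq_mul]
    simp [xSub]

lemma mul_inv_mul_zpow {G : Type*} [CommGroup G] (a b c : G) (m n : ℤ) :
    a * b⁻¹ * c ^ (-(m - n)) = a * c ^ (-m) * (b * c ^ (-n))⁻¹ := by
  rw [mul_inv, ← zpow_neg, neg_neg, mul_mul_mul_comm, ← zpow_add]
  congr 2
  ring

/-- The divisor `(α, 0) - (β, 0)` attached to two roots `α`, `β` of `f`. -/
def rootDivisor {α β : AlgebraicClosure K} (hα : (fbar f).eval α = 0) (hβ : (fbar f).eval β = 0) :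
    divisorsDegZero f :=
  ⟨Finsupp.single (weierstrassPoint α hα) 1 - Finsupp.single (weierstrassPoint β hβ) 1, by
    rw [AddMonoidHom.mem_ker, map_sub]
    simp [divisorDegree]⟩

lemma two_nsmul_rootDivisor [NeZero (2 : K)] (hf : f.Separable) {α β : AlgebraicClosure K}
    (hα : (fbar f).eval α = 0) (hβ : (fbar f).eval β = 0) :
    ((2 • rootDivisor hα hβ : divisorsDegZero f) : Divisor f) ∈ principalDivisors f := by
  classical
  refine AddSubgroup.subset_closure ⟨xSub f α * (xSub f β)⁻¹, fun P => ?_, fun w => ?_⟩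
  · obtain ⟨ϖ, h1, h2⟩ := exists_uniformizer hf P
    have e : ((2 • rootDivisor hα hβ : divisorsDegZero f) : Divisor f) P =
        (if P = weierstrassPoint α hα then 2 else 0 : ℤ) -
        (if P = weierstrassPoint β hβ then 2 else 0 : ℤ) := by
      rw [AddSubgroup.coe_nsmul, rootDivisor, Finsupp.smul_apply, Finsupp.sub_apply,
        Finsupp.single_apply, Finsupp.single_apply]
      simp only [eq_comm (b := P)]
      split_ifs <;> simp
    rw [e]
    obtain ⟨ha, ha'⟩ := order_xSub hf hα P h2
    obtain ⟨hb, hb'⟩ := order_xSub hf hβ P h2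
    refine ⟨ϖ, h1, ?_, ?_⟩
    · convert mul_mem ha hb' using 1
      rw [← Units.val_mul]
      congr 1
      exact mul_inv_mul_zpow _ _ _ _ _
    · convert mul_mem ha' hb using 1
      rw [← Units.val_mul]
      congr 1
      rw [mul_inv_mul_zpow, mul_inv, inv_inv]
  · refine ⟨MvPolynomial.C (β - α) * MvPolynomial.X 0,
      1 - MvPolynomial.C β * MvPolynomial.X 0, by simp, by simp, ?_⟩
    have hx := xFun_mul_xInvFun (f := f)
    have hb : (↑(xSub f β)⁻¹ : FunctionField f) * (xFun f - algebraMap _ _ β) = 1 :=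
      Units.inv_mul (xSub f β)
    have ha : (↑(xSub f α) : FunctionField f) = xFun f - algebraMap _ _ α := rfl
    simp only [map_mul, map_sub, map_one, MvPolynomial.aeval_C, MvPolynomial.aeval_X,
      Matrix.cons_val_zero, Units.val_mul, ha]
    linear_combination (xInvFun f * (xFun f - algebraMap _ _ α)) * hb -
      ((xFun f - algebraMap _ _ α) * (↑(xSub f β)⁻¹ : FunctionField f) - 1) * hx

end Torsion

section Etale

variable {K : Type u} [Field K]

/-- The action of the Galois group on the geometric points of a `K`-algebra `M`. -/
def galPoint {M : Type u} [CommRing M] [Algebra K M] (σ : GalK K) (s : M →ₐ[K] AlgebraicClosure K) :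
    M →ₐ[K] AlgebraicClosure K :=
  AlgHom.comp (σ : AlgebraicClosure K →ₐ[K] AlgebraicClosure K) s

/-- `Ind_K^M 𝔽₂` for a finite étale `K`-algebra `M`: the `𝔽₂`-vector space on the set of geometric
points `Hom_K(M, K̄)`, permuted by `G_K`. For `M = ∏ Mⱼ` with fields `Mⱼ` the geometric points of `M`
are the disjoint union of the transitive `G_K`-sets `Hom_K(Mⱼ, K̄) = G_K / G_{Mⱼ}`, so that this is
the direct sum of the modules `Ind_{G_{Mⱼ}}^{G_K} 𝔽₂`. -/
def indRep (M : Type u) [CommRing M] [Algebra K M] :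
    Representation (ZMod 2) (GalK K) ((M →ₐ[K] AlgebraicClosure K) →₀ ZMod 2) where
  toFun σ := Finsupp.lmapDomain (ZMod 2) (ZMod 2) (galPoint σ)
  map_one' := Finsupp.lmapDomain_id (ZMod 2) (ZMod 2)
  map_mul' σ τ := Finsupp.lmapDomain_comp (ZMod 2) (ZMod 2) (galPoint τ) (galPoint σ)

variable (f : K[X])

/-- The étale algebra `K_{f,2} = K[x, y, 1 / (x - y)] / (f(x), f(y))`, presented with the three
generators `x`, `y` and `1 / (x - y)`. -/
abbrev EtaleTwo : Type u :=
  MvPolynomial (Fin 3) K ⧸ Ideal.span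
    ({aeval (MvPolynomial.X 0) f, aeval (MvPolynomial.X 1) f,
      MvPolynomial.X 2 * (MvPolynomial.X 0 - MvPolynomial.X 1) - 1} : Set (MvPolynomial (Fin 3) K))

/-- The classes of `x`, `y` and `1 / (x - y)` in `K_{f,2}`. -/
def EtaleTwo.var (i : Fin 3) : EtaleTwo f := Ideal.Quotient.mk _ (MvPolynomial.X i)

lemma EtaleTwo.aeval_mk {A : Type*} [CommRing A] [Algebra K A] (φ : EtaleTwo f →ₐ[K] A)
    (p : MvPolynomial (Fin 3) K) :
    φ (Ideal.Quotient.mk _ p) = MvPolynomial.aeval (fun i => φ (EtaleTwo.var f i)) p := by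
  have : (φ.comp (Ideal.Quotient.mkₐ K _)) = MvPolynomial.aeval (fun i => φ (EtaleTwo.var f i)) :=
    MvPolynomial.algHom_ext fun i => by simp [EtaleTwo.var]
  exact congr($this p)

lemma EtaleTwo.aeval_f (i : Fin 3) (hi : i = 0 ∨ i = 1) : aeval (EtaleTwo.var f i) f = 0 := by
  have h : aeval (EtaleTwo.var f i) f =
      Ideal.Quotient.mkₐ K _ (aeval (MvPolynomial.X i : MvPolynomial (Fin 3) K) f) := by
    rw [← Polynomial.aeval_algHom_apply]; rfl
  rw [h]
  refine Ideal.Quotient.eq_zero_iff_mem.2 (Ideal.subset_span ?_)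
  rcases hi with rfl | rfl <;> simp

lemma EtaleTwo.inv_mul :
    EtaleTwo.var f 2 * (EtaleTwo.var f 0 - EtaleTwo.var f 1) = 1 := by
  rw [← sub_eq_zero]
  exact Ideal.Quotient.eq_zero_iff_mem.2 (Ideal.subset_span (by simp))

/-- The endomorphism of `K_{f,2}` that interchanges the classes of `x` and `y`. -/
def EtaleTwo.swap : EtaleTwo f →ₐ[K] EtaleTwo f :=
  Ideal.Quotient.liftₐ _
    (MvPolynomial.aeval ![EtaleTwo.var f 1, EtaleTwo.var f 0, -EtaleTwo.var f 2]) (by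
    intro p hp
    refine Submodule.span_induction (p := fun p _ => MvPolynomial.aeval
      ![EtaleTwo.var f 1, EtaleTwo.var f 0, -EtaleTwo.var f 2] p = 0) ?_ (map_zero _)
      (fun a b _ _ ha hb => by rw [map_add, ha, hb, add_zero])
      (fun a b _ hb => by rw [smul_eq_mul, map_mul, hb, mul_zero]) hp
    rintro q (rfl | rfl | rfl)
    · rw [← Polynomial.aeval_algHom_apply, MvPolynomial.aeval_X]
      exact EtaleTwo.aeval_f f 1 (Or.inr rfl)
    · rw [← Polynomial.aeval_algHom_apply, MvPolynomial.aeval_X]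
      exact EtaleTwo.aeval_f f 0 (Or.inl rfl)
    · have := EtaleTwo.inv_mul f
      simp only [map_sub, map_mul, MvPolynomial.aeval_X, map_one, Matrix.cons_val]
      linear_combination this)

@[simp] lemma EtaleTwo.swap_zero : swap f (var f 0) = var f 1 := by
  refine (Ideal.Quotient.lift_mk _ _ _).trans ?_
  simp
@[simp] lemma EtaleTwo.swap_one : swap f (var f 1) = var f 0 := by
  refine (Ideal.Quotient.lift_mk _ _ _).trans ?_
  simp
@[simp] lemma EtaleTwo.swap_two : swap f (var f 2) = -var f 2 := by
  refine (Ideal.Quotient.lift_mk _ _ _).trans ?_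
  simp

lemma EtaleTwo.algHom_ext {A : Type*} [CommRing A] [Algebra K A] {φ ψ : EtaleTwo f →ₐ[K] A}
    (h : ∀ i, φ (var f i) = ψ (var f i)) : φ = ψ := by
  refine AlgHom.ext fun b => ?_
  obtain ⟨p, rfl⟩ := Ideal.Quotient.mk_surjective b
  rw [aeval_mk, aeval_mk]
  simp [h]

lemma EtaleTwo.swap_swap (b : EtaleTwo f) : swap f (swap f b) = b := by
  have : (swap f).comp (swap f) = AlgHom.id K _ := by
    refine EtaleTwo.algHom_ext f fun i => ?_
    fin_cases i
    · simp
    · simp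
    · simp
  exact congr($this b)

/-- `K_f^{(2)}`, the subalgebra of `K_{f,2}` fixed by the interchange of `x` and `y`. -/
def EtaleSym : Subalgebra K (EtaleTwo f) := AlgHom.equalizer (EtaleTwo.swap f) (AlgHom.id K _)

lemma mem_etaleSym {b : EtaleTwo f} : b ∈ EtaleSym f ↔ EtaleTwo.swap f b = b := Iff.rfl

variable {f}

lemma eval_root (t : EtaleTwo f →ₐ[K] AlgebraicClosure K) (i : Fin 3) (hi : i = 0 ∨ i = 1) :
    (fbar f).eval (t (EtaleTwo.var f i)) = 0 := by
  rw [Polynomial.eval_map_algebraMap, Polynomial.aeval_algHom_apply, EtaleTwo.aeval_f f i hi,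
    map_zero]

/-- Two geometric points of `K_{f,2}` with the same restriction to `K_f^{(2)}` agree up
to the interchange. -/
lemma eq_or_swap {t t' : EtaleTwo f →ₐ[K] AlgebraicClosure K}
    (h : t.comp (EtaleSym f).val = t'.comp (EtaleSym f).val) :
    t = t' ∨ t = t'.comp (EtaleTwo.swap f) := by
  have hs (b : EtaleTwo f) (hb : b ∈ EtaleSym f) : t b = t' b := congr($h ⟨b, hb⟩)
  have h1 := hs (EtaleTwo.var f 0 + EtaleTwo.var f 1) (by
    rw [mem_etaleSym, map_add]; simp [add_comm])
  have h2 := hs (EtaleTwo.var f 0 * EtaleTwo.var f 1) (by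
    rw [mem_etaleSym, map_mul]; simp [mul_comm])
  rw [map_add, map_add] at h1
  rw [map_mul, map_mul] at h2
  have inv (s : EtaleTwo f →ₐ[K] AlgebraicClosure K) :
      s (EtaleTwo.var f 2) * (s (EtaleTwo.var f 0) - s (EtaleTwo.var f 1)) = 1 := by
    rw [← map_sub, ← map_mul, EtaleTwo.inv_mul, map_one]
  have key : (t (EtaleTwo.var f 0) - t' (EtaleTwo.var f 0)) *
      (t (EtaleTwo.var f 0) - t' (EtaleTwo.var f 1)) = 0 := by
    linear_combination (t (EtaleTwo.var f 0)) * h1 - h2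
  rcases mul_eq_zero.1 key with h3 | h3
  · left
    have e0 : t (EtaleTwo.var f 0) = t' (EtaleTwo.var f 0) := sub_eq_zero.1 h3
    have e1 : t (EtaleTwo.var f 1) = t' (EtaleTwo.var f 1) := by linear_combination h1 - e0
    refine EtaleTwo.algHom_ext f fun i => ?_
    fin_cases i
    · exact e0
    · exact e1
    · have i1 := inv t
      have i2 := inv t'
      rw [e0, e1] at i1
      exact mul_right_cancel₀ (right_ne_zero_of_mul_eq_one i2) (i1.trans i2.symm)
  · right
    have e0 : t (EtaleTwo.var f 0) = t' (EtaleTwo.var f 1) := sub_eq_zero.1 h3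
    have e1 : t (EtaleTwo.var f 1) = t' (EtaleTwo.var f 0) := by linear_combination h1 - e0
    refine EtaleTwo.algHom_ext f fun i => ?_
    fin_cases i
    · simpa using e0
    · simpa using e1
    · have i1 := inv t
      have i2 := inv t'
      rw [e0, e1] at i1
      refine mul_right_cancel₀ (right_ne_zero_of_mul_eq_one i1) (i1.trans ?_)
      simp
      linear_combination -i2

/-- A homomorphism to an algebraically closed field extends along an integral ring extension. -/
lemma exists_extension_of_isIntegral {S B L : Type u} [CommRing S] [CommRing B] [Field L]
    [IsAlgClosed L] [Algebra K S] [Algebra K B] [Algebra K L] [Algebra S B] [IsScalarTower K S B]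
    [Algebra.IsIntegral S B] (hinj : Function.Injective (algebraMap S B)) (s : S →ₐ[K] L) :
    ∃ t : B →ₐ[K] L, t.comp (IsScalarTower.toAlgHom K S B) = s := by
  have hprime : (RingHom.ker s).IsPrime := RingHom.ker_isPrime s
  obtain ⟨Q, -, hQ, hQ'⟩ := Ideal.exists_ideal_over_prime_of_isIntegral (S := B)
    (RingHom.ker s) ⊥ (by
      rw [← RingHom.ker_eq_comap_bot, (RingHom.injective_iff_ker_eq_bot _).1 hinj]
      exact bot_le)
  let s' : S ⧸ Q.comap (algebraMap S B) →+* L :=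
    Ideal.Quotient.lift _ (s : S →+* L) fun a ha => by
      rw [hQ'] at ha; exact ha
  have hs' : Function.Injective s' := by
    refine (injective_iff_map_eq_zero s').2 fun a ha => ?_
    obtain ⟨a, rfl⟩ := Ideal.Quotient.mk_surjective a
    refine Ideal.Quotient.eq_zero_iff_mem.2 ?_
    rw [hQ']; exact ha
  let : Algebra (S ⧸ Q.comap (algebraMap S B)) L := s'.toAlgebra
  have : FaithfulSMul (S ⧸ Q.comap (algebraMap S B)) L :=
    (faithfulSMul_iff_algebraMap_injective _ _).2 hs'
  have : FaithfulSMul (S ⧸ Q.comap (algebraMap S B)) (B ⧸ Q) :=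
    (faithfulSMul_iff_algebraMap_injective _ _).2 Ideal.algebraMap_quotient_injective
  have : IsDomain (S ⧸ Q.comap (algebraMap S B)) := hs'.isDomain s'
  have : IsDomain (B ⧸ Q) := Ideal.Quotient.isDomain Q
  have : Module.IsTorsionFree (S ⧸ Q.comap (algebraMap S B)) (B ⧸ Q) :=
    FaithfulSMul.to_isTorsionFree _ _
  let t' : B ⧸ Q →ₐ[S ⧸ Q.comap (algebraMap S B)] L := IsAlgClosed.lift
  have ht (a : S) : t' (Ideal.Quotient.mk Q (algebraMap _ _ a)) = s a :=
    t'.commutes (Ideal.Quotient.mk _ a)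
  refine ⟨⟨(t' : B ⧸ Q →+* L).comp (Ideal.Quotient.mk Q), fun c => ?_⟩, AlgHom.ext ht⟩
  have := (ht (algebraMap K S c)).trans (s.commutes c)
  rwa [← IsScalarTower.algebraMap_apply] at this

/-- Every geometric point of `K_f^{(2)}` extends to `K_{f,2}`. -/
lemma exists_extension (s : EtaleSym f →ₐ[K] AlgebraicClosure K) :
    ∃ t : EtaleTwo f →ₐ[K] AlgebraicClosure K, t.comp (EtaleSym f).val = s := by
  have hint : Algebra.IsIntegral (EtaleSym f) (EtaleTwo f) := by
    refine ⟨fun b => ?_⟩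
    have h1 : b + EtaleTwo.swap f b ∈ EtaleSym f := by
      rw [mem_etaleSym, map_add, EtaleTwo.swap_swap, add_comm]
    have h2 : b * EtaleTwo.swap f b ∈ EtaleSym f := by
      rw [mem_etaleSym, map_mul, EtaleTwo.swap_swap, mul_comm]
    refine ⟨X ^ 2 - C ⟨_, h1⟩ * X + C ⟨_, h2⟩, by monicity!, ?_⟩
    simp only [eval₂_add, eval₂_sub, eval₂_mul, eval₂_pow, eval₂_X, eval₂_C]
    change b ^ 2 - (b + EtaleTwo.swap f b) * b + b * EtaleTwo.swap f b = 0
    ring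
  exact exists_extension_of_isIntegral (S := EtaleSym f) (B := EtaleTwo f) Subtype.val_injective s

end Etale

section PairMap

variable {K : Type u} [Field K] {f : K[X]}

/-- For a geometric point `t` of `K_{f,2}`, that is, an ordered pair `(α, β)` of distinct roots of
`f`, the class of the divisor `(α, 0) - (β, 0)` in `J_𝔪[2]`. -/
def rootClass [NeZero (2 : K)] (hf : f.Separable) (t : EtaleTwo f →ₐ[K] AlgebraicClosure K) : GenJacobianTwo f :=
  ⟨QuotientAddGroup.mk
      (rootDivisor (eval_root t 0 (Or.inl rfl)) (eval_root t 1 (Or.inr rfl))), by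
    refine (AddSubgroup.torsionBy.nsmul_iff (n := 2)).2 ?_
    rw [← QuotientAddGroup.mk_nsmul, QuotientAddGroup.eq_zero_iff, AddSubgroup.mem_addSubgroupOf]
    exact two_nsmul_rootDivisor hf _ _⟩

lemma galJacobianTwo_rootClass [NeZero (2 : K)] (hf : f.Separable) (σ : GalK K)
    (t : EtaleTwo f →ₐ[K] AlgebraicClosure K) :
    galJacobianTwo f σ (rootClass hf t) = rootClass hf (galPoint σ t) := by
  have key (α : AlgebraicClosure K) (hα : (fbar f).eval α = 0) (hα' : (fbar f).eval (σ α) = 0) :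
      σ • weierstrassPoint α hα = weierstrassPoint (σ α) hα' := by
    refine AffinePoint.ext rfl ?_
    exact map_zero σ
  refine Subtype.ext ?_
  change galJacobian f σ (QuotientAddGroup.mk _) = QuotientAddGroup.mk _
  rw [galJacobian_mk]
  congr 1
  refine Subtype.ext ?_
  change galDivisor f σ (Finsupp.single _ 1 - Finsupp.single _ 1) =
    Finsupp.single _ 1 - Finsupp.single _ 1
  rw [map_sub]
  simp only [galDivisor, Finsupp.mapDomain.addMonoidHom_apply, Finsupp.mapDomain_single]
  rw [key (t _) (eval_root t 0 (Or.inl rfl)) (eval_root (galPoint σ t) 0 (Or.inl rfl)),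
    key (t _) (eval_root t 1 (Or.inr rfl)) (eval_root (galPoint σ t) 1 (Or.inr rfl))]
  rfl

lemma rootClass_swap [NeZero (2 : K)] (hf : f.Separable) (t : EtaleTwo f →ₐ[K] AlgebraicClosure K) :
    rootClass hf (t.comp (EtaleTwo.swap f)) = rootClass hf t := by
  have h1 : rootClass hf (t.comp (EtaleTwo.swap f)) = -rootClass hf t := by
    refine Subtype.ext ?_
    change QuotientAddGroup.mk _ = -QuotientAddGroup.mk _
    rw [← QuotientAddGroup.mk_neg]
    congr 1
    refine Subtype.ext ?_
    change Finsupp.single _ 1 - Finsupp.single _ 1 = -(Finsupp.single _ 1 - Finsupp.single _ 1)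
    rw [neg_sub]
    simp
  have h2 : (2 : ℕ) • rootClass hf t = 0 := AddSubgroup.torsionBy.nsmul (n := 2) _
  rw [h1, neg_eq_iff_add_eq_zero, ← two_nsmul, h2]

/-- For a geometric point of `K_f^{(2)}`, that is, an unordered pair `{α, β}` of distinct roots
of `f`, the class of `(α, 0) - (β, 0)` in `J_𝔪[2]`; it does not depend on the order of `α` and `β`,
see `pairClass_eq`. -/
def pairClass [NeZero (2 : K)] (hf : f.Separable) (s : EtaleSym f →ₐ[K] AlgebraicClosure K) : GenJacobianTwo f :=
  rootClass hf (exists_extension s).choose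

/-- `pairClass` may be computed from any ordering of the pair. -/
lemma pairClass_eq [NeZero (2 : K)] (hf : f.Separable) (t : EtaleTwo f →ₐ[K] AlgebraicClosure K) :
    pairClass hf (t.comp (EtaleSym f).val) = rootClass hf t := by
  rcases eq_or_swap (exists_extension (t.comp (EtaleSym f).val)).choose_spec with h | h
  · rw [pairClass, h]
  · rw [pairClass, h, rootClass_swap]

/-- The homomorphism of `G_K`-modules from `Ind_K^{K_f^{(2)}} 𝔽₂` to `J_𝔪[2]` that sends the basis
vector of an unordered pair `{α, β}` of distinct roots of `f` to the class of `(α, 0) - (β, 0)`. Under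
the identification of `J_𝔪[2]` with the even sums of roots it is `α ∧ β ↦ α + β`. -/
def pairMap [NeZero (2 : K)] (hf : f.Separable) :
    (indRep (K := K) (EtaleSym f)).IntertwiningMap (jacobianTwoRep f) where
  toLinearMap := Finsupp.linearCombination (ZMod 2) (pairClass hf)
  isIntertwining' σ := by
    refine Finsupp.lhom_ext fun s c => ?_
    obtain ⟨t, rfl⟩ := exists_extension s
    have e : galPoint σ (t.comp (EtaleSym f).val) = (galPoint σ t).comp (EtaleSym f).val := rfl
    change Finsupp.linearCombination (ZMod 2) (pairClass hf)
      (Finsupp.mapDomain (galPoint σ) (Finsupp.single _ c)) = jacobianTwoRep f σ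
        (Finsupp.linearCombination (ZMod 2) (pairClass hf) (Finsupp.single _ c))
    rw [Finsupp.mapDomain_single, Finsupp.linearCombination_single,
      Finsupp.linearCombination_single, map_smul, pairClass_eq, e, pairClass_eq]
    congr 1
    exact (galJacobianTwo_rootClass hf σ t).symm

/-- The basis vector of `Ind_K^{K_f^{(2)}} 𝔽₂` attached to the unordered pair underlying an ordered
pair of distinct roots of `f`. -/
def pairVector (t : EtaleTwo f →ₐ[K] AlgebraicClosure K) :
    (EtaleSym f →ₐ[K] AlgebraicClosure K) →₀ ZMod 2 :=
  Finsupp.single (t.comp (EtaleSym f).val) 1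

end PairMap

end

end EvenHyperelliptic

open EvenHyperelliptic

/-! Let `R` be the set of roots of `f` in the algebraic closure, and read the permutation module on
unordered pairs as the space of graphs on the vertex set `R`, modulo 2. Two facts are needed.

(1) `J_𝔪[2]` is the space of even subsets of `R`, with the class of `(α, 0) - (β, 0)` corresponding
to `{α, β}` (`exists_coordinates`, `span_rootClass`). Both halves use the involution `y ↦ -y`,
written `u ↦ ū`. A function that is congruent to `1` modulo `𝔪` and has trivial divisor is `1`
(`eq_one_of_divisorOf_eq_zero`). Hence if `h ≡ 1` has a divisor supported at the Weierstrass points,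
then `h = h̄` is a function of `x`, and its orders at these points are even
(`even_of_mem_principalDivisors`). Conversely, if `2D = div h`, dividing `h` by a function of `x`
with divisor `D + D̄` gives a function of norm `1`, which by Hilbert 90 is `u / ū` with `u ≡ 1`.
Then `D - div u` is invariant under the involution, and functions of `x` move it to the Weierstrass
points (`exists_sub_mem_principalDivisors`).

(2) In these terms `φ` takes a graph to its set of vertices of odd degree, and `ι`, given by the `2
× 2` minors of the coordinates, takes `v ∧ w` for two edges of a triangle to the triangle. Fixing a
root `α₀`, the triangles through `α₀` correspond to a basis of `∧² J_𝔪[2]`, and the edges at `α₀`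
split `φ`. So `0 → ∧² J_𝔪[2] → Ind → J_𝔪[2] → 0` is exact, with linear splittings `pairsToWedge` and
`jacobianToPairs` that need not be equivariant.

The long exact sequence identifies `H¹(∧² J_𝔪[2])` with the kernel of `φ_*` as soon as the
connecting map from `H⁰(J_𝔪[2])` vanishes, that is, as soon as invariant vectors lift to invariant
vectors. An invariant even set `S` lifts to the complete graph on `S`: it is invariant, and each
vertex of `S` has degree `|S| - 1`, which is odd (`IsCoordinates.exists_invariant_lift`). -/

open CategoryTheory Limits

namespace EvenHyperelliptic
noncomputable section
universe u

/-! ### Homology of complexes of topological modules, elementwise -/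

section TopModuleHomology

variable {R : Type*} [Ring R] [TopologicalSpace R] {ι : Type*} {c : ComplexShape ι}
  (A : HomologicalComplex (TopModuleCat R) c)

/-- The object of cycles is the kernel of the differential. -/
def cyclesIsoKer {i j : ι} (hj : c.next i = j) : A.cycles i ≅ TopModuleCat.ker (A.d i j) :=
  IsLimit.conePointUniqueUpToIso (A.cyclesIsKernel i j hj) (TopModuleCat.isLimitKer (A.d i j))

lemma cyclesIsoKer_hom_coe {i j : ι} (hj : c.next i = j) (z : A.cycles i) :
    (((cyclesIsoKer A hj).hom.hom z : TopModuleCat.ker (A.d i j)) : A.X i) =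
      (A.iCycles i).hom z := by
  have := IsLimit.conePointUniqueUpToIso_hom_comp (A.cyclesIsKernel i j hj)
    (TopModuleCat.isLimitKer (A.d i j)) WalkingParallelPair.zero
  exact congr(($this).hom z)

lemma TopModuleCat.hom_inv_apply {M N : TopModuleCat R} (e : M ≅ N) (x : M) :
    e.inv.hom (e.hom.hom x) = x := congr(($e.hom_inv_id).hom x)

lemma TopModuleCat.inv_hom_apply {M N : TopModuleCat R} (e : M ≅ N) (x : N) :
    e.hom.hom (e.inv.hom x) = x := congr(($e.inv_hom_id).hom x)

lemma iCycles_injective (j : ι) : Function.Injective (A.iCycles j).hom := by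
  intro x y h
  rw [← cyclesIsoKer_hom_coe A rfl, ← cyclesIsoKer_hom_coe A rfl] at h
  rw [← TopModuleCat.hom_inv_apply (cyclesIsoKer A rfl) x, Subtype.ext h,
    TopModuleCat.hom_inv_apply]

lemma exists_iCycles_eq {i j : ι} (hij : c.Rel i j) (x : A.X i) (hx : (A.d i j).hom x = 0) :
    ∃ z, (A.iCycles i).hom z = x := by
  refine ⟨(cyclesIsoKer A (c.next_eq' hij)).inv.hom ⟨x, hx⟩, ?_⟩
  rw [← cyclesIsoKer_hom_coe A (c.next_eq' hij), TopModuleCat.inv_hom_apply]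

/-- Homology is the cokernel of the map to the cycles. -/
def homologyIsoCoker {i j : ι} (hi : c.prev j = i) :
    A.homology j ≅ TopModuleCat.coker (A.toCycles i j) :=
  IsColimit.coconePointUniqueUpToIso (A.homologyIsCokernel i j hi)
    (TopModuleCat.isColimitCoker (A.toCycles i j))

lemma homologyIsoCoker_hom_homologyπ {i j : ι} (hi : c.prev j = i) (z : A.cycles j) :
    (homologyIsoCoker A hi).hom.hom ((A.homologyπ j).hom z) =
      (TopModuleCat.cokerπ (A.toCycles i j)).hom z := by
  have := IsColimit.comp_coconePointUniqueUpToIso_hom (A.homologyIsCokernel i j hi)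
    (TopModuleCat.isColimitCoker (A.toCycles i j)) WalkingParallelPair.one
  exact congr(($this).hom z)

lemma homologyπ_surjective (j : ι) : Function.Surjective (A.homologyπ j).hom := by
  intro x
  obtain ⟨z, hz⟩ := TopModuleCat.cokerπ_surjective _ ((homologyIsoCoker A (i := c.prev j) rfl).hom.hom x)
  refine ⟨z, ?_⟩
  rw [← homologyIsoCoker_hom_homologyπ A rfl] at hz
  rw [← TopModuleCat.hom_inv_apply (homologyIsoCoker A rfl) x, ← hz,
    TopModuleCat.hom_inv_apply]

/-- The cokernel of topological modules is the quotient by the image itself, not by its closure, so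
vanishing in homology is the purely algebraic condition of being a boundary. -/
lemma homologyπ_eq_zero_iff {i j : ι} (hij : c.Rel i j) (z : A.cycles j) :
    (A.homologyπ j).hom z = 0 ↔ ∃ y : A.X i, (A.d i j).hom y = (A.iCycles j).hom z := by
  have e (y : A.X i) : (A.d i j).hom y = (A.iCycles j).hom ((A.toCycles i j).hom y) :=
    (congr(($(A.toCycles_i i j)).hom y)).symm
  have h : (A.homologyπ j).hom z = 0 ↔
      (TopModuleCat.cokerπ (A.toCycles i j)).hom z = 0 := by
    rw [← homologyIsoCoker_hom_homologyπ A (c.prev_eq' hij)]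
    refine ⟨fun h => by rw [h, map_zero], fun h => ?_⟩
    rw [← TopModuleCat.hom_inv_apply (homologyIsoCoker A (c.prev_eq' hij))
      ((A.homologyπ j).hom z), h, map_zero]
  rw [h, TopModuleCat.hom_cokerπ, Submodule.mkQ_apply, Submodule.Quotient.mk_eq_zero]
  simp only [e, (iCycles_injective A j).eq_iff]
  rfl

/-- Elementwise form of the long exact sequence: for morphisms of complexes that are degreewise
as in an exact sequence near degree `j`, the first map is injective on homology if classes
of degree `i` lift, and its range is the kernel of the second map. -/
lemma homologyMap_injective {A B : HomologicalComplex (TopModuleCat R) c} (f : A ⟶ B) {i j : ι}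
    (hij : c.Rel i j)
    (h : ∀ (x : A.X j) (y : B.X i), (B.d i j).hom y = (f.f j).hom x →
      ∃ a : A.X i, (A.d i j).hom a = x) :
    Function.Injective (HomologicalComplex.homologyMap f j).hom := by
  rw [injective_iff_map_eq_zero]
  intro ξ hξ
  obtain ⟨z, rfl⟩ := homologyπ_surjective A j ξ
  have e : (HomologicalComplex.homologyMap f j).hom ((A.homologyπ j).hom z) =
      (B.homologyπ j).hom ((HomologicalComplex.cyclesMap f j).hom z) :=
    congr(($(HomologicalComplex.homologyπ_naturality f j)).hom z)
  rw [e, homologyπ_eq_zero_iff B hij] at hξ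
  obtain ⟨y, hy⟩ := hξ
  have e2 : (B.iCycles j).hom ((HomologicalComplex.cyclesMap f j).hom z) =
      (f.f j).hom ((A.iCycles j).hom z) :=
    congr(($(HomologicalComplex.cyclesMap_i f j)).hom z)
  rw [e2] at hy
  exact (homologyπ_eq_zero_iff A hij z).2 (h _ y hy)

/-- The diagram chase for exactness in the middle: correct a cycle of `B` by the boundary of a lift
`y` so that it comes from `A`; injectivity in degree `k` makes the preimage a cycle. Surjectivity of
`g` enters only in degree `i`. -/
lemma exists_homologyMap_eq {A B C : HomologicalComplex (TopModuleCat R) c} (f : A ⟶ B)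
    (g : B ⟶ C) {i j k : ι} (hij : c.Rel i j) (hjk : c.Rel j k)
    (hk : Function.Injective (f.f k).hom)
    (hj : ∀ y : B.X j, (g.f j).hom y = 0 → ∃ x, (f.f j).hom x = y)
    (hi : Function.Surjective (g.f i).hom) (η : B.homology j)
    (hη : (HomologicalComplex.homologyMap g j).hom η = 0) :
    ∃ ξ, (HomologicalComplex.homologyMap f j).hom ξ = η := by
  obtain ⟨z, rfl⟩ := homologyπ_surjective B j η
  have e : (HomologicalComplex.homologyMap g j).hom ((B.homologyπ j).hom z) =
      (C.homologyπ j).hom ((HomologicalComplex.cyclesMap g j).hom z) :=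
    congr(($(HomologicalComplex.homologyπ_naturality g j)).hom z)
  rw [e, homologyπ_eq_zero_iff C hij] at hη
  obtain ⟨w, hw⟩ := hη
  have e2 : (C.iCycles j).hom ((HomologicalComplex.cyclesMap g j).hom z) =
      (g.f j).hom ((B.iCycles j).hom z) :=
    congr(($(HomologicalComplex.cyclesMap_i g j)).hom z)
  rw [e2] at hw
  obtain ⟨y, rfl⟩ := hi w
  have e3 : (C.d i j).hom ((g.f i).hom y) = (g.f j).hom ((B.d i j).hom y) :=
    congr(($(g.comm i j)).hom y)
  obtain ⟨x, hx⟩ := hj ((B.iCycles j).hom z - (B.d i j).hom y) (by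
    rw [map_sub, ← hw, e3, sub_self])
  have hx0 : (A.d j k).hom x = 0 := by
    refine hk ?_
    have e4 : (B.d j k).hom ((f.f j).hom x) = (f.f k).hom ((A.d j k).hom x) :=
      congr(($(f.comm j k)).hom x)
    have e5 : (B.d j k).hom ((B.d i j).hom y) = 0 := congr(($(B.d_comp_d i j k)).hom y)
    have e6 : (B.d j k).hom ((B.iCycles j).hom z) = 0 := congr(($(B.iCycles_d j k)).hom z)
    rw [← e4, hx, map_sub, e5, e6, sub_zero, map_zero]
  obtain ⟨z', hz'⟩ := exists_iCycles_eq A hjk x hx0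
  refine ⟨(A.homologyπ j).hom z', ?_⟩
  have e7 : (HomologicalComplex.homologyMap f j).hom ((A.homologyπ j).hom z') =
      (B.homologyπ j).hom ((HomologicalComplex.cyclesMap f j).hom z') :=
    congr(($(HomologicalComplex.homologyπ_naturality f j)).hom z')
  have e8 : (B.iCycles j).hom ((HomologicalComplex.cyclesMap f j).hom z') =
      (f.f j).hom ((A.iCycles j).hom z') :=
    congr(($(HomologicalComplex.cyclesMap_i f j)).hom z')
  rw [e7, ← sub_eq_zero, ← map_sub, homologyπ_eq_zero_iff B hij]
  exact ⟨-y, by rw [map_sub, map_neg, e8, hz', hx]; abel⟩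

end TopModuleHomology

/-! ### Homogeneous cochains of discrete modules and the long exact sequence -/

section LongExact

variable {K : Type u} [Field K] {A B C : Type u} [AddCommGroup A] [Module (ZMod 2) A]
  [AddCommGroup B] [Module (ZMod 2) B] [AddCommGroup C] [Module (ZMod 2) C]
  {ρ : Representation (ZMod 2) (GalK K) A} {σ : Representation (ZMod 2) (GalK K) B}
  {τ : Representation (ZMod 2) (GalK K) C}

instance (ρ : Representation (ZMod 2) (GalK K) A) : DiscreteTopology (discreteTopRep ρ) := ⟨rfl⟩

/-- The complex of homogeneous cochains of a discrete `G_K`-module. -/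
abbrev cochains (ρ : Representation (ZMod 2) (GalK K) A) :
    CochainComplex (TopModuleCat.{u} (ZMod 2)) ℕ :=
  TopRep.homogeneousCochains.{0, u, u} (discreteTopRep ρ)

/-- The map on homogeneous cochains induced by a homomorphism of `G_K`-modules. -/
def cochainMap (φ : ρ.IntertwiningMap σ) : cochains ρ ⟶ cochains σ :=
  ContinuousCohomology.cochainsMap.{0, u} (ContinuousMonoidHom.id (GalK K))
    (X := discreteTopRep ρ) (Y := discreteTopRep σ) (discreteTopRepMap φ)

/-- The values of a homogeneous `0`-cochain. -/
def value₀ (F : (cochains ρ).X 0) (x : GalK K) : A := F.1 x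

/-- The values of a homogeneous `1`-cochain. -/
def value₁ (F : (cochains ρ).X 1) (x y : GalK K) : A := F.1 x y

/-- The values of a homogeneous `2`-cochain. -/
def value₂ (F : (cochains ρ).X 2) (x y z : GalK K) : A := F.1 x y z

lemma value₀_sub (F F' : (cochains ρ).X 0) (x : GalK K) :
    value₀ (F - F') x = value₀ F x - value₀ F' x := rfl

lemma value₀_map (φ : ρ.IntertwiningMap σ) (F : (cochains ρ).X 0) (x : GalK K) :
    value₀ (((cochainMap φ).f 0).hom F) x = φ.toLinearMap (value₀ F x) := rfl

lemma value₁_map (φ : ρ.IntertwiningMap σ) (F : (cochains ρ).X 1) (x y : GalK K) :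
    value₁ (((cochainMap φ).f 1).hom F) x y = φ.toLinearMap (value₁ F x y) := rfl

lemma value₁_d (F : (cochains ρ).X 0) (x y : GalK K) :
    value₁ (((cochains ρ).d 0 1).hom F) x y = value₀ F y - value₀ F x := by
  rw [value₁, TopRep.homogeneousCochains.d_apply]
  rfl

lemma smul_value₀ (F : (cochains ρ).X 0) (g x : GalK K) :
    ρ g (value₀ F (g⁻¹ * x)) = value₀ F x := congr($(F.2 g) x)

lemma smul_value₁ (F : (cochains ρ).X 1) (g x y : GalK K) :
    ρ g (value₁ F (g⁻¹ * x) (g⁻¹ * y)) = value₁ F x y := congr($(F.2 g) x y)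

lemma value₀_ext {F F' : (cochains ρ).X 0} (h : ∀ x, value₀ F x = value₀ F' x) : F = F' :=
  Subtype.ext (ContinuousMap.ext h)

lemma value₁_ext {F F' : (cochains ρ).X 1} (h : ∀ x y, value₁ F x y = value₁ F' x y) : F = F' :=
  Subtype.ext (ContinuousMap.ext fun x => ContinuousMap.ext (h x))

lemma value₂_ext {F F' : (cochains ρ).X 2}
    (h : ∀ x y z, value₂ F x y z = value₂ F' x y z) : F = F' :=
  Subtype.ext (ContinuousMap.ext fun x => ContinuousMap.ext fun y => ContinuousMap.ext (h x y))

/-- The homogeneous `0`-cochain attached to a vector with locally constant orbit map. -/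
def orbitCochain (b : A) (hb : IsLocallyConstant fun g => ρ g b) : (cochains ρ).X 0 :=
  ⟨⟨fun g => (show discreteTopRep ρ from ρ g b),
    (hb.comp fun b => (show discreteTopRep ρ from b)).continuous⟩,
    fun g => ContinuousMap.ext fun x => by
      change ρ g (ρ (g⁻¹ * x) b) = ρ x b
      rw [← Module.End.mul_apply, ← map_mul, mul_inv_cancel_left]⟩

lemma value₀_orbitCochain (b : A) (hb : IsLocallyConstant fun g => ρ g b) (x : GalK K) :
    value₀ (orbitCochain b hb) x = ρ x b := rfl

lemma value₀_eq (F : (cochains ρ).X 0) (x : GalK K) : value₀ F x = ρ x (value₀ F 1) := by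
  rw [← smul_value₀ F x x, inv_mul_cancel]

lemma intertwining_apply (φ : ρ.IntertwiningMap σ) (g : GalK K) (a : A) :
    φ.toLinearMap (ρ g a) = σ g (φ.toLinearMap a) := congr($(φ.isIntertwining' g) a)

variable {ι : ρ.IntertwiningMap σ} {φ : σ.IntertwiningMap τ}

/-- `r` may be a mere map of sets: continuity is free on a discrete module, and equivariance of `r ∘
F` can be tested after the injective equivariant `ι`, where `r` disappears. -/
lemma exists_cochain_zero_eq (hinj : Function.Injective ι.toLinearMap) {r : B → A}
    (F : (cochains σ).X 0) (h : ∀ x, ι.toLinearMap (r (value₀ F x)) = value₀ F x) :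
    ∃ F', ((cochainMap ι).f 0).hom F' = F := by
  let r' : C(discreteTopRep σ, discreteTopRep ρ) := ⟨r, continuous_of_discreteTopology⟩
  refine ⟨⟨r'.comp F.1, fun g => ContinuousMap.ext fun x => hinj ?_⟩, value₀_ext h⟩
  change ι.toLinearMap (ρ g (r (value₀ F (g⁻¹ * x)))) = ι.toLinearMap (r (value₀ F x))
  rw [intertwining_apply, h, h]
  exact smul_value₀ F g x

/-- As in degree zero. The cochains are curried, so continuity in the first variable is continuity
of postcomposition with `r'`. -/
lemma exists_cochain_one_eq (hinj : Function.Injective ι.toLinearMap) {r : B → A}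
    (F : (cochains σ).X 1) (h : ∀ x y, ι.toLinearMap (r (value₁ F x y)) = value₁ F x y) :
    ∃ F', ((cochainMap ι).f 1).hom F' = F := by
  let r' : C(discreteTopRep σ, discreteTopRep ρ) := ⟨r, continuous_of_discreteTopology⟩
  refine ⟨⟨⟨fun x => r'.comp (F.1 x), (ContinuousMap.continuous_postcomp r').comp F.1.continuous⟩,
    fun g => ContinuousMap.ext fun x => ContinuousMap.ext fun y => hinj ?_⟩, value₁_ext h⟩
  change ι.toLinearMap (ρ g (r (value₁ F (g⁻¹ * x) (g⁻¹ * y)))) =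
    ι.toLinearMap (r (value₁ F x y))
  rw [intertwining_apply, h, h]
  exact smul_value₁ F g x y

/-- The long exact sequence for a short exact sequence of discrete `G_K`-modules with surjective
map on invariants. -/
theorem exists_H1_equiv_ker {r : B →ₗ[ZMod 2] A} {s : C →ₗ[ZMod 2] B}
    (hr : ∀ a, r (ι.toLinearMap a) = a)
    (hrs : ∀ b, ι.toLinearMap (r b) + s (φ.toLinearMap b) = b)
    (hφι : ∀ a, φ.toLinearMap (ι.toLinearMap a) = 0)
    (hs : ∀ c, φ.toLinearMap (s c) = c)
    (hB : ∀ b, IsLocallyConstant fun g => σ g b)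
    (hC : ∀ c, (∀ g, τ g c = c) → ∃ b, (∀ g, σ g b = b) ∧ φ.toLinearMap b = c) :
    ∃ Φ : H1 ρ ≃ₗ[ZMod 2] LinearMap.ker (H1map φ), ∀ c, (Φ c : H1 σ) = H1map ι c := by
  have hinj : Function.Injective ι.toLinearMap := Function.LeftInverse.injective hr
  have hex (b : B) (hb : φ.toLinearMap b = 0) : ι.toLinearMap (r b) = b := by
    simpa [hb] using hrs b
  have h1 : Function.Injective (H1map ι) := by
    refine homologyMap_injective (i := 0) (j := 1) (cochainMap ι) rfl fun x y hy => ?_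
    -- The coboundary of `y` comes from `A`, so `φ ∘ y` has zero coboundary: it is constant, and its
    -- value is an invariant vector of `C`.
    have hconst (g : GalK K) : φ.toLinearMap (value₀ y g) = φ.toLinearMap (value₀ y 1) := by
      have h := congr_arg φ.toLinearMap congr(value₁ $hy 1 g)
      rwa [value₁_d, value₁_map, hφι, map_sub, sub_eq_zero] at h
    -- This is the vanishing of the connecting map. Subtracting the orbit cochain of an invariant
    -- lift leaves the coboundary of `y` unchanged and moves `y` into the image of `ι`.
    obtain ⟨b, hb, hb'⟩ := hC (φ.toLinearMap (value₀ y 1)) fun g => by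
      rw [← intertwining_apply, ← value₀_eq, hconst]
    obtain ⟨a, ha⟩ := exists_cochain_zero_eq (r := r) hinj (y - orbitCochain b (hB b)) fun g => by
      refine hex _ ?_
      rw [value₀_sub, value₀_orbitCochain, hb, map_sub, hb', hconst, sub_self]
    have e : ((cochainMap ι).f 1).hom (((cochains ρ).d 0 1).hom a) =
        ((cochainMap ι).f 1).hom x := by
      have e1 : ((cochains σ).d 0 1).hom (((cochainMap ι).f 0).hom a) =
          ((cochainMap ι).f 1).hom (((cochains ρ).d 0 1).hom a) :=
        congr(($((cochainMap ι).comm 0 1)).hom a)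
      rw [← e1, ha, ← hy]
      refine value₁_ext fun g g' => ?_
      rw [value₁_d, value₁_d, value₀_sub, value₀_sub, value₀_orbitCochain, value₀_orbitCochain,
        hb, hb, sub_sub_sub_cancel_right]
    refine ⟨a, value₁_ext fun g g' => hinj ?_⟩
    rw [← value₁_map, e, value₁_map]
  have h2 (η : H1 σ) (hη : H1map φ η = 0) : ∃ ξ, H1map ι ξ = η := by
    refine exists_homologyMap_eq (i := 0) (j := 1) (k := 2) (cochainMap ι) (cochainMap φ) rfl rfl
      (fun F F' h => value₂_ext fun x y z => hinj congr(value₂ $h x y z))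
      (fun F h => exists_cochain_one_eq (r := r) hinj F fun x y => hex _ congr(value₁ $h x y))
      (fun F => ?_) η hη
    -- A `0`-cochain is the orbit map of its value at `1`. Lifting that one value suffices, with
    -- `hB` giving continuity of the orbit; `s` itself need not be equivariant.
    refine ⟨orbitCochain (s (value₀ F 1)) (hB _), value₀_ext fun x => ?_⟩
    rw [value₀_map, value₀_orbitCochain, intertwining_apply, hs]
    exact (value₀_eq F x).symm
  have h3 (ξ : H1 ρ) : H1map φ (H1map ι ξ) = 0 := by
    obtain ⟨z, rfl⟩ := homologyπ_surjective (cochains ρ) 1 ξ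
    have e1 : H1map ι (((cochains ρ).homologyπ 1).hom z) = ((cochains σ).homologyπ 1).hom
        ((HomologicalComplex.cyclesMap (cochainMap ι) 1).hom z) :=
      congr(($(HomologicalComplex.homologyπ_naturality (cochainMap ι) 1)).hom z)
    have e2 (z) : H1map φ (((cochains σ).homologyπ 1).hom z) = ((cochains τ).homologyπ 1).hom
        ((HomologicalComplex.cyclesMap (cochainMap φ) 1).hom z) :=
      congr(($(HomologicalComplex.homologyπ_naturality (cochainMap φ) 1)).hom z)
    rw [e1, e2, homologyπ_eq_zero_iff (cochains τ) (i := 0) (j := 1) rfl]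
    refine ⟨0, ?_⟩
    have e3 : ((cochains σ).iCycles 1).hom
        ((HomologicalComplex.cyclesMap (cochainMap ι) 1).hom z) =
        ((cochainMap ι).f 1).hom (((cochains ρ).iCycles 1).hom z) :=
      congr(($(HomologicalComplex.cyclesMap_i (cochainMap ι) 1)).hom z)
    have e4 (z) : ((cochains τ).iCycles 1).hom
        ((HomologicalComplex.cyclesMap (cochainMap φ) 1).hom z) =
        ((cochainMap φ).f 1).hom (((cochains σ).iCycles 1).hom z) :=
      congr(($(HomologicalComplex.cyclesMap_i (cochainMap φ) 1)).hom z)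
    rw [e4, e3, map_zero]
    exact value₁_ext fun x y => (hφι _).symm
  let ψ : H1 ρ →ₗ[ZMod 2] LinearMap.ker (H1map φ) := (H1map ι).codRestrict _ h3
  refine ⟨LinearEquiv.ofBijective ψ ⟨fun x y h => h1 (congr_arg Subtype.val h), fun η => ?_⟩,
    fun _ => rfl⟩
  obtain ⟨ξ, hξ⟩ := h2 η.1 η.2
  exact ⟨ξ, Subtype.ext hξ⟩

end LongExact
end
end EvenHyperelliptic

namespace EvenHyperelliptic
noncomputable section
universe u

/-! ### Values of rational functions at a point of a chart -/

section Values

variable {K : Type u} [Field K] {f : K[X]} {s : Fin 2 → FunctionField f}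
  {P : Fin 2 → AlgebraicClosure K} {h h' : FunctionField f} {c c' : AlgebraicClosure K}

/-- The rational function `h` is regular at the point `P` of the chart `s`, with value `c`. -/
def HasValue (s : Fin 2 → FunctionField f) (P : Fin 2 → AlgebraicClosure K)
    (h : FunctionField f) (c : AlgebraicClosure K) : Prop :=
  VanishesAt f s P (h - algebraMap _ _ c)

lemma hasValue_iff : HasValue s P h c ↔ ∃ p q : MvPolynomial (Fin 2) (AlgebraicClosure K),
    MvPolynomial.aeval P q ≠ 0 ∧ h * MvPolynomial.aeval s q = MvPolynomial.aeval s p ∧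
      MvPolynomial.aeval P p = c * MvPolynomial.aeval P q := by
  constructor
  · rintro ⟨p, q, hp, hq, e⟩
    refine ⟨p + MvPolynomial.C c * q, q, hq, ?_, ?_⟩
    · rw [map_add, map_mul, MvPolynomial.aeval_C, ← e]; ring
    · rw [map_add, map_mul, MvPolynomial.aeval_C, hp, zero_add]; rfl
  · rintro ⟨p, q, hq, e, hp⟩
    refine ⟨p - MvPolynomial.C c * q, q, ?_, hq, ?_⟩
    · rw [map_sub, map_mul, MvPolynomial.aeval_C, hp]; exact sub_self _
    · rw [map_sub, map_mul, MvPolynomial.aeval_C, ← e]; ring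

lemma vanishesAt_iff_hasValue : VanishesAt f s P h ↔ HasValue s P h 0 := by
  rw [HasValue, map_zero, sub_zero]

lemma HasValue.add (hh : HasValue s P h c) (hh' : HasValue s P h' c') :
    HasValue s P (h + h') (c + c') := by
  rw [hasValue_iff] at *
  obtain ⟨p, q, h1, h2, h3⟩ := hh
  obtain ⟨p', q', h1', h2', h3'⟩ := hh'
  refine ⟨p * q' + p' * q, q * q', by simpa using ⟨h1, h1'⟩, ?_, ?_⟩
  · rw [map_mul, map_add, map_mul, map_mul, ← h2, ← h2']; ring
  · rw [map_mul, map_add, map_mul, map_mul, h3, h3']; ring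

lemma HasValue.mul (hh : HasValue s P h c) (hh' : HasValue s P h' c') :
    HasValue s P (h * h') (c * c') := by
  rw [hasValue_iff] at *
  obtain ⟨p, q, h1, h2, h3⟩ := hh
  obtain ⟨p', q', h1', h2', h3'⟩ := hh'
  refine ⟨p * p', q * q', by simpa using ⟨h1, h1'⟩, ?_, ?_⟩
  · rw [map_mul, map_mul, ← h2, ← h2']; ring
  · rw [map_mul, map_mul, h3, h3']; ring

lemma hasValue_aeval (p : MvPolynomial (Fin 2) (AlgebraicClosure K)) :
    HasValue s P (MvPolynomial.aeval s p) (MvPolynomial.aeval P p) :=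
  hasValue_iff.2 ⟨p, 1, by simp, by simp, by simp⟩

lemma hasValue_algebraMap (c : AlgebraicClosure K) : HasValue s P (algebraMap _ _ c) c := by
  simpa using hasValue_aeval (s := s) (P := P) (MvPolynomial.C c)

lemma hasValue_chart (i : Fin 2) : HasValue s P (s i) (P i) := by
  simpa using hasValue_aeval (s := s) (P := P) (MvPolynomial.X i)

lemma hasValue_one : HasValue s P (1 : FunctionField f) 1 := by
  simpa using hasValue_algebraMap (s := s) (P := P) 1

lemma HasValue.neg (hh : HasValue s P h c) : HasValue s P (-h) (-c) := by
  simpa using (hasValue_algebraMap (-1)).mul hh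

lemma HasValue.sub (hh : HasValue s P h c) (hh' : HasValue s P h' c') :
    HasValue s P (h - h') (c - c') := by
  rw [sub_eq_add_neg, sub_eq_add_neg]; exact hh.add hh'.neg

lemma HasValue.inv {u : (FunctionField f)ˣ} (hh : HasValue s P u c) (hc : c ≠ 0) :
    HasValue s P (↑u⁻¹ : FunctionField f) c⁻¹ := by
  rw [hasValue_iff] at *
  obtain ⟨p, q, h1, h2, h3⟩ := hh
  refine ⟨q, p, by rw [h3]; exact mul_ne_zero hc h1, ?_, ?_⟩
  · rw [← h2, Units.inv_mul_cancel_left]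
  · rw [h3, inv_mul_cancel_left₀ hc]

lemma HasValue.pow (hh : HasValue s P h c) (n : ℕ) : HasValue s P (h ^ n) (c ^ n) := by
  induction n with
  | zero => simpa using hasValue_one
  | succ n ih => rw [pow_succ, pow_succ]; exact ih.mul hh

lemma mem_localRing_iff : h ∈ localRing f s P ↔ ∃ c, HasValue s P h c := by
  constructor
  · rintro ⟨p, q, h1, h2⟩
    exact ⟨MvPolynomial.aeval P p / MvPolynomial.aeval P q,
      hasValue_iff.2 ⟨p, q, h1, h2, by rw [div_mul_cancel₀ _ h1]⟩⟩
  · rintro ⟨c, hc⟩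
    obtain ⟨p, q, h1, h2, -⟩ := hasValue_iff.1 hc
    exact ⟨p, q, h1, h2⟩

lemma HasValue.mem (hh : HasValue s P h c) : h ∈ localRing f s P := mem_localRing_iff.2 ⟨c, hh⟩

/-- The polynomial relations between the functions of the chart `s` hold at the point `P`. -/
def Specializes (s : Fin 2 → FunctionField f) (P : Fin 2 → AlgebraicClosure K) : Prop :=
  ∀ p : MvPolynomial (Fin 2) (AlgebraicClosure K),
    MvPolynomial.aeval s p = 0 → MvPolynomial.aeval P p = 0

/-- Cross-multiplying two presentations gives a polynomial relation between the chart functions,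
which may be evaluated at `P`. Inverses are taken only of given units, so irreducibility of `y² - f`
plays no part. -/
lemma HasValue.unique (hs : Specializes s P) (hh : HasValue s P h c) (hh' : HasValue s P h c') :
    c = c' := by
  obtain ⟨p, q, h1, h2, h3⟩ := hasValue_iff.1 hh
  obtain ⟨p', q', h1', h2', h3'⟩ := hasValue_iff.1 hh'
  have e := hs (p * q' - p' * q) (by rw [map_sub, map_mul, map_mul, ← h2, ← h2']; ring)
  rw [map_sub, map_mul, map_mul, h3, h3'] at e
  have e2 : (c - c') * (MvPolynomial.aeval P q * MvPolynomial.aeval P q') = 0 := by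
    linear_combination e
  exact sub_eq_zero.1 ((mul_eq_zero.1 e2).resolve_right (mul_ne_zero h1 h1'))

/-- The units of the local ring at `P`, as a subgroup of the units of the function field. -/
def localUnits (s : Fin 2 → FunctionField f) (P : Fin 2 → AlgebraicClosure K) :
    Subgroup (FunctionField f)ˣ where
  carrier := {u | (u : FunctionField f) ∈ localRing f s P ∧
    (↑u⁻¹ : FunctionField f) ∈ localRing f s P}
  one_mem' := by simp [one_mem]
  mul_mem' := fun ha hb => ⟨mul_mem ha.1 hb.1, by rw [mul_inv]; exact mul_mem ha.2 hb.2⟩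
  inv_mem' := fun ha => ⟨ha.2, by rw [inv_inv]; exact ha.1⟩

lemma HasValue.mem_localUnits {u : (FunctionField f)ˣ} (hh : HasValue s P u c) (hc : c ≠ 0) :
    u ∈ localUnits s P := ⟨hh.mem, (hh.inv hc).mem⟩

lemma IsUniformizer.div_mem_localUnits {ϖ ϖ' : (FunctionField f)ˣ} (h1 : IsUniformizer f s P ϖ)
    (h2 : IsUniformizer f s P ϖ') : ϖ⁻¹ * ϖ' ∈ localUnits s P :=
  ⟨h1.2 _ h2.1, by rw [mul_inv, inv_inv, mul_comm]; exact h2.2 _ h1.1⟩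

/-- If `ϖ⁻¹` had a value `c`, then `1 = ϖ ϖ⁻¹` would have the value `0 · c`. -/
lemma IsUniformizer.inv_not_mem (hs : Specializes s P) {ϖ : (FunctionField f)ˣ}
    (h1 : IsUniformizer f s P ϖ) : (↑ϖ⁻¹ : FunctionField f) ∉ localRing f s P := by
  intro h
  obtain ⟨c, hc⟩ := mem_localRing_iff.1 h
  have := (vanishesAt_iff_hasValue.1 h1.1).mul hc
  rw [Units.mul_inv, zero_mul] at this
  exact zero_ne_one (this.unique hs hasValue_one)

end Values

/-! ### The function field as `K̄(x) ⊕ K̄(x) y`, and the relations in the two charts -/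

section FunctionField

variable {K : Type u} [Field K] {f : K[X]}

lemma of_add_of_mul_y_eq_zero {a b : RatFunc (AlgebraicClosure K)}
    (h : AdjoinRoot.of (curvePoly f) a + AdjoinRoot.of (curvePoly f) b * yFun f = 0) :
    a = 0 ∧ b = 0 := by
  have h1 : AdjoinRoot.mk (curvePoly f) (C a + C b * X) = 0 := by
    rw [map_add, map_mul, AdjoinRoot.mk_C, AdjoinRoot.mk_C, AdjoinRoot.mk_X]; exact h
  rw [AdjoinRoot.mk_eq_zero] at h1
  have hm : (curvePoly f).Monic := monic_X_pow_sub_C _ two_ne_zero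
  have h2 := Polynomial.eq_zero_of_dvd_of_degree_lt h1 (by
    rw [curvePoly, degree_X_pow_sub_C two_pos]
    refine lt_of_le_of_lt (b := (1 : WithBot ℕ)) ?_ (by norm_num)
    compute_degree)
  have h3 := congr_arg (coeff · 0) h2
  have h4 := congr_arg (coeff · 1) h2
  simp at h3 h4
  exact ⟨h3, h4⟩

lemma exists_eq_of_add_of_mul_y (h : FunctionField f) : ∃ a b : RatFunc (AlgebraicClosure K),
    h = AdjoinRoot.of (curvePoly f) a + AdjoinRoot.of (curvePoly f) b * yFun f := by
  have hm : (curvePoly f).Monic := monic_X_pow_sub_C _ two_ne_zero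
  obtain ⟨p, rfl⟩ := AdjoinRoot.mk_surjective h
  have hd : (p %ₘ curvePoly f).natDegree < 2 := by
    have h2 : (curvePoly f).natDegree = 2 := natDegree_X_pow_sub_C
    have h1 : curvePoly f ≠ 1 := fun h => by rw [h, natDegree_one] at h2; omega
    exact h2 ▸ natDegree_modByMonic_lt p hm h1
  refine ⟨(p %ₘ curvePoly f).coeff 0, (p %ₘ curvePoly f).coeff 1, ?_⟩
  have e : AdjoinRoot.mk (curvePoly f) p = AdjoinRoot.mk (curvePoly f) (p %ₘ curvePoly f) := by
    rw [AdjoinRoot.mk_eq_mk]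
    exact ⟨p /ₘ curvePoly f, sub_eq_of_eq_add' (modByMonic_add_div p (curvePoly f)).symm⟩
  rw [e]
  conv_lhs => rw [(p %ₘ curvePoly f).as_sum_range' 2 hd]
  simp [Finset.sum_range_succ, ← C_mul_X_pow_eq_monomial, yFun]

lemma of_algebraMap (A : (AlgebraicClosure K)[X]) :
    AdjoinRoot.of (curvePoly f) (algebraMap _ (RatFunc (AlgebraicClosure K)) A) =
      aeval (xFun f) A := by
  have e : (aeval (xFun f) : (AlgebraicClosure K)[X] →ₐ[AlgebraicClosure K] FunctionField f) =
      (IsScalarTower.toAlgHom (AlgebraicClosure K) (RatFunc (AlgebraicClosure K))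
        (FunctionField f)).comp (IsScalarTower.toAlgHom (AlgebraicClosure K)
          (AlgebraicClosure K)[X] (RatFunc (AlgebraicClosure K))) := by
    refine Polynomial.algHom_ext ?_
    simp [xFun, AdjoinRoot.algebraMap_eq]
  rw [e]
  rfl

lemma aeval_xInvFun (A : (AlgebraicClosure K)[X]) :
    aeval (xInvFun f) A = AdjoinRoot.of (curvePoly f)
      (aeval (RatFunc.X⁻¹ : RatFunc (AlgebraicClosure K)) A) :=
  Polynomial.aeval_algHom_apply (IsScalarTower.toAlgHom (AlgebraicClosure K)
    (RatFunc (AlgebraicClosure K)) (FunctionField f)) _ A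

/-- Points satisfying the equation of a chart of the form `s₁² = G(s₀)`, where `s₀` is
transcendental and `1, s₁` are independent over `K̄(s₀)`, satisfy all relations. -/
lemma specializes_of {s : Fin 2 → FunctionField f} {P : Fin 2 → AlgebraicClosure K}
    {G : (AlgebraicClosure K)[X]} (hs : s 1 ^ 2 = aeval (s 0) G) (hP : P 1 ^ 2 = aeval (P 0) G)
    (hi : ∀ A B : (AlgebraicClosure K)[X], aeval (s 0) A + aeval (s 0) B * s 1 = 0 →
      A = 0 ∧ B = 0) : Specializes s P := by
  intro p hp
  -- The relation `s₁² = G(s₀)` reduces every polynomial to `A(s₀) + B(s₀) s₁`, and the same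
  -- reduction is valid at `P`. Independence then kills `A` and `B`.
  have key : ∃ A B : (AlgebraicClosure K)[X],
      MvPolynomial.aeval s p = aeval (s 0) A + aeval (s 0) B * s 1 ∧
      MvPolynomial.aeval P p = aeval (P 0) A + aeval (P 0) B * P 1 := by
    clear hp
    induction p using MvPolynomial.induction_on with
    | C a => exact ⟨C a, 0, by simp, by simp⟩
    | add p q hp hq =>
      obtain ⟨A, B, h1, h2⟩ := hp
      obtain ⟨A', B', h1', h2'⟩ := hq
      refine ⟨A + A', B + B', ?_, ?_⟩
      · simp only [map_add, h1, h1']; ring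
      · simp only [map_add, h2, h2']; ring
    | mul_X p i hp =>
      obtain ⟨A, B, h1, h2⟩ := hp
      fin_cases i
      · refine ⟨A * X, B * X, ?_, ?_⟩
        · simp only [map_mul, h1, aeval_X, MvPolynomial.aeval_X, Fin.zero_eta]; ring
        · simp only [map_mul, h2, aeval_X, MvPolynomial.aeval_X, Fin.zero_eta]; ring
      · refine ⟨B * G, A, ?_, ?_⟩
        · simp only [map_mul, h1, MvPolynomial.aeval_X, Fin.mk_one, ← hs]; ring
        · simp only [map_mul, h2, MvPolynomial.aeval_X, Fin.mk_one, ← hP]; ring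
  obtain ⟨A, B, h1, h2⟩ := key
  obtain ⟨rfl, rfl⟩ := hi A B (h1.symm.trans hp)
  simpa using h2

lemma specializes_affine (P : AffinePoint f) :
    Specializes ![xFun f, yFun f] ![P.x, P.y] := by
  refine specializes_of (G := fbar f) yFun_sq (by simpa using P.eq) fun A B h => ?_
  simp only [Matrix.cons_val_zero, Matrix.cons_val_one, ← of_algebraMap] at h
  obtain ⟨h1, h2⟩ := of_add_of_mul_y_eq_zero h
  exact ⟨(map_eq_zero_iff _ (RatFunc.algebraMap_injective _)).1 h1,
    (map_eq_zero_iff _ (RatFunc.algebraMap_injective _)).1 h2⟩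

lemma aeval_inv_X_eq_zero {A : (AlgebraicClosure K)[X]}
    (h : aeval (RatFunc.X⁻¹ : RatFunc (AlgebraicClosure K)) A = 0) : A = 0 := by
  by_contra hA
  have h1 : IsAlgebraic (AlgebraicClosure K) (RatFunc.X⁻¹ : RatFunc (AlgebraicClosure K)) :=
    ⟨A, hA, h⟩
  exact RatFunc.transcendental_X (IsAlgebraic.inv_iff.1 h1)

lemma aeval_reverse_xInvFun (A : (AlgebraicClosure K)[X]) :
    aeval (xInvFun f) A.reverse = aeval (xFun f) A * xInvFun f ^ A.natDegree := by
  let : Invertible (xFun f) := ⟨xInvFun f, by rw [mul_comm, xFun_mul_xInvFun], xFun_mul_xInvFun⟩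
  have h : aeval (xInvFun f) A.reverse * xFun f ^ A.natDegree = aeval (xFun f) A :=
    eval₂_reverse_mul_pow (algebraMap (AlgebraicClosure K) (FunctionField f)) (xFun f) A
  rw [← h, mul_assoc, ← mul_pow, xFun_mul_xInvFun, one_pow, mul_one]

/-- With `n = deg f`, the square of `y / x ^ (n / 2)` is `f(x) / x ^ n`, the reversed polynomial at
`1 / x`. Evenness is what makes `2 * (n / 2) = n`; the constant term of the reversed polynomial is
the leading coefficient of `f`. -/
lemma specializes_infinity (heven : Even f.natDegree) (w : InfinitePoint f) :
    Specializes ![xInvFun f, yFun f * xInvFun f ^ (f.natDegree / 2)] ![0, w.w] := by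
  refine specializes_of (G := (fbar f).reverse) ?_ ?_ fun A B h => ?_
  · simp only [Matrix.cons_val_zero, Matrix.cons_val_one]
    rw [aeval_reverse_xInvFun, mul_pow, yFun_sq, ← pow_mul, natDegree_map,
      Nat.div_mul_cancel heven.two_dvd]
  · simp only [Matrix.cons_val_zero, Matrix.cons_val_one]
    rw [w.eq, ← coeff_zero_eq_aeval_zero, coeff_zero_reverse]
  · simp only [Matrix.cons_val_zero, Matrix.cons_val_one, aeval_xInvFun] at h
    rw [mul_comm (yFun f), ← mul_assoc, xInvFun, ← map_pow, ← map_mul] at h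
    obtain ⟨h1, h2⟩ := of_add_of_mul_y_eq_zero h
    refine ⟨aeval_inv_X_eq_zero h1, aeval_inv_X_eq_zero ?_⟩
    exact (mul_eq_zero.1 h2).resolve_right (pow_ne_zero _ (inv_ne_zero RatFunc.X_ne_zero))

end FunctionField
end
end EvenHyperelliptic

namespace EvenHyperelliptic
noncomputable section
universe u

/-! ### The hyperelliptic involution `y ↦ -y` -/

section Conjugation

variable {K : Type u} [Field K] {f : K[X]}

variable (f) in
/-- The hyperelliptic involution `y ↦ -y` on the function field. -/
def conj : FunctionField f →ₐ[AlgebraicClosure K] FunctionField f :=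
  AdjoinRoot.liftAlgHom (curvePoly f) (IsScalarTower.toAlgHom (AlgebraicClosure K)
    (RatFunc (AlgebraicClosure K)) (FunctionField f)) (-yFun f) (by
      have h2 := AdjoinRoot.eval₂_root (curvePoly f)
      rw [Polynomial.eval₂_sub, Polynomial.eval₂_pow, Polynomial.eval₂_X,
        Polynomial.eval₂_C] at h2 ⊢
      rw [neg_sq]
      exact h2)

lemma conj_of (r : RatFunc (AlgebraicClosure K)) :
    conj f (AdjoinRoot.of (curvePoly f) r) = AdjoinRoot.of (curvePoly f) r :=
  AdjoinRoot.liftAlgHom_of _ _ _ _ _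

lemma conj_y : conj f (yFun f) = -yFun f := AdjoinRoot.liftAlgHom_root _ _ _ _

lemma conj_conj (h : FunctionField f) : conj f (conj f h) = h := by
  obtain ⟨a, b, rfl⟩ := exists_eq_of_add_of_mul_y h
  simp only [map_add, map_mul, conj_of, conj_y, map_neg, neg_neg, mul_neg]

lemma exists_of_eq_of_conj_eq [NeZero (2 : K)] {h : FunctionField f} (hh : conj f h = h) :
    ∃ r, h = AdjoinRoot.of (curvePoly f) r := by
  obtain ⟨a, b, rfl⟩ := exists_eq_of_add_of_mul_y h
  refine ⟨a, ?_⟩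
  have h1 : AdjoinRoot.of (curvePoly f) 0 + AdjoinRoot.of (curvePoly f) (2 * b) * yFun f = 0 := by
    rw [map_mul, map_ofNat]
    simp only [map_add, map_mul, conj_of, conj_y] at hh
    rw [map_zero]
    linear_combination -hh
  have h2 := (of_add_of_mul_y_eq_zero h1).2
  have h3 : (2 : RatFunc (AlgebraicClosure K)) ≠ 0 := by
    have := (map_ne_zero (algebraMap K (RatFunc (AlgebraicClosure K)))).2 (NeZero.ne (2 : K))
    rwa [map_ofNat] at this
  rw [(mul_eq_zero.1 h2).resolve_left h3, map_zero, zero_mul, add_zero]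

/-- The involution on units. -/
abbrev conjUnit : (FunctionField f)ˣ →* (FunctionField f)ˣ :=
  Units.map (conj f : FunctionField f →* FunctionField f)

lemma conjUnit_conjUnit (u : (FunctionField f)ˣ) : conjUnit (conjUnit u) = u :=
  Units.ext (conj_conj _)

/-- Replacing the second variable by its negative in numerator and denominator carries a
presentation at `(a, b)` to one at `(a, -b)`. The hypotheses on `s` hold in the affine chart and in
the chart at infinity. -/
lemma vanishesAt_conj {s : Fin 2 → FunctionField f} (h0 : conj f (s 0) = s 0)
    (h1 : conj f (s 1) = -s 1) {a b : AlgebraicClosure K} {h : FunctionField f}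
    (hh : VanishesAt f s ![a, b] h) : VanishesAt f s ![a, -b] (conj f h) := by
  let t : MvPolynomial (Fin 2) (AlgebraicClosure K) →ₐ[AlgebraicClosure K]
    MvPolynomial (Fin 2) (AlgebraicClosure K) :=
    MvPolynomial.aeval ![MvPolynomial.X 0, -MvPolynomial.X 1]
  have e1 (p) : MvPolynomial.aeval ![a, -b] (t p) = MvPolynomial.aeval ![a, b] p := by
    have : (MvPolynomial.aeval ![a, -b]).comp t = MvPolynomial.aeval ![a, b] := by
      refine MvPolynomial.algHom_ext fun i => ?_
      fin_cases i <;> simp [t]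
    exact congr($this p)
  have e2 (p) : MvPolynomial.aeval s (t p) = conj f (MvPolynomial.aeval s p) := by
    have : (MvPolynomial.aeval s).comp t = (conj f).comp (MvPolynomial.aeval s) := by
      refine MvPolynomial.algHom_ext fun i => ?_
      fin_cases i <;> simp [t, h0, h1]
    exact congr($this p)
  obtain ⟨p, q, hp, hq, e⟩ := hh
  refine ⟨t p, t q, by rw [e1, hp], by rwa [e1], ?_⟩
  rw [e2, e2, ← map_mul, e]

lemma hasValue_conj {s : Fin 2 → FunctionField f} (h0 : conj f (s 0) = s 0)
    (h1 : conj f (s 1) = -s 1) {a b : AlgebraicClosure K} {h : FunctionField f}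
    {c : AlgebraicClosure K} (hh : HasValue s ![a, b] h c) :
    HasValue s ![a, -b] (conj f h) c := by
  have := vanishesAt_conj h0 h1 hh
  rwa [map_sub, AlgHom.commutes] at this

lemma mem_localRing_conj {s : Fin 2 → FunctionField f} (h0 : conj f (s 0) = s 0)
    (h1 : conj f (s 1) = -s 1) {a b : AlgebraicClosure K} {h : FunctionField f}
    (hh : h ∈ localRing f s ![a, b]) : conj f h ∈ localRing f s ![a, -b] := by
  obtain ⟨c, hc⟩ := mem_localRing_iff.1 hh
  exact (hasValue_conj h0 h1 hc).mem

/-- The image of a point under the hyperelliptic involution. -/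
def AffinePoint.conj (P : AffinePoint f) : AffinePoint f := ⟨P.x, -P.y, by rw [neg_sq, P.eq]⟩

@[simp] lemma AffinePoint.conj_x (P : AffinePoint f) : P.conj.x = P.x := rfl
@[simp] lemma AffinePoint.conj_y (P : AffinePoint f) : P.conj.y = -P.y := rfl

lemma AffinePoint.conj_conj (P : AffinePoint f) : P.conj.conj = P :=
  AffinePoint.ext rfl (neg_neg _)

lemma AffinePoint.eq_or_eq_conj {P Q : AffinePoint f} (h : P.x = Q.x) : P = Q ∨ P = Q.conj := by
  have h1 : P.y ^ 2 = Q.y ^ 2 := by rw [P.eq, Q.eq, h]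
  rcases sq_eq_sq_iff_eq_or_eq_neg.1 h1 with h2 | h2
  · exact Or.inl (AffinePoint.ext h h2)
  · exact Or.inr (AffinePoint.ext h h2)

lemma conj_xFun : conj f (xFun f) = xFun f := conj_of _
lemma conj_xInvFun : conj f (xInvFun f) = xInvFun f := conj_of _

lemma isUniformizer_conj {P : AffinePoint f} {ϖ : (FunctionField f)ˣ}
    (hϖ : IsUniformizer f ![xFun f, yFun f] ![P.x, P.y] ϖ) :
    IsUniformizer f ![xFun f, yFun f] ![P.conj.x, P.conj.y] (conjUnit ϖ) := by
  refine ⟨vanishesAt_conj conj_xFun conj_y hϖ.1, fun h hh => ?_⟩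
  have h1 := vanishesAt_conj conj_xFun conj_y hh
  rw [AffinePoint.conj_x, AffinePoint.conj_y, neg_neg] at h1
  have h2 := mem_localRing_conj conj_xFun conj_y (hϖ.2 _ h1)
  rwa [map_mul, conj_conj] at h2

lemma localUnits_conj {P : AffinePoint f} {u : (FunctionField f)ˣ}
    (hu : u ∈ localUnits ![xFun f, yFun f] ![P.x, P.y]) :
    conjUnit u ∈ localUnits ![xFun f, yFun f] ![P.conj.x, P.conj.y] :=
  ⟨mem_localRing_conj conj_xFun conj_y hu.1, mem_localRing_conj conj_xFun conj_y hu.2⟩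

lemma ratFunc_mul_denom {F : Type*} [Field F] (r : RatFunc F) :
    r * algebraMap _ _ r.denom = algebraMap _ _ r.num :=
  ((div_eq_iff ((map_ne_zero_iff _ (RatFunc.algebraMap_injective _)).2 r.denom_ne_zero)).1
    (RatFunc.num_div_denom r)).symm

/-- Clearing denominators: a function is of the form `(A(x) + B(x) y) / D(x)`. -/
lemma exists_mul_eq_aeval (h : FunctionField f) : ∃ (v : (FunctionField f)ˣ)
    (p : MvPolynomial (Fin 2) (AlgebraicClosure K)), conjUnit v = v ∧
      h * v = MvPolynomial.aeval ![xFun f, yFun f] p := by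
  obtain ⟨a, b, rfl⟩ := exists_eq_of_add_of_mul_y h
  have hd : algebraMap _ (RatFunc (AlgebraicClosure K)) (a.denom * b.denom) ≠ 0 :=
    (map_ne_zero_iff _ (RatFunc.algebraMap_injective _)).2
      (mul_ne_zero a.denom_ne_zero b.denom_ne_zero)
  refine ⟨(isUnit_of_ne_zero (f := f) hd).unit, inFirst (a.num * b.denom) +
    inFirst (b.num * a.denom) * MvPolynomial.X 1, Units.ext (conj_of _), ?_⟩
  rw [IsUnit.unit_spec, map_add, map_mul (MvPolynomial.aeval _), aeval_inFirst, aeval_inFirst,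
    MvPolynomial.aeval_X]
  simp only [Matrix.cons_val_zero, Matrix.cons_val_one, ← of_algebraMap, map_mul,
    ← ratFunc_mul_denom a, ← ratFunc_mul_denom b]
  ring

end Conjugation

/-! ### Orders at affine points -/

section Order

variable {K : Type u} [Field K] {f : K[X]} {P : AffinePoint f} {h h' : (FunctionField f)ˣ}
  {m n : ℤ}

/-- Two uniformizers differ by a local unit, so the uniformizer hidden in `HasOrder` may be replaced
by any given one. -/
lemma hasOrder_iff {ϖ : (FunctionField f)ˣ}
    (hϖ : IsUniformizer f ![xFun f, yFun f] ![P.x, P.y] ϖ) :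
    HasOrder P h n ↔ h * ϖ ^ (-n) ∈ localUnits ![xFun f, yFun f] ![P.x, P.y] := by
  refine ⟨fun ⟨ϖ', h1, h2⟩ => ?_, fun h2 => ⟨ϖ, hϖ, h2⟩⟩
  have h3 : h * ϖ ^ (-n) = (h * ϖ' ^ (-n)) * (ϖ⁻¹ * ϖ') ^ n := by
    rw [mul_zpow, inv_zpow', mul_mul_mul_comm, ← zpow_add, neg_add_cancel, zpow_zero, mul_one]
  rw [h3]
  exact mul_mem h2 (zpow_mem (hϖ.div_mem_localUnits h1) n)

lemma HasOrder.mul (h1 : HasOrder P h m) (h2 : HasOrder P h' n) : HasOrder P (h * h') (m + n) := by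
  have h3 := h1
  obtain ⟨ϖ, hϖ, -⟩ := h3
  rw [hasOrder_iff hϖ] at *
  rw [neg_add, zpow_add, mul_mul_mul_comm]
  exact mul_mem h1 h2

lemma HasOrder.inv (h1 : HasOrder P h n) : HasOrder P h⁻¹ (-n) := by
  have h3 := h1
  obtain ⟨ϖ, hϖ, -⟩ := h3
  rw [hasOrder_iff hϖ] at *
  rw [zpow_neg, ← mul_inv]
  exact inv_mem h1

lemma HasOrder.conj (h1 : HasOrder P h n) : HasOrder P.conj (conjUnit h) n := by
  obtain ⟨ϖ, hϖ, h2⟩ := h1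
  refine (hasOrder_iff (isUniformizer_conj hϖ)).2 ?_
  rw [← map_zpow, ← map_mul]
  exact localUnits_conj h2

lemma IsUniformizer.hasOrder (hϖ : IsUniformizer f ![xFun f, yFun f] ![P.x, P.y] h) :
    HasOrder P h 1 := by
  rw [hasOrder_iff hϖ, zpow_neg_one, mul_inv_cancel]
  exact one_mem _

lemma HasOrder.mem (h1 : HasOrder P h n) (hn : 0 ≤ n) :
    (h : FunctionField f) ∈ localRing f ![xFun f, yFun f] ![P.x, P.y] := by
  have h3 := h1
  obtain ⟨ϖ, hϖ, -⟩ := h3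
  rw [hasOrder_iff hϖ] at h1
  obtain ⟨m, rfl⟩ := Int.eq_ofNat_of_zero_le hn
  have e : (h : FunctionField f) = ↑(h * ϖ ^ (-(m : ℤ))) * (ϖ : FunctionField f) ^ m := by
    rw [← Units.val_pow_eq_pow_val, ← Units.val_mul, zpow_neg, zpow_natCast,
      inv_mul_cancel_right]
  rw [e]
  exact mul_mem h1.1 (pow_mem (vanishesAt_iff_hasValue.1 hϖ.1).mem m)

/-- If `n < 0`, then `h⁻¹ ϖ⁻¹` has order `-n - 1 ≥ 0` and is regular; multiplied by the regular
function `h` it would make `ϖ⁻¹` regular. -/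
lemma HasOrder.nonneg (h1 : HasOrder P h n)
    (hh : (h : FunctionField f) ∈ localRing f ![xFun f, yFun f] ![P.x, P.y]) : 0 ≤ n := by
  by_contra! hn
  have h3 := h1
  obtain ⟨ϖ, hϖ, -⟩ := h3
  refine hϖ.inv_not_mem (specializes_affine P) ?_
  have h4 : HasOrder P (h * h⁻¹ * ϖ⁻¹ * h) (n + -n + -1 + n) :=
    ((h1.mul h1.inv).mul hϖ.hasOrder.inv).mul h1
  have h5 : HasOrder P (h⁻¹ * ϖ⁻¹) (-n + -1) := h1.inv.mul hϖ.hasOrder.inv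
  have h6 := mul_mem hh (h5.mem (by omega))
  rwa [← Units.val_mul, mul_inv_cancel_left] at h6

lemma HasOrder.unique (h1 : HasOrder P h m) (h2 : HasOrder P h n) : m = n := by
  have h3 := (h1.mul h2.inv).nonneg (by rw [mul_inv_cancel]; exact one_mem _)
  have h4 := (h2.mul h1.inv).nonneg (by rw [mul_inv_cancel]; exact one_mem _)
  omega

lemma HasValue.hasOrder [NeZero (2 : K)] (hf : f.Separable) {c : AlgebraicClosure K}
    (hh : HasValue ![xFun f, yFun f] ![P.x, P.y] h c) (hc : c ≠ 0) : HasOrder P h 0 := by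
  obtain ⟨ϖ, hϖ, -⟩ := exists_uniformizer hf P
  rw [hasOrder_iff hϖ, neg_zero, zpow_zero, mul_one]
  exact hh.mem_localUnits hc

/-- With `P = (a, b)`, the equation gives `(y - b)(y + b) = (x - a) g(x)`. The factor `y + b` has
the value `2b ≠ 0` at `P`, so `x - a` divides `y - b` locally. -/
lemma isUniformizer_xSub [NeZero (2 : K)] (hP : P.y ≠ 0) :
    IsUniformizer f ![xFun f, yFun f] ![P.x, P.y] (xSub f P.x) := by
  refine isUniformizer_of
    ⟨MvPolynomial.X 0 - MvPolynomial.C P.x, 1, by simp, by simp, by simp [xSub]⟩ ?_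
  obtain ⟨g, hg⟩ := Polynomial.dvd_iff_isRoot.2
    (show (fbar f - C (P.y ^ 2)).IsRoot P.x by simp [P.eq])
  have hy2 : yFun f ^ 2 - algebraMap _ _ (P.y ^ 2) =
      (xFun f - algebraMap _ _ P.x) * aeval (xFun f) g := by
    have := congr_arg (aeval (xFun f)) hg
    rw [map_sub, ← yFun_sq, map_mul, map_sub, Polynomial.aeval_X, Polynomial.aeval_C,
      Polynomial.aeval_C] at this
    exact this
  intro i
  fin_cases i
  · refine ⟨1, 1, by simp, ?_⟩
    simp [xSub]
  · refine ⟨inFirst g, MvPolynomial.X 1 + MvPolynomial.C P.y, ?_, ?_⟩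
    · have h2 : (2 : AlgebraicClosure K) ≠ 0 := by
        have := (map_ne_zero (algebraMap K (AlgebraicClosure K))).2 (NeZero.ne (2 : K))
        rwa [map_ofNat] at this
      simpa [← two_mul] using ⟨h2, hP⟩
    · rw [aeval_inFirst, mul_assoc, Units.inv_mul_eq_iff_eq_mul]
      simp only [Fin.mk_one, Matrix.cons_val_zero, MvPolynomial.aeval_X, Matrix.cons_val_one,
        Matrix.cons_val_fin_one, xSub, IsUnit.unit_spec, map_add, MvPolynomial.aeval_C]
      rw [← hy2, map_pow]
      ring

open Classical in
/-- The order of `x - a` at an affine point. -/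
lemma hasOrder_xSub [NeZero (2 : K)] (hf : f.Separable) (a : AlgebraicClosure K)
    (P : AffinePoint f) :
    HasOrder P (xSub f a) (if P.x = a then if P.y = 0 then 2 else 1 else 0) := by
  split_ifs with h1 h2
  · subst h1
    obtain ⟨ϖ, hϖ, hy⟩ := exists_uniformizer hf P
    have hr : (fbar f).eval P.x = 0 := by rw [← P.eq, h2, zero_pow two_ne_zero]
    have := order_xSub hf hr P hy
    rw [if_pos (show P = weierstrassPoint P.x hr from AffinePoint.ext rfl h2)] at this
    exact ⟨ϖ, hϖ, this⟩
  · subst h1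
    exact (isUniformizer_xSub h2).hasOrder
  · refine HasValue.hasOrder hf (c := P.x - a) ?_ (sub_ne_zero.2 h1)
    exact (hasValue_chart 0).sub (hasValue_algebraMap a)

lemma hasOrder_one [NeZero (2 : K)] (hf : f.Separable) : HasOrder P 1 0 :=
  HasValue.hasOrder hf hasValue_one one_ne_zero

end Order

/-! ### Units fixed by the involution, and existence of orders -/

section Rational

variable {K : Type u} [Field K] [NeZero (2 : K)] {f : K[X]}

variable (f) in
/-- The constant functions. -/
abbrev constUnit : (AlgebraicClosure K)ˣ →* (FunctionField f)ˣ :=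
  Units.map (algebraMap (AlgebraicClosure K) (FunctionField f) : _ →* _)

/-- Every unit of the function field that is fixed by the hyperelliptic involution is a product of
constants and powers of functions `x - a`. -/
lemma mem_of_conjUnit_eq {S : Subgroup (FunctionField f)ˣ} (hc : ∀ c, constUnit f c ∈ S)
    (hx : ∀ a, xSub f a ∈ S) {u : (FunctionField f)ˣ} (hu : conjUnit u = u) : u ∈ S := by
  have key (n : ℕ) : ∀ A : (AlgebraicClosure K)[X], A.natDegree = n → A ≠ 0 →
      ∃ v ∈ S, (v : FunctionField f) = aeval (xFun f) A := by
    induction n with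
    | zero =>
      intro A hA hA0
      rw [natDegree_eq_zero] at hA
      obtain ⟨c, rfl⟩ := hA
      have hc0 : c ≠ 0 := fun h => hA0 (by rw [h, C_0])
      exact ⟨_, hc (Units.mk0 c hc0), by simp⟩
    | succ n ih =>
      intro A hA hA0
      obtain ⟨a, ha⟩ := IsAlgClosed.exists_root A (fun h => by
        rw [natDegree_eq_zero_iff_degree_le_zero.2 h.le] at hA; omega)
      obtain ⟨B, rfl⟩ := dvd_iff_isRoot.2 ha
      have hB0 : B ≠ 0 := right_ne_zero_of_mul hA0
      rw [natDegree_mul (X_sub_C_ne_zero a) hB0, natDegree_X_sub_C] at hA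
      obtain ⟨v, hv, hv'⟩ := ih B (by omega) hB0
      exact ⟨xSub f a * v, mul_mem (hx a) hv, by simp [hv', xSub]⟩
  obtain ⟨r, hr⟩ := exists_of_eq_of_conj_eq (congr_arg Units.val hu)
  -- A unit equal to `0` forces the zero ring, in which the only unit is `1`.
  by_cases hr0 : r = 0
  · have : Subsingleton (FunctionField f) := by
      have h0 : (u : FunctionField f) = 0 := by rw [hr, hr0, map_zero]
      exact subsingleton_of_zero_eq_one (by rw [← u.mul_inv, h0, zero_mul])
    have : u = 1 := Units.ext (Subsingleton.elim _ _)
    rw [this]; exact one_mem _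
  · obtain ⟨v, hv, hv'⟩ := key _ r.num rfl (RatFunc.num_ne_zero hr0)
    obtain ⟨w, hw, hw'⟩ := key _ r.denom rfl r.denom_ne_zero
    have e : u * w = v := by
      refine Units.ext ?_
      rw [Units.val_mul, hv', hw', hr, ← of_algebraMap, ← of_algebraMap, ← map_mul]
      congr 1
      exact ratFunc_mul_denom r
    rw [eq_mul_inv_of_mul_eq e]
    exact mul_mem hv (inv_mem hw)

/-- Units that have an order at `P` form a subgroup, so it is enough to look at constants and at the
functions `x - a`. -/
lemma exists_hasOrder_of_conjUnit_eq (hf : f.Separable) (P : AffinePoint f)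
    {u : (FunctionField f)ˣ} (hu : conjUnit u = u) : ∃ n, HasOrder P u n := by
  let S : Subgroup (FunctionField f)ˣ :=
    { carrier := {u | ∃ n, HasOrder P u n}
      one_mem' := ⟨0, hasOrder_one hf⟩
      mul_mem' := fun ⟨m, h1⟩ ⟨n, h2⟩ => ⟨m + n, h1.mul h2⟩
      inv_mem' := fun ⟨m, h1⟩ => ⟨-m, h1.inv⟩ }
  exact mem_of_conjUnit_eq (S := S)
    (fun c => ⟨0, HasValue.hasOrder hf (hasValue_algebraMap _) c.ne_zero⟩)
    (fun a => ⟨_, hasOrder_xSub hf a P⟩) hu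

/-- The norm `u ū` is a function of `x`, so its order is already known. For regular `u` it bounds
the number of times a uniformizer can be split off, and clearing a denominator in `x` reduces to
regular `u`. -/
lemma exists_hasOrder (hf : f.Separable) (P : AffinePoint f) (h : (FunctionField f)ˣ) :
    ∃ n, HasOrder P h n := by
  obtain ⟨ϖ, hϖ, -⟩ := exists_uniformizer hf P
  -- Induction on the order `m` of `u v`: either `u` has a nonzero value and order `0`, or it
  -- vanishes and `ϖ⁻¹ u` is still regular. For `m = 0`, `u` is a local unit with inverse `v (u
  -- v)⁻¹`.
  have key (m : ℕ) : ∀ u v : (FunctionField f)ˣ,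
      (u : FunctionField f) ∈ localRing f ![xFun f, yFun f] ![P.x, P.y] →
      (v : FunctionField f) ∈ localRing f ![xFun f, yFun f] ![P.x, P.y] →
      HasOrder P (u * v) m → ∃ n, HasOrder P u n := by
    induction m with
    | zero =>
      intro u v hu hv huv
      refine ⟨0, (hasOrder_iff hϖ).2 ?_⟩
      rw [hasOrder_iff hϖ] at huv
      simp only [Nat.cast_zero, neg_zero, zpow_zero, mul_one] at huv ⊢
      refine ⟨hu, ?_⟩
      have := mul_mem hv huv.2
      rwa [← Units.val_mul, mul_inv, mul_comm u⁻¹, mul_inv_cancel_left] at this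
    | succ m ih =>
      intro u v hu hv huv
      obtain ⟨c, hc⟩ := mem_localRing_iff.1 hu
      by_cases hc0 : c = 0
      · subst hc0
        have h1 := hϖ.2 _ (vanishesAt_iff_hasValue.2 hc)
        rw [← Units.val_mul] at h1
        obtain ⟨n, hn⟩ := ih (ϖ⁻¹ * u) v h1 hv (by
          have := hϖ.hasOrder.inv.mul huv
          rw [mul_assoc]
          convert this using 1
          push_cast; ring)
        refine ⟨1 + n, ?_⟩
        have := hϖ.hasOrder.mul hn
        rwa [mul_inv_cancel_left] at this
      · exact ⟨0, hc.hasOrder hf hc0⟩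
  obtain ⟨v, p, hv, e⟩ := exists_mul_eq_aeval (h : FunctionField f)
  obtain ⟨n, hn⟩ := exists_hasOrder_of_conjUnit_eq hf P hv
  have hreg (Q : AffinePoint f) :
      ((h * v : (FunctionField f)ˣ) : FunctionField f) ∈
        localRing f ![xFun f, yFun f] ![Q.x, Q.y] := by
    rw [Units.val_mul, e]
    exact (hasValue_aeval p).mem
  have hreg' : ((conjUnit (h * v) : (FunctionField f)ˣ) : FunctionField f) ∈
      localRing f ![xFun f, yFun f] ![P.x, P.y] := by
    have := mem_localRing_conj conj_xFun conj_y (hreg P.conj)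
    rwa [AffinePoint.conj_y, neg_neg] at this
  obtain ⟨m, hm⟩ := exists_hasOrder_of_conjUnit_eq hf P
    (u := (h * v) * conjUnit (h * v)) (by
      rw [map_mul conjUnit (h * v), conjUnit_conjUnit, mul_comm])
  obtain ⟨m, rfl⟩ := Int.eq_ofNat_of_zero_le (hm.nonneg (mul_mem (hreg P) hreg'))
  obtain ⟨l, hl⟩ := key m _ _ (hreg P) hreg' hm
  refine ⟨l + -n, ?_⟩
  have := hl.mul hn.inv
  rwa [mul_inv_cancel_right] at this

end Rational
end
end EvenHyperelliptic

namespace EvenHyperelliptic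
noncomputable section
universe u

/-! ### The affine divisor of a function -/

section DivisorOf

variable {K : Type u} [Field K] {f : K[X]}

lemma finite_setOf_x_eq (a : AlgebraicClosure K) : {P : AffinePoint f | P.x = a}.Finite := by
  rcases Set.eq_empty_or_nonempty {P : AffinePoint f | P.x = a} with h | ⟨P₀, h⟩
  · rw [h]; exact Set.finite_empty
  · refine (Set.toFinite {P₀, P₀.conj}).subset fun P hP => ?_
    exact AffinePoint.eq_or_eq_conj (hP.trans h.symm)

/-- The hyperelliptic involution on divisors. -/
def conjDivisor : Divisor f →+ Divisor f := Finsupp.mapDomain.addMonoidHom AffinePoint.conj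

lemma AffinePoint.conj_injective : Function.Injective (AffinePoint.conj (f := f)) :=
  Function.LeftInverse.injective AffinePoint.conj_conj

lemma conjDivisor_apply (D : Divisor f) (P : AffinePoint f) : conjDivisor D P = D P.conj := by
  conv_lhs => rw [← P.conj_conj]
  exact Finsupp.mapDomain_apply AffinePoint.conj_injective D _

lemma conjDivisor_single (P : AffinePoint f) (n : ℤ) :
    conjDivisor (Finsupp.single P n) = Finsupp.single P.conj n := Finsupp.mapDomain_single

/-- There is a point above every value of `x`. -/
lemma exists_point (f : K[X]) (a : AlgebraicClosure K) : ∃ P : AffinePoint f, P.x = a := by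
  obtain ⟨b, hb⟩ := IsAlgClosed.exists_pow_nat_eq ((fbar f).eval a) two_pos
  exact ⟨⟨a, b, hb⟩, rfl⟩

lemma divisorDegree_single (P : AffinePoint f) (n : ℤ) :
    divisorDegree f (Finsupp.single P n) = n := by simp [divisorDegree]

variable [NeZero (2 : K)] (hf : f.Separable)

/-- The order of a unit of the function field at an affine point. -/
def ord (P : AffinePoint f) (u : (FunctionField f)ˣ) : ℤ := (exists_hasOrder hf P u).choose

lemma hasOrder_ord (P : AffinePoint f) (u : (FunctionField f)ˣ) : HasOrder P u (ord hf P u) :=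
  (exists_hasOrder hf P u).choose_spec

variable {hf}

lemma HasOrder.ord_eq {P : AffinePoint f} {u : (FunctionField f)ˣ} {n : ℤ} (h : HasOrder P u n) :
    ord hf P u = n := (hasOrder_ord hf P u).unique h

lemma ord_mul (P : AffinePoint f) (u v : (FunctionField f)ˣ) :
    ord hf P (u * v) = ord hf P u + ord hf P v :=
  ((hasOrder_ord hf P u).mul (hasOrder_ord hf P v)).ord_eq

lemma ord_inv (P : AffinePoint f) (u : (FunctionField f)ˣ) : ord hf P u⁻¹ = -ord hf P u :=
  (hasOrder_ord hf P u).inv.ord_eq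

lemma ord_one (P : AffinePoint f) : ord hf P 1 = 0 := (hasOrder_one hf).ord_eq

lemma ord_constUnit (P : AffinePoint f) (c : (AlgebraicClosure K)ˣ) :
    ord hf P (constUnit f c) = 0 :=
  HasOrder.ord_eq (HasValue.hasOrder hf (hasValue_algebraMap _) c.ne_zero)

lemma ord_conj (P : AffinePoint f) (u : (FunctionField f)ˣ) :
    ord hf P.conj (conjUnit u) = ord hf P u := (hasOrder_ord hf P u).conj.ord_eq

lemma ord_nonneg_iff {P : AffinePoint f} {u : (FunctionField f)ˣ} : 0 ≤ ord hf P u ↔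
    (u : FunctionField f) ∈ localRing f ![xFun f, yFun f] ![P.x, P.y] :=
  ⟨(hasOrder_ord hf P u).mem, (hasOrder_ord hf P u).nonneg⟩

lemma HasValue.ne_zero_of_ord_eq_zero {P : AffinePoint f} {u : (FunctionField f)ˣ}
    {c : AlgebraicClosure K} (h : HasValue ![xFun f, yFun f] ![P.x, P.y] u c)
    (hu : ord hf P u = 0) : c ≠ 0 := by
  rintro rfl
  obtain ⟨c', hc'⟩ := mem_localRing_iff.1 (ord_nonneg_iff (u := u⁻¹) |>.1
    (by rw [ord_inv, hu, neg_zero] : 0 ≤ ord hf P u⁻¹))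
  have := h.mul hc'
  rw [Units.mul_inv, zero_mul] at this
  exact zero_ne_one (this.unique (specializes_affine P) hasValue_one)

lemma finite_ord_ne_zero_of_conjUnit_eq {u : (FunctionField f)ˣ} (hu : conjUnit u = u) :
    {P | ord hf P u ≠ 0}.Finite := by
  let S : Subgroup (FunctionField f)ˣ :=
    { carrier := {u | {P | ord hf P u ≠ 0}.Finite}
      one_mem' := by simp [ord_one]
      mul_mem' := fun {a b} h1 h2 => (Set.Finite.union h1 h2).subset fun P hP => by
        by_contra h
        simp only [Set.mem_union, Set.mem_ofPred_eq, not_or, not_not] at h hP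
        exact hP (by rw [ord_mul, h.1, h.2, add_zero])
      inv_mem' := fun {a} h1 => by
        simpa only [Set.mem_ofPred_eq, ord_inv, ne_eq, neg_eq_zero] using h1 }
  refine mem_of_conjUnit_eq (S := S) (fun c => ?_) (fun a => ?_) hu
  · change {P | ord hf P (constUnit f c) ≠ 0}.Finite
    simp [ord_constUnit]
  · refine (finite_setOf_x_eq a).subset fun P hP => ?_
    by_contra h
    refine hP ?_
    have := hasOrder_xSub hf a P
    rw [if_neg (show ¬P.x = a from h)] at this
    exact this.ord_eq

/-- Let `v` be a denominator in `x`. Away from the finitely many points where `v` or the norm of `u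
v` has nonzero order, `u v` and its conjugate are regular with product of nonzero value, so `u v`
has a nonzero value too. -/
lemma finite_ord_ne_zero (u : (FunctionField f)ˣ) : {P | ord hf P u ≠ 0}.Finite := by
  obtain ⟨v, p, hv, e⟩ := exists_mul_eq_aeval (u : FunctionField f)
  have h1 : conjUnit ((u * v) * conjUnit (u * v)) = (u * v) * conjUnit (u * v) := by
    rw [map_mul conjUnit (u * v), conjUnit_conjUnit, mul_comm]
  refine ((finite_ord_ne_zero_of_conjUnit_eq (hf := hf) hv).union
    (finite_ord_ne_zero_of_conjUnit_eq (hf := hf) h1)).subset fun P hP => ?_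
  by_contra h
  simp only [Set.mem_union, Set.mem_ofPred_eq, not_or, not_not] at h hP
  have h2 : ord hf P (u * v) = ord hf P u := by rw [ord_mul, h.1, add_zero]
  have hreg (Q : AffinePoint f) : HasValue ![xFun f, yFun f] ![Q.x, Q.y]
      ((u * v : (FunctionField f)ˣ) : FunctionField f) (MvPolynomial.aeval ![Q.x, Q.y] p) := by
    rw [Units.val_mul, e]
    exact hasValue_aeval p
  have h3 := hasValue_conj conj_xFun conj_y (hreg P.conj)
  rw [AffinePoint.conj_y, neg_neg] at h3
  have h4 := HasValue.ne_zero_of_ord_eq_zero (u := (u * v) * conjUnit (u * v))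
    ((hreg P).mul h3) h.2
  refine hP ?_
  rw [← h2]
  exact ((hreg P).hasOrder hf (left_ne_zero_of_mul h4)).ord_eq

variable (hf)

/-- The divisor of a unit of the function field, on the affine part of the curve. -/
def divisorOf : Additive (FunctionField f)ˣ →+ Divisor f where
  toFun u := Finsupp.ofSupportFinite (fun P => ord hf P u.toMul) (finite_ord_ne_zero u.toMul)
  map_zero' := Finsupp.ext fun P => ord_one (hf := hf) P
  map_add' u v := Finsupp.ext fun P => ord_mul (hf := hf) P u.toMul v.toMul

variable {hf}

lemma divisorOf_apply (u : (FunctionField f)ˣ) (P : AffinePoint f) :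
    divisorOf hf (.ofMul u) P = ord hf P u := rfl

lemma divisorOf_mul (u v : (FunctionField f)ˣ) : divisorOf hf (.ofMul (u * v)) =
    divisorOf hf (.ofMul u) + divisorOf hf (.ofMul v) := map_add (divisorOf hf) _ _

lemma divisorOf_inv (u : (FunctionField f)ˣ) : divisorOf hf (.ofMul u⁻¹) =
    -divisorOf hf (.ofMul u) := map_neg (divisorOf hf) _

lemma divisorOf_conj (u : (FunctionField f)ˣ) :
    divisorOf hf (.ofMul (conjUnit u)) = conjDivisor (divisorOf hf (.ofMul u)) := by
  ext P
  rw [conjDivisor_apply, divisorOf_apply, divisorOf_apply, ← ord_conj P.conj, P.conj_conj]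

/-- At a Weierstrass point the two summands coincide, in accordance with the order `2`. Poles at
infinity are not recorded, so the degree is `2` rather than `0`. -/
lemma divisorOf_xSub (P : AffinePoint f) : divisorOf hf (.ofMul (xSub f P.x)) =
    Finsupp.single P 1 + Finsupp.single P.conj 1 := by
  classical
  have h2 : (2 : AlgebraicClosure K) ≠ 0 := by
    have := (map_ne_zero (algebraMap K (AlgebraicClosure K))).2 (NeZero.ne (2 : K))
    rwa [map_ofNat] at this
  ext Q
  rw [divisorOf_apply, (hasOrder_xSub hf P.x Q).ord_eq, Finsupp.add_apply,
    Finsupp.single_apply, Finsupp.single_apply]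
  have hyy (R : AffinePoint f) : R = R.conj ↔ R.y = 0 := by
    constructor
    · intro h
      have h3 : R.y = -R.y := congr_arg AffinePoint.y h
      have h4 : 2 * R.y = 0 := by linear_combination h3
      exact (mul_eq_zero.1 h4).resolve_left h2
    · intro h
      exact AffinePoint.ext rfl (by rw [AffinePoint.conj_y, h, neg_zero])
  by_cases hx : Q.x = P.x
  · rw [if_pos hx]
    rcases AffinePoint.eq_or_eq_conj hx with rfl | rfl
    · by_cases hy : Q.y = 0
      · rw [if_pos hy, if_pos rfl, if_pos ((hyy Q).2 hy).symm]; rfl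
      · rw [if_neg hy, if_pos rfl, if_neg fun h => hy ((hyy Q).1 h.symm)]; rfl
    · by_cases hy : P.y = 0
      · rw [if_pos (by simpa using hy), if_pos ((hyy P).2 hy), if_pos rfl]; rfl
      · rw [if_neg (by simpa using hy), if_neg fun h => hy ((hyy P).1 h), if_pos rfl]; rfl
  · rw [if_neg hx, if_neg fun h => hx (by rw [h]), if_neg fun h => hx (by rw [← h]; rfl)]; rfl

end DivisorOf

/-! ### Congruences modulo `𝔪` and degrees -/

section Infinity

variable {K : Type u} [Field K] {f : K[X]}

/-- The function `h` has the value `c` at both points at infinity. -/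
def ValueAtInfinity (h : FunctionField f) (c : AlgebraicClosure K) : Prop :=
  ∀ w : InfinitePoint f,
    HasValue ![xInvFun f, yFun f * xInvFun f ^ (f.natDegree / 2)] ![0, w.w] h c

/-- The leading coefficient has a square root in the algebraic closure, so there is a point at
infinity at which to compare; without one the condition would be vacuous. -/
lemma ValueAtInfinity.unique (heven : Even f.natDegree) {h : FunctionField f}
    {c c' : AlgebraicClosure K} (h1 : ValueAtInfinity h c) (h2 : ValueAtInfinity h c') :
    c = c' := by
  obtain ⟨b, hb⟩ := IsAlgClosed.exists_pow_nat_eq (fbar f).leadingCoeff two_pos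
  exact (h1 ⟨b, hb⟩).unique (specializes_infinity heven _) (h2 ⟨b, hb⟩)

lemma ValueAtInfinity.conj {h : FunctionField f} {c : AlgebraicClosure K}
    (h1 : ValueAtInfinity h c) : ValueAtInfinity (conj f h) c := by
  intro w
  have := hasValue_conj conj_xInvFun
    (show EvenHyperelliptic.conj f (yFun f * xInvFun f ^ (f.natDegree / 2)) =
      -(yFun f * xInvFun f ^ (f.natDegree / 2)) by
        rw [map_mul, map_pow, conj_y, conj_xInvFun, neg_mul])
    (h1 ⟨-w.w, by rw [neg_sq, w.eq]⟩)
  rwa [neg_neg] at this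

lemma valueAtInfinity_xInvFun : ValueAtInfinity (xInvFun f) 0 := fun _ => hasValue_chart 0

variable (f) in
/-- The units that are congruent to `1` modulo `𝔪`. -/
def congrOne : Subgroup (FunctionField f)ˣ where
  carrier := {u | ValueAtInfinity (u : FunctionField f) 1}
  one_mem' := fun _ => hasValue_one
  mul_mem' := fun h1 h2 w => by simpa using (h1 w).mul (h2 w)
  inv_mem' := fun h1 w => by simpa using (h1 w).inv one_ne_zero

lemma mem_congrOne {u : (FunctionField f)ˣ} :
    u ∈ congrOne f ↔ ValueAtInfinity (u : FunctionField f) 1 := Iff.rfl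

lemma mem_congrOne_iff {u : (FunctionField f)ˣ} :
    u ∈ congrOne f ↔ ∀ w : InfinitePoint f, VanishesAtInfinity w (↑u - 1) := by
  refine forall_congr' fun w => ?_
  rw [VanishesAtInfinity, HasValue, map_one]

/-- The generators of the closure already form the image of the group `congrOne f` under
`divisorOf`. -/
lemma mem_principalDivisors_iff [NeZero (2 : K)] (hf : f.Separable) {D : Divisor f} :
    D ∈ principalDivisors f ↔ ∃ u ∈ congrOne f, divisorOf hf (.ofMul u) = D := by
  constructor
  · intro h
    refine (AddSubgroup.closure_le ((congrOne f).toAddSubgroup.map (divisorOf hf))).2 ?_ h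
    rintro D ⟨h, h1, h2⟩
    exact ⟨.ofMul h, mem_congrOne_iff.2 h2, Finsupp.ext fun P => HasOrder.ord_eq (hf := hf) (h1 P)⟩
  · rintro ⟨u, hu, rfl⟩
    exact AddSubgroup.subset_closure ⟨u, fun P => hasOrder_ord hf P u, mem_congrOne_iff.1 hu⟩

lemma conjUnit_mem_congrOne {u : (FunctionField f)ˣ} (hu : u ∈ congrOne f) :
    conjUnit u ∈ congrOne f := ValueAtInfinity.conj hu

/-- The unit `1 / x`. -/
def xInvUnit (f : K[X]) : (FunctionField f)ˣ :=
  ⟨xInvFun f, xFun f, by rw [mul_comm, xFun_mul_xInvFun], xFun_mul_xInvFun⟩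

lemma xSub_mul_xInvUnit_mem (a : AlgebraicClosure K) : xSub f a * xInvUnit f ∈ congrOne f := by
  intro w
  have e : ((xSub f a * xInvUnit f : (FunctionField f)ˣ) : FunctionField f) =
      1 - algebraMap _ _ a * xInvFun f := by
    rw [Units.val_mul, ← xFun_mul_xInvFun]
    simp only [xSub, IsUnit.unit_spec, xInvUnit]
    ring
  rw [e]
  simpa using hasValue_one.sub ((hasValue_algebraMap a).mul (valueAtInfinity_xInvFun w))

lemma xSub_div_xSub_mem (a b : AlgebraicClosure K) : xSub f a / xSub f b ∈ congrOne f := by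
  have := div_mem (xSub_mul_xInvUnit_mem (f := f) a) (xSub_mul_xInvUnit_mem b)
  rwa [mul_div_mul_right_eq_div] at this

lemma conjUnit_xSub (a : AlgebraicClosure K) : conjUnit (xSub f a) = xSub f a := by
  refine Units.ext ?_
  change conj f (xFun f - algebraMap _ _ a) = xFun f - algebraMap _ _ a
  rw [map_sub, conj_xFun, AlgHom.commutes]

variable [NeZero (2 : K)] {hf : f.Separable}

/-- Here `m` is the degree of `u` as a rational function of `x`: every value of `x` accounts for two
points of the curve, and `u / x ^ m` is finite and nonzero at infinity. All this is multiplicative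
in `u`, so constants and `x - a` suffice. -/
lemma exists_degree_eq_two_mul {u : (FunctionField f)ˣ} (hu : conjUnit u = u) :
    ∃ (m : ℤ) (c : AlgebraicClosure K), c ≠ 0 ∧
      divisorDegree f (divisorOf hf (.ofMul u)) = 2 * m ∧
      ValueAtInfinity ((u * xInvUnit f ^ m : (FunctionField f)ˣ) : FunctionField f) c := by
  let S : Subgroup (FunctionField f)ˣ :=
    { carrier := {u | ∃ (m : ℤ) (c : AlgebraicClosure K), c ≠ 0 ∧
        divisorDegree f (divisorOf hf (.ofMul u)) = 2 * m ∧
        ValueAtInfinity ((u * xInvUnit f ^ m : (FunctionField f)ˣ) : FunctionField f) c}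
      one_mem' := ⟨0, 1, one_ne_zero, by simp, fun w => by
        simpa using hasValue_one⟩
      mul_mem' := by
        rintro u v ⟨m, c, h1, h2, h3⟩ ⟨m', c', h1', h2', h3'⟩
        refine ⟨m + m', c * c', mul_ne_zero h1 h1', ?_, fun w => ?_⟩
        · rw [divisorOf_mul, map_add, h2, h2']; ring
        · rw [zpow_add, mul_mul_mul_comm]
          exact (h3 w).mul (h3' w)
      inv_mem' := by
        rintro u ⟨m, c, h1, h2, h3⟩
        refine ⟨-m, c⁻¹, inv_ne_zero h1, ?_, fun w => ?_⟩
        · rw [divisorOf_inv, map_neg, h2]; ring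
        · rw [zpow_neg, ← mul_inv]
          exact (h3 w).inv h1 }
  refine mem_of_conjUnit_eq (S := S) (fun c => ?_) (fun a => ?_) hu
  · refine ⟨0, c, c.ne_zero, ?_, fun w => ?_⟩
    · have : divisorOf hf (.ofMul (constUnit f c)) = 0 := Finsupp.ext fun P => ord_constUnit (hf := hf) P c
      rw [this, map_zero, mul_zero]
    · rw [zpow_zero, mul_one]; exact hasValue_algebraMap _
  · obtain ⟨P, rfl⟩ := exists_point f a
    refine ⟨1, 1, one_ne_zero, ?_, ?_⟩
    · rw [divisorOf_xSub, map_add, divisorDegree_single, divisorDegree_single]; rfl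
    · rw [zpow_one]; exact xSub_mul_xInvUnit_mem _

/-- If `m < 0` the function `u` would vanish at infinity, and if `m > 0` the function `u / x ^ m`
would, contrary to the nonzero values of both. -/
lemma divisorDegree_eq_zero (heven : Even f.natDegree) {u : (FunctionField f)ˣ}
    (hu : conjUnit u = u) {c : AlgebraicClosure K} (hc : c ≠ 0)
    (h : ValueAtInfinity (u : FunctionField f) c) :
    divisorDegree f (divisorOf hf (.ofMul u)) = 0 := by
  obtain ⟨m, c', h1, h2, h3⟩ := exists_degree_eq_two_mul (hf := hf) hu
  have hpow (n : ℕ) (w : InfinitePoint f) := (valueAtInfinity_xInvFun w).pow n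
  rcases lt_trichotomy m 0 with hm | rfl | hm
  · obtain ⟨n, hn⟩ := Int.eq_ofNat_of_zero_le (neg_nonneg.2 hm.le)
    have hn0 : n ≠ 0 := by rintro rfl; omega
    refine absurd (ValueAtInfinity.unique heven h (c' := 0) fun w => ?_) hc
    have := (h3 w).mul (hpow n w)
    rw [zero_pow hn0, mul_zero] at this
    convert this using 1
    have e : xInvFun f ^ n = ((xInvUnit f ^ (-m) : (FunctionField f)ˣ) : FunctionField f) := by
      rw [hn]; rfl
    rw [e, ← Units.val_mul, mul_assoc, ← zpow_add, add_neg_cancel, zpow_zero, mul_one]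
  · rw [h2, mul_zero]
  · obtain ⟨n, rfl⟩ := Int.eq_ofNat_of_zero_le hm.le
    have hn0 : n ≠ 0 := by rintro rfl; omega
    refine absurd (ValueAtInfinity.unique heven h3 (c' := 0) fun w => ?_) h1
    have := (h w).mul (hpow n w)
    rw [zero_pow hn0, mul_zero] at this
    exact this

end Infinity
end
end EvenHyperelliptic

namespace EvenHyperelliptic
noncomputable section
universe u

/-! ### Principal divisors supported at Weierstrass points, and representatives of 2-torsion classes
-/

section Torsion

variable {K : Type u} [Field K] {f : K[X]}

lemma divisorDegree_conjDivisor (D : Divisor f) :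
    divisorDegree f (conjDivisor D) = divisorDegree f D := by
  induction D using Finsupp.induction_linear with
  | zero => simp
  | add D E hD hE => simp [hD, hE]
  | single P n => rw [conjDivisor_single, divisorDegree_single, divisorDegree_single]

/-- The product of powers of the functions `(x - x(P)) / (x - c)` with the exponents given by a
divisor. -/
def xSubDivProd (f : K[X]) (c : AlgebraicClosure K) : Divisor f →+ Additive (FunctionField f)ˣ :=
  Finsupp.liftAddHom fun P => zmultiplesHom _ (.ofMul (xSub f P.x / xSub f c))

lemma xSubDivProd_mem (c : AlgebraicClosure K) (D : Divisor f) :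
    (xSubDivProd f c D).toMul ∈ congrOne f := by
  induction D using Finsupp.induction_linear with
  | zero => rw [map_zero, toMul_zero]; exact one_mem _
  | add D E hD hE => rw [map_add, toMul_add]; exact mul_mem hD hE
  | single P n =>
    rw [xSubDivProd, Finsupp.liftAddHom_apply_single, zmultiplesHom_apply, toMul_zsmul,
      toMul_ofMul]
    exact zpow_mem (xSub_div_xSub_mem _ _) n

lemma conjUnit_xSubDivProd (c : AlgebraicClosure K) (D : Divisor f) :
    conjUnit (xSubDivProd f c D).toMul = (xSubDivProd f c D).toMul := by
  induction D using Finsupp.induction_linear with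
  | zero => rw [map_zero, toMul_zero, map_one]
  | add D E hD hE => rw [map_add, toMul_add, map_mul, hD, hE]
  | single P n =>
    rw [xSubDivProd, Finsupp.liftAddHom_apply_single, zmultiplesHom_apply, toMul_zsmul,
      toMul_ofMul, map_zpow, _root_.map_div, conjUnit_xSub, conjUnit_xSub]

variable [NeZero (2 : K)] {hf : f.Separable}

variable (K) in
lemma two_ne_zero_algebraicClosure : (2 : AlgebraicClosure K) ≠ 0 := by
  have := (map_ne_zero (algebraMap K (AlgebraicClosure K))).2 (NeZero.ne (2 : K))
  rwa [map_ofNat] at this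

/-- The product of powers of the functions `x - a` with prescribed exponents. -/
def xSubProd (f : K[X]) : (AlgebraicClosure K →₀ ℤ) →+ Additive (FunctionField f)ˣ :=
  Finsupp.liftAddHom fun a => zmultiplesHom _ (.ofMul (xSub f a))

open Classical in
lemma divisorOf_xSubProd_apply (m : AlgebraicClosure K →₀ ℤ) (P : AffinePoint f) :
    divisorOf hf (xSubProd f m) P = m P.x * (if P.y = 0 then 2 else 1) := by
  induction m using Finsupp.induction_linear with
  | zero => simp
  | add m n hm hn => rw [map_add, map_add, Finsupp.add_apply, hm, hn, Finsupp.add_apply, add_mul]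
  | single a n =>
    rw [xSubProd, Finsupp.liftAddHom_apply_single, zmultiplesHom_apply, map_zsmul,
      Finsupp.smul_apply, divisorOf_apply, (hasOrder_xSub hf a P).ord_eq, Finsupp.single_apply]
    by_cases h : P.x = a
    · rw [if_pos h, if_pos h.symm, smul_eq_mul]
    · rw [if_neg h, if_neg (Ne.symm h), smul_zero, zero_mul]

lemma exists_eq_xSubProd {u : (FunctionField f)ˣ} (hu : conjUnit u = u) :
    ∃ (c : (AlgebraicClosure K)ˣ) (m : AlgebraicClosure K →₀ ℤ),
      u = constUnit f c * (xSubProd f m).toMul := by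
  let S : Subgroup (FunctionField f)ˣ :=
    { carrier := {u | ∃ (c : (AlgebraicClosure K)ˣ) (m : AlgebraicClosure K →₀ ℤ),
        u = constUnit f c * (xSubProd f m).toMul}
      one_mem' := ⟨1, 0, by simp⟩
      mul_mem' := by
        rintro _ _ ⟨c, m, rfl⟩ ⟨c', m', rfl⟩
        exact ⟨c * c', m + m', by rw [map_mul, map_add, toMul_add, mul_mul_mul_comm]⟩
      inv_mem' := by
        rintro _ ⟨c, m, rfl⟩
        exact ⟨c⁻¹, -m, by rw [map_inv, map_neg, toMul_neg, mul_inv]⟩ }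
  refine mem_of_conjUnit_eq (S := S) (fun c => ⟨c, 0, by simp⟩)
    (fun a => ⟨1, Finsupp.single a 1, ?_⟩) hu
  rw [map_one, one_mul, xSubProd, Finsupp.liftAddHom_apply_single, zmultiplesHom_apply, one_zsmul,
    toMul_ofMul]

/-- A rational function in `x` that is regular on the affine curve, and has the same finite nonzero
value at the points at infinity, is constant. -/
lemma eq_algebraMap_of_ord_nonneg (heven : Even f.natDegree) {u : (FunctionField f)ˣ}
    (hu : conjUnit u = u) {c : AlgebraicClosure K} (hc : c ≠ 0)
    (h : ValueAtInfinity (u : FunctionField f) c) (hn : ∀ P, 0 ≤ ord hf P u) :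
    (u : FunctionField f) = algebraMap _ _ c := by
  -- The orders are nonnegative and add up to the degree, which is zero.
  have h0 (P) : ord hf P u = 0 := by
    have hd := divisorDegree_eq_zero (hf := hf) heven hu hc h
    by_contra hP
    have hmem : P ∈ (divisorOf hf (.ofMul u)).support := Finsupp.mem_support_iff.2 hP
    have hd2 : ∑ P ∈ (divisorOf hf (.ofMul u)).support, divisorOf hf (.ofMul u) P = 0 := by
      rw [← hd]; simp [divisorDegree, Finsupp.sum]
    exact hP ((Finset.sum_eq_zero_iff_of_nonneg fun P _ => hn P).1 hd2 P hmem)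
  obtain ⟨c', m, rfl⟩ := exists_eq_xSubProd hu
  -- There is a point above every `a`, and its order is the exponent `m a` times `1` or `2`.
  have hm : m = 0 := by
    ext a
    obtain ⟨P, rfl⟩ := exists_point f a
    have h1 := h0 P
    rw [ord_mul, ord_constUnit, zero_add] at h1
    have h2 := divisorOf_xSubProd_apply (hf := hf) m P
    rw [show divisorOf hf (xSubProd f m) P = 0 from h1] at h2
    refine (mul_eq_zero.1 h2.symm).resolve_right ?_
    split_ifs <;> norm_num
  subst hm
  rw [map_zero, toMul_zero, mul_one] at h ⊢
  rw [h.unique heven fun w => hasValue_algebraMap _]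
  rfl

lemma eq_one_of_conjUnit_eq (heven : Even f.natDegree) {u : (FunctionField f)ˣ}
    (hu : conjUnit u = u) (h : u ∈ congrOne f) (h0 : divisorOf hf (.ofMul u) = 0) : u = 1 := by
  refine Units.ext ?_
  rw [eq_algebraMap_of_ord_nonneg (hf := hf) heven hu one_ne_zero h fun P => ?_, map_one,
    Units.val_one]
  exact (congr($h0 P) : _ = (0 : ℤ)).ge

/-- A function with trivial divisor that is congruent to `1` modulo `𝔪` is trivial. -/
lemma eq_one_of_divisorOf_eq_zero (heven : Even f.natDegree) {u : (FunctionField f)ˣ}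
    (h : u ∈ congrOne f) (h0 : divisorOf hf (.ofMul u) = 0) : u = 1 := by
  -- Write `u = a + b y`. The norm is a function of `x` with trivial divisor and value `1` at
  -- infinity, hence `1`.
  have hN : u * conjUnit u = 1 := by
    refine eq_one_of_conjUnit_eq (hf := hf) heven ?_ (mul_mem h (conjUnit_mem_congrOne h)) ?_
    · rw [map_mul, conjUnit_conjUnit, mul_comm]
    · rw [divisorOf_mul, divisorOf_conj, h0, map_zero, add_zero]
  obtain ⟨a, b, hab⟩ := exists_eq_of_add_of_mul_y (u : FunctionField f)
  have hconj : ((conjUnit u : (FunctionField f)ˣ) : FunctionField f) =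
      AdjoinRoot.of (curvePoly f) a - AdjoinRoot.of (curvePoly f) b * yFun f := by
    change conj f u = _
    rw [hab, map_add, map_mul, conj_of, conj_of, conj_y, mul_neg, sub_eq_add_neg]
  have ht : (u : FunctionField f) + (conjUnit u : (FunctionField f)ˣ) =
      AdjoinRoot.of (curvePoly f) (2 * a) := by
    rw [hconj, hab, map_mul, map_ofNat]; ring
  have htv : ValueAtInfinity (AdjoinRoot.of (curvePoly f) (2 * a)) 2 := by
    intro w
    have := (h w).add (conjUnit_mem_congrOne h w)
    rwa [one_add_one_eq_two, ht] at this
  have h2 := two_ne_zero_algebraicClosure K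
  have ha0 : 2 * a ≠ 0 := by
    intro h3
    rw [h3, map_zero] at htv
    refine h2 (htv.unique heven fun w => ?_)
    simpa using hasValue_algebraMap (f := f) (K := K) 0
  have hreg (v : (FunctionField f)ˣ) (hv : divisorOf hf (.ofMul v) = 0) (P : AffinePoint f) :
      (v : FunctionField f) ∈ localRing f ![xFun f, yFun f] ![P.x, P.y] :=
    ord_nonneg_iff.1 (congr($hv P) : ord hf P v = (0 : ℤ)).ge
  -- The trace `2a` is regular on the affine curve with value `2` at infinity, hence equal to `2`.
  -- So `a = 1`, and the norm `1 - b² y² = 1` then gives `b = 0`.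
  have h3 := eq_algebraMap_of_ord_nonneg (hf := hf) heven
    (u := (isUnit_of_ne_zero (f := f) ha0).unit) (Units.ext (conj_of _)) h2 htv
    (fun P => ord_nonneg_iff.2 (by
      rw [IsUnit.unit_spec, ← ht]
      exact add_mem (hreg u h0 P) (hreg _ (by rw [divisorOf_conj, h0, map_zero]) P)))
  rw [IsUnit.unit_spec, map_ofNat] at h3
  have h4 : AdjoinRoot.of (curvePoly f) (2 * a - 2) +
      AdjoinRoot.of (curvePoly f) 0 * yFun f = 0 := by
    rw [map_sub, h3, map_ofNat, map_zero]; ring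
  have h5 := (of_add_of_mul_y_eq_zero h4).1
  have h2' : (2 : RatFunc (AlgebraicClosure K)) ≠ 0 := left_ne_zero_of_mul ha0
  have ha : a = 1 := mul_left_cancel₀ h2' (by linear_combination h5)
  subst ha
  have h6 : AdjoinRoot.of (curvePoly f) (b ^ 2) * yFun f ^ 2 = 0 := by
    have := congr_arg Units.val hN
    rw [Units.val_mul, hconj, hab, Units.val_one, map_one] at this
    rw [map_pow]
    linear_combination -this
  have h7 : AdjoinRoot.of (curvePoly f) (b ^ 2) + AdjoinRoot.of (curvePoly f) 0 * yFun f = 0 := by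
    rw [((isUnit_yFun hf.ne_zero).pow 2).mul_left_eq_zero.1 h6, map_zero, zero_mul, zero_add]
  have hb : b = 0 := pow_eq_zero_iff two_ne_zero |>.1 (of_add_of_mul_y_eq_zero h7).1
  refine Units.ext ?_
  rw [hab, hb, map_one, map_zero, zero_mul, add_zero, Units.val_one]

/-- The map `x` is ramified at a Weierstrass point: each `x - a` has order `0` or `2` there. -/
lemma even_ord_of_conjUnit_eq {u : (FunctionField f)ˣ} (hu : conjUnit u = u) {P : AffinePoint f}
    (hP : P.y = 0) : Even (ord hf P u) := by
  obtain ⟨c, m, rfl⟩ := exists_eq_xSubProd hu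
  rw [ord_mul, ord_constUnit, zero_add]
  have := divisorOf_xSubProd_apply (hf := hf) m P
  rw [if_pos hP] at this
  exact ⟨m P.x, this.trans (mul_two _)⟩

/-- A divisor supported at the Weierstrass points that vanishes in `J_𝔪` is even. -/
theorem even_of_mem_principalDivisors (heven : Even f.natDegree) (hf : f.Separable) {D : Divisor f}
    (hD : D ∈ principalDivisors f) (hy : ∀ P : AffinePoint f, P.y ≠ 0 → D P = 0)
    (P : AffinePoint f) : Even (D P) := by
  obtain ⟨h, hh, rfl⟩ := (mem_principalDivisors_iff hf).1 hD
  by_cases hP : P.y = 0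
  · refine even_ord_of_conjUnit_eq (hf := hf) (u := h) ?_ hP
    -- Weierstrass points are fixed by the involution, so `h` and its conjugate have the same
    -- divisor. The congruence modulo `𝔪` makes the ratio `1`; trivial divisor alone would leave
    -- room for a constant such as `-1`.
    have hk : h / conjUnit h = 1 := by
      refine eq_one_of_divisorOf_eq_zero (hf := hf) heven
        (div_mem hh (conjUnit_mem_congrOne hh)) ?_
      rw [div_eq_mul_inv, divisorOf_mul, divisorOf_inv, divisorOf_conj]
      ext Q
      rw [Finsupp.add_apply, Finsupp.neg_apply, conjDivisor_apply, Finsupp.zero_apply]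
      by_cases hQ : Q.y = 0
      · have : Q.conj = Q := AffinePoint.ext rfl (by rw [AffinePoint.conj_y, hQ, neg_zero])
        rw [this, add_neg_cancel]
      · rw [hy Q hQ, hy Q.conj (by simpa using hQ), neg_zero, add_zero]
    exact (div_eq_one.1 hk).symm
  · rw [hy P hP]; exact Even.zero

/-- For `D` of degree zero the auxiliary `c` drops out, leaving `D` plus its conjugate as the
divisor of a function of `x` congruent to `1`. -/
lemma divisorOf_xSubDivProd (c : AlgebraicClosure K) (D : Divisor f) :
    divisorOf hf (xSubDivProd f c D) =
      D + conjDivisor D - divisorDegree f D • divisorOf hf (.ofMul (xSub f c)) := by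
  induction D using Finsupp.induction_linear with
  | zero => simp
  | add D E hD hE => simp only [map_add, hD, hE, add_smul]; abel
  | single P n =>
    rw [xSubDivProd, Finsupp.liftAddHom_apply_single, zmultiplesHom_apply, map_zsmul,
      div_eq_mul_inv, divisorOf_mul, divisorOf_inv, divisorOf_xSub, divisorDegree_single,
      conjDivisor_single, ← sub_eq_add_neg, smul_sub, smul_add, Finsupp.smul_single,
      Finsupp.smul_single, smul_eq_mul, mul_one]

lemma divisorDegree_divisorOf (heven : Even f.natDegree) {u : (FunctionField f)ˣ}
    (hu : u ∈ congrOne f) : divisorDegree f (divisorOf hf (.ofMul u)) = 0 := by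
  have h1 := divisorDegree_eq_zero (hf := hf) heven (u := u * conjUnit u)
    (by rw [map_mul, conjUnit_conjUnit, mul_comm]) one_ne_zero
    (mem_congrOne.1 (mul_mem hu (conjUnit_mem_congrOne hu)))
  rw [divisorOf_mul, map_add, divisorOf_conj, divisorDegree_conjDivisor] at h1
  omega

/-- Hilbert 90 for functions congruent to `1` modulo `𝔪`. -/
lemma exists_eq_div_conjUnit (heven : Even f.natDegree) {k : (FunctionField f)ˣ}
    (hk : k ∈ congrOne f) (hN : k * conjUnit k = 1) :
    ∃ u ∈ congrOne f, k = u / conjUnit u := by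
  have h2 := two_ne_zero_algebraicClosure K
  -- The usual Hilbert 90 element `1 + k`, halved so as to be congruent to `1` modulo `𝔪`.
  let w : FunctionField f := algebraMap _ _ (2⁻¹ : AlgebraicClosure K) * (1 + k)
  have hw : ValueAtInfinity w 1 := by
    intro v
    have := (hasValue_algebraMap (2⁻¹ : AlgebraicClosure K)).mul (hasValue_one.add (hk v))
    rwa [one_add_one_eq_two, inv_mul_cancel₀ h2] at this
  have hconj : conj f w * k = w := by
    have e : conj f (k : FunctionField f) * k = 1 := by
      rw [mul_comm]; exact congr_arg Units.val hN
    simp only [w]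
    rw [map_mul, AlgHom.commutes, map_add, map_one]
    linear_combination (algebraMap _ (FunctionField f) (2⁻¹ : AlgebraicClosure K)) * e
  obtain ⟨r, hr⟩ := exists_of_eq_of_conj_eq (h := w * conj f w)
    (by rw [map_mul, conj_conj, mul_comm])
  have hv : ValueAtInfinity (w * conj f w) (1 * 1) := fun v => (hw v).mul (hw.conj v)
  have hr0 : r ≠ 0 := by
    rintro rfl
    rw [hr, map_zero, mul_one] at hv
    refine one_ne_zero (hv.unique heven fun w => ?_)
    simpa using hasValue_algebraMap (f := f) (K := K) 0
  -- The norm of `w` is the image of a rational function `r` of `x`, which is nonzero because it has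
  -- the value `1` at infinity.
  have hunit : IsUnit w := isUnit_of_mul_isUnit_left (hr ▸ isUnit_of_ne_zero hr0)
  refine ⟨hunit.unit, hw, ?_⟩
  rw [eq_div_iff_mul_eq']
  exact Units.ext ((mul_comm _ _).trans hconj)

/-- A `2`-torsion class of `J_𝔪` is represented by a divisor supported at the Weierstrass points. -/
theorem exists_sub_mem_principalDivisors (heven : Even f.natDegree) (hf : f.Separable)
    (hpos : 0 < f.natDegree) {D : Divisor f} (hD : divisorDegree f D = 0)
    (h2 : 2 • D ∈ principalDivisors f) : ∃ E : Divisor f, divisorDegree f E = 0 ∧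
      (∀ P : AffinePoint f, P.y ≠ 0 → E P = 0) ∧ D - E ∈ principalDivisors f := by
  classical
  obtain ⟨h, hh, hdiv⟩ := (mem_principalDivisors_iff hf).1 h2
  obtain ⟨α, hα⟩ := IsAlgClosed.exists_root (fbar f) (by
    intro h
    have : (fbar f).natDegree = 0 := natDegree_eq_zero_iff_degree_le_zero.2 h.le
    rw [natDegree_map] at this
    omega)
  let g := (xSubDivProd f α D).toMul
  have hg : divisorOf hf (.ofMul g) = D + conjDivisor D := by
    change divisorOf hf (xSubDivProd f α D) = _
    rw [divisorOf_xSubDivProd, hD, zero_smul, sub_zero]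
  have hgc : conjUnit g = g := conjUnit_xSubDivProd α D
  have hg1 : g ∈ congrOne f := xSubDivProd_mem α D
  -- The divisor of `h / g` is `2D - (D + D̄) = D - D̄`, so the norm of `h / g` has trivial divisor.
  have hN : (h / g) * conjUnit (h / g) = 1 := by
    refine eq_one_of_conjUnit_eq (hf := hf) heven (by
      rw [map_mul, conjUnit_conjUnit, mul_comm])
      (mul_mem (div_mem hh hg1) (conjUnit_mem_congrOne (div_mem hh hg1))) ?_
    rw [divisorOf_mul, divisorOf_conj, div_eq_mul_inv, divisorOf_mul, divisorOf_inv, hdiv, hg]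
    ext P
    simp only [Finsupp.add_apply, Finsupp.neg_apply, conjDivisor_apply, Finsupp.smul_apply,
      Finsupp.zero_apply, AffinePoint.conj_conj, nsmul_eq_mul]
    push_cast
    ring
  obtain ⟨u, hu, hk⟩ := exists_eq_div_conjUnit heven (div_mem hh hg1) hN
  -- From `D - D̄ = div u - conj (div u)`, the divisor `D - div u` is invariant under the
  -- involution.
  let D' := D - divisorOf hf (.ofMul u)
  have hD' (P : AffinePoint f) : D' P.conj = D' P := by
    have h3 : divisorOf hf (.ofMul (h / g)) = divisorOf hf (.ofMul (u / conjUnit u)) := by rw [hk]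
    rw [div_eq_mul_inv, div_eq_mul_inv, divisorOf_mul, divisorOf_inv, divisorOf_mul,
      divisorOf_inv, divisorOf_conj, hdiv, hg] at h3
    have h4 := congr($h3 P)
    simp only [Finsupp.add_apply, Finsupp.neg_apply, conjDivisor_apply, Finsupp.smul_apply,
      nsmul_eq_mul] at h4
    simp only [D', Finsupp.sub_apply]
    push_cast at h4
    linarith
  have hD'0 : divisorDegree f D' = 0 := by
    rw [map_sub, hD, divisorDegree_divisorOf heven hu, sub_zero]
  -- One point is selected above each `x`, and `n` keeps the part of `D'` there. Off the Weierstrass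
  -- points `D' = n + n̄`, which is also `div q` because `α` is a root and `div (x - α)` is
  -- supported at a Weierstrass point. At the Weierstrass points themselves no condition is imposed.
  choose sec hsec using exists_point f
  let n : Divisor f := D'.filter fun P => P = sec P.x
  let q := (xSubDivProd f α n).toMul
  have hq : q ∈ congrOne f := xSubDivProd_mem α n
  refine ⟨D' - divisorOf hf (.ofMul q), ?_, fun P hP => ?_, ?_⟩
  · rw [map_sub, hD'0, divisorDegree_divisorOf heven hq, sub_zero]
  · have hPα : P.x ≠ α := by
      intro h
      have := P.eq
      rw [h, hα.eq_zero] at this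
      exact hP (pow_eq_zero_iff two_ne_zero |>.1 this)
    have hP' : P ≠ P.conj := by
      intro h
      have h3 : P.y = -P.y := congr_arg AffinePoint.y h
      have h4 : 2 * P.y = 0 := by linear_combination h3
      exact hP ((mul_eq_zero.1 h4).resolve_left (two_ne_zero_algebraicClosure K))
    have h0 : divisorOf hf (.ofMul (xSub f α)) P = 0 := by
      have := hasOrder_xSub hf α P
      rw [if_neg hPα] at this
      exact HasOrder.ord_eq (hf := hf) this
    have hq' : divisorOf hf (.ofMul q) P = n P + n P.conj := by
      change divisorOf hf (xSubDivProd f α n) P = _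
      rw [divisorOf_xSubDivProd, Finsupp.sub_apply, Finsupp.add_apply, Finsupp.smul_apply, h0,
        smul_zero, sub_zero, conjDivisor_apply]
    rw [Finsupp.sub_apply, hq', Finsupp.filter_apply, Finsupp.filter_apply, AffinePoint.conj_x]
    rcases AffinePoint.eq_or_eq_conj (hsec P.x) with h | h
    · rw [h, if_pos rfl, if_neg hP'.symm, add_zero, sub_self]
    · rw [h, if_neg hP', if_pos rfl, zero_add, hD', sub_self]
  · refine (mem_principalDivisors_iff hf).2 ⟨u * q, mul_mem hu hq, ?_⟩
    rw [divisorOf_mul]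
    simp only [D']
    abel

end Torsion
end
end EvenHyperelliptic

namespace EvenHyperelliptic
noncomputable section
universe u

/-! ### Geometric points of `K_{f,2}` as ordered pairs of distinct roots -/

section EtalePoint

variable {K : Type u} [Field K] {f : K[X]}

/-- An ordered pair of distinct roots of `f` is a geometric point of `K_{f,2}`. -/
lemma exists_etaleTwo_point {α β : AlgebraicClosure K} (hα : (fbar f).eval α = 0)
    (hβ : (fbar f).eval β = 0) (h : α ≠ β) : ∃ t : EtaleTwo f →ₐ[K] AlgebraicClosure K,
      t (EtaleTwo.var f 0) = α ∧ t (EtaleTwo.var f 1) = β := by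
  refine ⟨Ideal.Quotient.liftₐ _ (MvPolynomial.aeval ![α, β, (α - β)⁻¹]) fun p hp => ?_, ?_, ?_⟩
  · refine Submodule.span_induction (p := fun p _ => MvPolynomial.aeval
      ![α, β, (α - β)⁻¹] p = 0) ?_ (map_zero _)
      (fun a b _ _ ha hb => by rw [map_add, ha, hb, add_zero])
      (fun a b _ hb => by rw [smul_eq_mul, map_mul, hb, mul_zero]) hp
    rintro q (rfl | rfl | rfl)
    · rw [← Polynomial.aeval_algHom_apply, MvPolynomial.aeval_X]
      simpa [Polynomial.eval_map_algebraMap] using hα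
    · rw [← Polynomial.aeval_algHom_apply, MvPolynomial.aeval_X]
      simpa [Polynomial.eval_map_algebraMap] using hβ
    · simp [inv_mul_cancel₀ (sub_ne_zero.2 h)]
  · refine (Ideal.Quotient.lift_mk _ _ _).trans ?_
    simp
  · refine (Ideal.Quotient.lift_mk _ _ _).trans ?_
    simp

lemma EtaleTwo.ne (t : EtaleTwo f →ₐ[K] AlgebraicClosure K) :
    t (EtaleTwo.var f 0) ≠ t (EtaleTwo.var f 1) := by
  intro h
  have := congr_arg t (EtaleTwo.inv_mul f)
  rw [map_mul, map_sub, h, sub_self, mul_zero, map_one] at this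
  exact zero_ne_one this

lemma EtaleTwo.point_ext {t t' : EtaleTwo f →ₐ[K] AlgebraicClosure K}
    (h0 : t (EtaleTwo.var f 0) = t' (EtaleTwo.var f 0))
    (h1 : t (EtaleTwo.var f 1) = t' (EtaleTwo.var f 1)) : t = t' := by
  refine EtaleTwo.algHom_ext f fun i => ?_
  fin_cases i
  · exact h0
  · exact h1
  · have i1 := congr_arg t (EtaleTwo.inv_mul f)
    have i2 := congr_arg t' (EtaleTwo.inv_mul f)
    rw [map_mul, map_sub, map_one] at i1 i2
    rw [h0, h1] at i1
    exact mul_right_cancel₀ (right_ne_zero_of_mul_eq_one i2) (i1.trans i2.symm)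

end EtalePoint

/-! ### `J_𝔪[2]` as even sets of roots -/

section Coordinates

variable {K : Type u} [Field K] {f : K[X]}

variable (f) in
/-- The divisors of degree zero that are supported at the Weierstrass points. -/
def weierstrassDivisors : AddSubgroup (Divisor f) where
  carrier := {D | divisorDegree f D = 0 ∧ ∀ P : AffinePoint f, P.y ≠ 0 → D P = 0}
  zero_mem' := ⟨map_zero _, fun _ _ => rfl⟩
  add_mem' := fun ⟨h1, h2⟩ ⟨h3, h4⟩ => ⟨by rw [map_add, h1, h3, add_zero], fun P hP => by
    rw [Finsupp.add_apply, h2 P hP, h4 P hP, add_zero]⟩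
  neg_mem' := fun ⟨h1, h2⟩ => ⟨by rw [map_neg, h1, neg_zero], fun P hP => by
    rw [Finsupp.neg_apply, h2 P hP, neg_zero]⟩

lemma weierstrassDivisors_le : weierstrassDivisors f ≤ divisorsDegZero f := fun _ hD => hD.1

lemma exists_root_fbar (hpos : 0 < f.natDegree) : ∃ α, (fbar f).eval α = 0 :=
  IsAlgClosed.exists_root (fbar f) (by
    intro h
    have : (fbar f).natDegree = 0 := natDegree_eq_zero_iff_degree_le_zero.2 h.le
    rw [natDegree_map] at this
    omega)

variable (f) in
/-- Half of the coordinates of a divisor: the multiplicities above each value of `x`, modulo `2`. -/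
def parity : Divisor f →+ (AlgebraicClosure K → ZMod 2) where
  toFun D a := ((D.mapDomain AffinePoint.x a : ℤ) : ZMod 2)
  map_zero' := by ext a; simp
  map_add' D E := by ext a; simp [Finsupp.mapDomain_add]

open Classical in
lemma parity_single (P : AffinePoint f) :
    parity f (Finsupp.single P 1) = Pi.single P.x 1 := by
  ext a
  change ((Finsupp.mapDomain AffinePoint.x (Finsupp.single P 1) a : ℤ) : ZMod 2) = _
  rw [Finsupp.mapDomain_single, Finsupp.single_apply, Pi.single_apply]
  simp only [eq_comm (b := a)]
  split_ifs <;> simp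

lemma mapDomain_x_apply {D : Divisor f} (hD : D ∈ weierstrassDivisors f) {P : AffinePoint f}
    (hP : P.y = 0) : D.mapDomain AffinePoint.x P.x = D P := by
  refine Finsupp.mapDomain_apply' {P : AffinePoint f | P.y = 0} D (fun Q hQ => ?_)
    (fun Q hQ Q' hQ' h => AffinePoint.ext h (Eq.trans hQ (Eq.symm hQ'))) hP
  by_contra h
  exact (Finsupp.mem_support_iff.1 hQ) (hD.2 Q h)

lemma parity_eq_zero_iff {D : Divisor f} (hD : D ∈ weierstrassDivisors f) :
    parity f D = 0 ↔ ∀ P, Even (D P) := by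
  classical
  constructor
  · intro h P
    by_cases hP : P.y = 0
    · rw [← mapDomain_x_apply hD hP, ← ZMod.intCast_eq_zero_iff_even]
      exact congr_fun h P.x
    · rw [hD.2 P hP]; exact Even.zero
  · intro h
    ext a
    by_cases ha : D.mapDomain AffinePoint.x a = 0
    · change ((D.mapDomain AffinePoint.x a : ℤ) : ZMod 2) = 0
      rw [ha, Int.cast_zero]
    · obtain ⟨P, hP, rfl⟩ := Finset.mem_image.1
        (Finsupp.mapDomain_support (Finsupp.mem_support_iff.2 ha))
      have hy : P.y = 0 := by
        by_contra hy
        exact (Finsupp.mem_support_iff.1 hP) (hD.2 P hy)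
      change ((D.mapDomain AffinePoint.x P.x : ℤ) : ZMod 2) = 0
      rw [mapDomain_x_apply hD hy, ZMod.intCast_eq_zero_iff_even]
      exact h P

variable [NeZero (2 : K)]

lemma two_nsmul_mem_principalDivisors (hf : f.Separable) {D : Divisor f}
    (hD : D ∈ weierstrassDivisors f) : 2 • D ∈ principalDivisors f := by
  -- The base value `0` is arbitrary, since the degree is zero; a Weierstrass divisor equals its
  -- conjugate, so `D + D̄ = 2D`.
  refine (mem_principalDivisors_iff hf).2 ⟨_, xSubDivProd_mem 0 D, ?_⟩
  rw [ofMul_toMul, divisorOf_xSubDivProd, hD.1, zero_smul, sub_zero, two_nsmul]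
  congr 1
  ext P
  rw [conjDivisor_apply]
  by_cases hP : P.y = 0
  · congr 1
    exact AffinePoint.ext rfl (by rw [AffinePoint.conj_y, hP, neg_zero])
  · rw [hD.2 P hP, hD.2 _ (by simpa using hP)]

/-- The class in `J_𝔪[2]` of a divisor supported at the Weierstrass points. -/
def weierstrassClass (hf : f.Separable) : weierstrassDivisors f →+ GenJacobianTwo f :=
  ((QuotientAddGroup.mk' _).comp (AddSubgroup.inclusion weierstrassDivisors_le)).codRestrict _
    fun D => by
      refine (AddSubgroup.torsionBy.nsmul_iff (n := 2)).2 ?_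
      rw [← map_nsmul]
      refine (QuotientAddGroup.eq_zero_iff _).2 ?_
      rw [AddSubgroup.mem_addSubgroupOf]
      exact two_nsmul_mem_principalDivisors hf D.2

lemma weierstrassClass_eq_zero_iff (hf : f.Separable) (D : weierstrassDivisors f) :
    weierstrassClass hf D = 0 ↔ (D : Divisor f) ∈ principalDivisors f := by
  refine Subtype.ext_iff.trans ?_
  refine (QuotientAddGroup.eq_zero_iff (AddSubgroup.inclusion weierstrassDivisors_le D)).trans ?_
  rw [AddSubgroup.mem_addSubgroupOf]
  rfl

lemma weierstrassClass_surjective (heven : Even f.natDegree) (hf : f.Separable)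
    (hpos : 0 < f.natDegree) : Function.Surjective (weierstrassClass hf) := by
  intro c
  obtain ⟨D, hD⟩ := QuotientAddGroup.mk_surjective c.1
  have h2 : 2 • c.1 = 0 := (AddSubgroup.torsionBy.nsmul_iff (n := 2)).1 c.2
  rw [← hD, ← QuotientAddGroup.mk_nsmul, QuotientAddGroup.eq_zero_iff,
    AddSubgroup.mem_addSubgroupOf] at h2
  obtain ⟨E, h3, h4, h5⟩ := exists_sub_mem_principalDivisors heven hf hpos
    (show divisorDegree f D.1 = 0 from D.2) h2
  refine ⟨⟨E, h3, h4⟩, Subtype.ext ?_⟩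
  rw [← hD]
  refine QuotientAddGroup.eq.2 ?_
  rw [AddSubgroup.mem_addSubgroupOf]
  change -E + D.1 ∈ _
  rwa [neg_add_eq_sub]

lemma weierstrassClass_eq_zero_iff_parity (heven : Even f.natDegree) (hf : f.Separable)
    (D : weierstrassDivisors f) :
    weierstrassClass hf D = 0 ↔ parity f (D : Divisor f) = 0 := by
  rw [parity_eq_zero_iff D.2]
  constructor
  · intro h P
    rw [weierstrassClass_eq_zero_iff] at h
    exact even_of_mem_principalDivisors heven hf h D.2.2 P
  · intro h
    -- If all multiplicities are even, `D = 2E` with `E` again of degree zero and supported at the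
    -- Weierstrass points, and twice such a divisor is principal.
    let E : Divisor f := D.1.mapRange (· / 2) (Int.zero_ediv 2)
    have hE : D.1 = 2 • E := by
      ext P
      rw [Finsupp.smul_apply, Finsupp.mapRange_apply, nsmul_eq_mul, Nat.cast_ofNat,
        Int.mul_ediv_cancel' (h P).two_dvd]
    have hE' : E ∈ weierstrassDivisors f := by
      refine ⟨?_, fun P hP => ?_⟩
      · have := D.2.1
        rw [hE, map_nsmul, nsmul_eq_mul] at this
        exact (mul_eq_zero.1 this).resolve_left (by norm_num)
      · rw [Finsupp.mapRange_apply, D.2.2 P hP, Int.zero_ediv]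
    rw [weierstrassClass_eq_zero_iff, hE]
    exact two_nsmul_mem_principalDivisors hf hE'

open Classical in
/-- The identification of `J_𝔪[2]` with a space of functions on the roots of `f`. -/
theorem exists_coordinates (heven : Even f.natDegree) (hf : f.Separable)
    (hpos : 0 < f.natDegree) :
    ∃ ξ : GenJacobianTwo f →ₗ[ZMod 2] (AlgebraicClosure K → ZMod 2), Function.Injective ξ ∧
      ∀ t : EtaleTwo f →ₐ[K] AlgebraicClosure K, ξ (rootClass hf t) =
        Pi.single (t (EtaleTwo.var f 0)) 1 + Pi.single (t (EtaleTwo.var f 1)) 1 := by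
  let π : weierstrassDivisors f →+ (AlgebraicClosure K → ZMod 2) :=
    (parity f).comp (weierstrassDivisors f).subtype
  have hsurj := weierstrassClass_surjective heven hf hpos
  have hker : (weierstrassClass hf).ker ≤ π.ker := fun D hD =>
    (weierstrassClass_eq_zero_iff_parity heven hf D).1 hD
  -- `weierstrassClass` and `parity` have the same kernel: one inclusion makes `ξ` well defined, the
  -- other makes it injective.
  let ξ := (weierstrassClass hf).liftOfSurjective hsurj ⟨π, hker⟩
  have hξ (D) : ξ (weierstrassClass hf D) = parity f D.1 :=
    AddMonoidHom.liftOfRightInverse_comp_apply _ _ _ ⟨π, hker⟩ D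
  refine ⟨ξ.toZModLinearMap 2, ?_, fun t => ?_⟩
  · refine (injective_iff_map_eq_zero (ξ.toZModLinearMap 2)).2 fun c hc => ?_
    obtain ⟨D, rfl⟩ := hsurj c
    exact (weierstrassClass_eq_zero_iff_parity heven hf D).2 ((hξ D).symm.trans hc)
  · let D := rootDivisor (eval_root t 0 (Or.inl rfl)) (eval_root t 1 (Or.inr rfl))
    have hD : D.1 ∈ weierstrassDivisors f := by
      refine ⟨D.2, fun P hP => ?_⟩
      change (Finsupp.single _ 1 - Finsupp.single _ 1 : Divisor f) P = 0
      rw [Finsupp.sub_apply, Finsupp.single_eq_of_ne, Finsupp.single_eq_of_ne, sub_zero]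
      · rintro rfl; exact hP rfl
      · rintro rfl; exact hP rfl
    change ξ (weierstrassClass hf ⟨D.1, hD⟩) = _
    rw [hξ]
    change parity f (Finsupp.single _ 1 - Finsupp.single _ 1) = _
    rw [map_sub, parity_single, parity_single]
    ext a
    rw [Pi.sub_apply, Pi.add_apply, CharTwo.sub_eq_add]
    rfl

/-- `J_𝔪[2]` is spanned by the differences of Weierstrass points. -/
theorem span_rootClass (heven : Even f.natDegree) (hf : f.Separable) (hpos : 0 < f.natDegree) :
    Submodule.span (ZMod 2) (Set.range (rootClass hf)) = ⊤ := by
  refine (Submodule.eq_top_iff'.2 fun c => ?_)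
  obtain ⟨D, rfl⟩ := weierstrassClass_surjective heven hf hpos c
  obtain ⟨α, hα⟩ := exists_root_fbar hpos
  let P₀ := weierstrassPoint α hα
  have hmem (P : AffinePoint f) (hP : P.y = 0) :
      Finsupp.single P 1 - Finsupp.single P₀ 1 ∈ weierstrassDivisors f := by
    refine ⟨by rw [map_sub, divisorDegree_single, divisorDegree_single, sub_self],
      fun Q hQ => ?_⟩
    rw [Finsupp.sub_apply, Finsupp.single_eq_of_ne, Finsupp.single_eq_of_ne, sub_zero]
    · rintro rfl; exact hQ rfl
    · rintro rfl; exact hQ hP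
  have hy (P : D.1.support) : P.1.y = 0 := by
    by_contra hy
    exact (Finsupp.mem_support_iff.1 P.2) (D.2.2 P hy)
  -- The degree is zero, so subtracting `P₀` from every point of `D`, with multiplicity, changes
  -- nothing.
  have hsum : D = ∑ P : D.1.support, D.1 P • (⟨_, hmem P.1 (hy P)⟩ : weierstrassDivisors f) := by
    refine Subtype.ext ?_
    rw [AddSubgroup.val_finsetSum]
    simp only [AddSubgroup.coe_zsmul]
    rw [Finset.sum_coe_sort D.1.support
      (fun P => D.1 P • (Finsupp.single P 1 - Finsupp.single P₀ 1))]
    simp only [smul_sub, Finsupp.smul_single, smul_eq_mul, mul_one, Finset.sum_sub_distrib]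
    have h1 : ∑ P ∈ D.1.support, Finsupp.single P (D.1 P) = D.1 := Finsupp.sum_single D.1
    have h2 : ∑ P ∈ D.1.support, Finsupp.single P₀ (D.1 P) = 0 := by
      rw [← Finsupp.single_finsetSum]
      have : ∑ P ∈ D.1.support, D.1 P = 0 := by
        rw [← D.2.1]; simp [divisorDegree, Finsupp.sum]
      rw [this, Finsupp.single_zero]
    rw [h1, h2, sub_zero]
  rw [hsum, map_sum]
  refine Submodule.sum_mem _ fun P _ => ?_
  rw [map_zsmul]
  refine zsmul_mem ?_ _
  by_cases h : P.1.x = α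
  · have : (⟨_, hmem P.1 (hy P)⟩ : weierstrassDivisors f) = 0 := by
      refine Subtype.ext ?_
      have : P.1 = P₀ := AffinePoint.ext h (hy P)
      change Finsupp.single P.1 1 - Finsupp.single P₀ 1 = 0
      rw [this, sub_self]
    rw [this, map_zero]
    exact zero_mem _
  · have hr : (fbar f).eval P.1.x = 0 := by rw [← P.1.eq, hy P, zero_pow two_ne_zero]
    obtain ⟨t, h0, h1⟩ := exists_etaleTwo_point hr hα h
    refine Submodule.subset_span ⟨t, ?_⟩
    refine Subtype.ext ?_
    change QuotientAddGroup.mk _ = QuotientAddGroup.mk _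
    congr 1
    refine Subtype.ext ?_
    change Finsupp.single (weierstrassPoint _ _) 1 - Finsupp.single (weierstrassPoint _ _) 1 =
      Finsupp.single P.1 1 - Finsupp.single P₀ 1
    congr 2
    · exact AffinePoint.ext h0 (hy P).symm
    · exact AffinePoint.ext h1 rfl

end Coordinates
end
end EvenHyperelliptic

namespace EvenHyperelliptic
noncomputable section
universe u

/-! ### Functions on unordered pairs of roots, and the Galois action on them -/

section PairVectors

variable {K : Type u} [Field K] {f : K[X]}

/-- The unordered pair underlying an ordered pair of roots. -/
abbrev toPair (t : EtaleTwo f →ₐ[K] AlgebraicClosure K) :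
    EtaleSym f →ₐ[K] AlgebraicClosure K := t.comp (EtaleSym f).val

lemma finite_etaleTwo_points (hf : f ≠ 0) : Finite (EtaleTwo f →ₐ[K] AlgebraicClosure K) := by
  have hR : {a | (fbar f).IsRoot a}.Finite := Polynomial.finite_setOfPred_isRoot
    ((Polynomial.map_ne_zero_iff (algebraMap K (AlgebraicClosure K)).injective).2 hf)
  have := hR.to_subtype
  refine Finite.of_injective (β := {a | (fbar f).IsRoot a} × {a | (fbar f).IsRoot a})
    (fun t => (⟨_, eval_root t 0 (Or.inl rfl)⟩, ⟨_, eval_root t 1 (Or.inr rfl)⟩)) fun t t' h => ?_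
  exact EtaleTwo.point_ext (congr_arg (fun p => p.1.1) h) (congr_arg (fun p => p.2.1) h)

lemma finite_etaleSym_points (hf : f ≠ 0) : Finite (EtaleSym f →ₐ[K] AlgebraicClosure K) := by
  have := finite_etaleTwo_points hf
  exact Finite.of_surjective toPair fun s => exists_extension s

variable (f) in
/-- The value at a pair of roots `{α, β}` of the alternating form `v ∧ w ↦ v α * w β - v β * w α`
on functions on the roots. Modulo `2` it does not depend on the order of `α` and `β`. -/
def pairForm (v w : AlgebraicClosure K → ZMod 2) (s : EtaleSym f →ₐ[K] AlgebraicClosure K) :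
    ZMod 2 :=
  v ((exists_extension s).choose (EtaleTwo.var f 0)) *
    w ((exists_extension s).choose (EtaleTwo.var f 1)) -
  v ((exists_extension s).choose (EtaleTwo.var f 1)) *
    w ((exists_extension s).choose (EtaleTwo.var f 0))

/-- This disposes of every choice of an ordering: the chosen ordering of the pair is `t` or its
interchange, and `F` does not see the difference. -/
lemma apply_eq_of_symm {A : Type*} {F : AlgebraicClosure K → AlgebraicClosure K → A}
    (hF : ∀ a b, F a b = F b a) (t : EtaleTwo f →ₐ[K] AlgebraicClosure K) :
    F ((exists_extension (toPair t)).choose (EtaleTwo.var f 0))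
      ((exists_extension (toPair t)).choose (EtaleTwo.var f 1)) =
    F (t (EtaleTwo.var f 0)) (t (EtaleTwo.var f 1)) := by
  rcases eq_or_swap (exists_extension (toPair t)).choose_spec with h | h
  · rw [h]
  · rw [h, AlgHom.comp_apply, AlgHom.comp_apply, EtaleTwo.swap_zero, EtaleTwo.swap_one, hF]

lemma pairForm_toPair (v w : AlgebraicClosure K → ZMod 2)
    (t : EtaleTwo f →ₐ[K] AlgebraicClosure K) : pairForm f v w (toPair t) =
      v (t (EtaleTwo.var f 0)) * w (t (EtaleTwo.var f 1)) +
      v (t (EtaleTwo.var f 1)) * w (t (EtaleTwo.var f 0)) := by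
  rw [← CharTwo.sub_eq_add]
  exact apply_eq_of_symm (F := fun a b => v a * w b - v b * w a)
    (fun a b => by rw [CharTwo.sub_eq_add, CharTwo.sub_eq_add, add_comm]) t

lemma toPair_eq_iff {t t' : EtaleTwo f →ₐ[K] AlgebraicClosure K} :
    toPair t = toPair t' ↔ t = t' ∨ t = t'.comp (EtaleTwo.swap f) := by
  refine ⟨eq_or_swap, ?_⟩
  rintro (rfl | rfl)
  · rfl
  · refine AlgHom.ext fun b => ?_
    exact congr_arg t' b.2

lemma ite_mul_ite_eq (p q : Prop) [Decidable p] [Decidable q] :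
    ((if p then 1 else 0) * if q then 1 else 0 : ZMod 2) = if p ∧ q then 1 else 0 := by
  split_ifs <;> simp_all

open Classical in
-- A basis vector `e_{αβ}` is itself a minor, namely that of the indicator functions of `α` and `β`,
-- with signs irrelevant modulo `2`. Identities between graphs thereby become polynomial identities
-- in values of indicator functions.
lemma pairVector_toPair (t t' : EtaleTwo f →ₐ[K] AlgebraicClosure K) :
    pairVector t (toPair t') =
      (Pi.single (t (EtaleTwo.var f 0)) 1 : AlgebraicClosure K → ZMod 2) (t' (EtaleTwo.var f 0)) *
        (Pi.single (t (EtaleTwo.var f 1)) 1 : AlgebraicClosure K → ZMod 2)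
          (t' (EtaleTwo.var f 1)) +
      (Pi.single (t (EtaleTwo.var f 0)) 1 : AlgebraicClosure K → ZMod 2) (t' (EtaleTwo.var f 1)) *
        (Pi.single (t (EtaleTwo.var f 1)) 1 : AlgebraicClosure K → ZMod 2)
          (t' (EtaleTwo.var f 0)) := by
  rw [pairVector, Finsupp.single_apply]
  simp only [Pi.single_apply]
  have hne := EtaleTwo.ne t
  by_cases h : toPair t' = toPair t
  · rw [if_pos h.symm]
    rcases toPair_eq_iff.1 h with rfl | rfl
    · simp [hne, hne.symm]
    · simp [hne, hne.symm]
  · rw [if_neg (Ne.symm h)]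
    rw [toPair_eq_iff, not_or] at h
    have h1 : ¬(t' (EtaleTwo.var f 0) = t (EtaleTwo.var f 0) ∧
        t' (EtaleTwo.var f 1) = t (EtaleTwo.var f 1)) := fun h' =>
      h.1 (EtaleTwo.point_ext h'.1 h'.2)
    have h2 : ¬(t' (EtaleTwo.var f 1) = t (EtaleTwo.var f 0) ∧
        t' (EtaleTwo.var f 0) = t (EtaleTwo.var f 1)) := fun h' =>
      h.2 (EtaleTwo.point_ext (by simp [h'.2]) (by simp [h'.1]))
    simp only [ite_mul_ite_eq, if_neg h1, if_neg h2, add_zero]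

lemma ext_toPair {b b' : (EtaleSym f →ₐ[K] AlgebraicClosure K) →₀ ZMod 2}
    (h : ∀ t, b (toPair t) = b' (toPair t)) : b = b' := by
  ext s
  obtain ⟨t, rfl⟩ := exists_extension s
  exact h t

lemma toPair_galPoint (σ : GalK K) (t : EtaleTwo f →ₐ[K] AlgebraicClosure K) :
    galPoint σ (toPair t) = toPair (galPoint σ t) := rfl

lemma indRep_apply_galPoint (σ : GalK K)
    (b : (EtaleSym f →ₐ[K] AlgebraicClosure K) →₀ ZMod 2)
    (s : EtaleSym f →ₐ[K] AlgebraicClosure K) :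
    indRep (K := K) (EtaleSym f) σ b (galPoint σ s) = b s := by
  refine Finsupp.mapDomain_apply (fun s s' h => ?_) b s
  exact AlgHom.ext fun x => σ.injective (congr($h x))

/-- Every `a` is algebraic over `K`, so its stabilizer is open, and `σ ↦ σ a` is constant on left
cosets of it. -/
lemma isLocallyConstant_apply (a : AlgebraicClosure K) :
    IsLocallyConstant fun σ : GalK K => σ a := by
  rw [IsLocallyConstant.iff_exists_open]
  intro σ
  refine ⟨(σ⁻¹ * ·) ⁻¹' (MulAction.stabilizer (GalK K) a), ?_, ?_, fun τ hτ => ?_⟩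
  · exact (stabilizer_isOpen_of_isIntegral a).preimage (continuous_const_mul σ⁻¹)
  · simp
  · have h : (σ⁻¹ * τ) • a = a := hτ
    rw [mul_smul, inv_smul_eq_iff] at h
    exact h

lemma isLocallyConstant_indRep (b : (EtaleSym f →ₐ[K] AlgebraicClosure K) →₀ ZMod 2) :
    IsLocallyConstant fun σ => indRep (K := K) (EtaleSym f) σ b := by
  induction b using Finsupp.induction_linear with
  | zero => simp only [map_zero]; exact IsLocallyConstant.const 0
  | add b b' hb hb' => simp only [map_add]; exact hb.add hb'
  | single s c =>
    obtain ⟨t, rfl⟩ := exists_extension s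
    have h1 := isLocallyConstant_apply (t (EtaleTwo.var f 0))
    have h2 := isLocallyConstant_apply (t (EtaleTwo.var f 1))
    rw [IsLocallyConstant.iff_eventually_eq] at h1 h2 ⊢
    intro σ
    filter_upwards [h1 σ, h2 σ] with τ e1 e2
    have e : galPoint τ t = galPoint σ t := EtaleTwo.point_ext e1 e2
    change Finsupp.mapDomain (galPoint τ) (Finsupp.single (toPair t) c) =
      Finsupp.mapDomain (galPoint σ) (Finsupp.single (toPair t) c)
    rw [Finsupp.mapDomain_single, Finsupp.mapDomain_single, toPair_galPoint, toPair_galPoint, e]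

open Classical in
-- The sum counts the ordered pairs of distinct roots equal to `(γ, β)`: one if `γ ≠ β`, none
-- otherwise.
lemma sum_single_mul_single [Fintype (EtaleTwo f →ₐ[K] AlgebraicClosure K)]
    {γ β : AlgebraicClosure K} (hγ : (fbar f).eval γ = 0) (hβ : (fbar f).eval β = 0) :
    ∑ t : EtaleTwo f →ₐ[K] AlgebraicClosure K,
      (Pi.single γ 1 : AlgebraicClosure K → ZMod 2) (t (EtaleTwo.var f 0)) *
      (Pi.single β 1 : AlgebraicClosure K → ZMod 2) (t (EtaleTwo.var f 1)) =
      1 + (Pi.single β 1 : AlgebraicClosure K → ZMod 2) γ := by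
  simp only [Pi.single_apply, ite_mul_ite_eq]
  by_cases h : γ = β
  · subst h
    rw [if_pos rfl, CharTwo.add_self_eq_zero]
    refine Finset.sum_eq_zero fun t _ => if_neg ?_
    rintro ⟨h1, h2⟩
    exact EtaleTwo.ne t (h1.trans h2.symm)
  · obtain ⟨t, h1, h2⟩ := exists_etaleTwo_point hγ hβ h
    rw [if_neg h, add_zero, Finset.sum_eq_single t]
    · rw [if_pos ⟨h1, h2⟩]
    · intro t' _ h'
      refine if_neg ?_
      rintro ⟨h3, h4⟩
      exact h' (EtaleTwo.point_ext (h3.trans h1.symm) (h4.trans h2.symm))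
    · intro h; exact absurd (Finset.mem_univ _) h

end PairVectors

/-! ### The map `ι` by minors -/

section WedgeToPairs

variable {K : Type u} [Field K] {f : K[X]} {hf : f.Separable}
  {ξ : GenJacobianTwo f →ₗ[ZMod 2] (AlgebraicClosure K → ZMod 2)}

/-- The linear map `∧² J_𝔪[2] → Ind_K^{K_f^{(2)}} 𝔽₂` given by the `2 × 2` minors of the
coordinates. -/
def wedgeToPairs (hf : f.Separable)
    (ξ : GenJacobianTwo f →ₗ[ZMod 2] (AlgebraicClosure K → ZMod 2)) :
    ⋀[ZMod 2]^2 (GenJacobianTwo f) →ₗ[ZMod 2]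
      ((EtaleSym f →ₐ[K] AlgebraicClosure K) →₀ ZMod 2) :=
  haveI := finite_etaleSym_points hf.ne_zero
  (Finsupp.linearEquivFunOnFinite (ZMod 2) (ZMod 2) _).symm.toLinearMap ∘ₗ
    LinearMap.pi fun s => exteriorPower.alternatingMapLinearEquiv
      ((Matrix.detRowAlternating (R := ZMod 2) (n := Fin 2)).compLinearMap
        (LinearMap.pi ![LinearMap.proj ((exists_extension s).choose (EtaleTwo.var f 0)) ∘ₗ ξ,
          LinearMap.proj ((exists_extension s).choose (EtaleTwo.var f 1)) ∘ₗ ξ]))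

lemma wedgeToPairs_apply (v w : GenJacobianTwo f) (s : EtaleSym f →ₐ[K] AlgebraicClosure K) :
    wedgeToPairs hf ξ (exteriorPower.ιMulti (ZMod 2) 2 ![v, w]) s = pairForm f (ξ v) (ξ w) s := by
  refine (exteriorPower.alternatingMapLinearEquiv_apply_ιMulti _ _).trans ?_
  refine (Matrix.det_fin_two _).trans ?_
  rfl

end WedgeToPairs

/-! ### Galois equivariance and support of the coordinates -/

section Coordinates

variable {K : Type u} [Field K] [NeZero (2 : K)] {f : K[X]} {hf : f.Separable}
  {ξ : GenJacobianTwo f →ₗ[ZMod 2] (AlgebraicClosure K → ZMod 2)}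

open Classical in
/-- The linear map `ξ` takes the coordinates with respect to the roots of `f`. -/
def IsCoordinates (hf : f.Separable)
    (ξ : GenJacobianTwo f →ₗ[ZMod 2] (AlgebraicClosure K → ZMod 2)) : Prop :=
  ∀ t : EtaleTwo f →ₐ[K] AlgebraicClosure K, ξ (rootClass hf t) =
    Pi.single (t (EtaleTwo.var f 0)) 1 + Pi.single (t (EtaleTwo.var f 1)) 1

lemma IsCoordinates.gal (hξ : IsCoordinates hf ξ)
    (hspan : Submodule.span (ZMod 2) (Set.range (rootClass hf)) = ⊤) (σ : GalK K)
    (v : GenJacobianTwo f) (a : AlgebraicClosure K) : ξ (jacobianTwoRep f σ v) (σ a) = ξ v a := by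
  classical
  have hv : v ∈ Submodule.span (ZMod 2) (Set.range (rootClass hf)) := hspan ▸ Submodule.mem_top
  induction hv using Submodule.span_induction with
  | mem v hv =>
    obtain ⟨t, rfl⟩ := hv
    have e : jacobianTwoRep f σ (rootClass hf t) = rootClass hf (galPoint σ t) :=
      galJacobianTwo_rootClass hf σ t
    rw [e, hξ, hξ]
    simp only [Pi.add_apply, Pi.single_apply]
    have h (i) : σ a = galPoint σ t (EtaleTwo.var f i) ↔ a = t (EtaleTwo.var f i) :=
      σ.injective.eq_iff
    simp only [h]
  | zero => simp
  | add v w _ _ hv hw => simp only [map_add, Pi.add_apply, hv, hw]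
  | smul c v _ hv => simp only [map_smul, Pi.smul_apply, hv]

lemma IsCoordinates.apply_eq_zero (hξ : IsCoordinates hf ξ)
    (hspan : Submodule.span (ZMod 2) (Set.range (rootClass hf)) = ⊤)
    (v : GenJacobianTwo f) {a : AlgebraicClosure K} (ha : (fbar f).eval a ≠ 0) : ξ v a = 0 := by
  classical
  have hv : v ∈ Submodule.span (ZMod 2) (Set.range (rootClass hf)) := hspan ▸ Submodule.mem_top
  induction hv using Submodule.span_induction with
  | mem v hv =>
    obtain ⟨t, rfl⟩ := hv
    rw [hξ, Pi.add_apply, Pi.single_apply, Pi.single_apply, if_neg, if_neg, add_zero]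
    · rintro rfl; exact ha (eval_root t 1 (Or.inr rfl))
    · rintro rfl; exact ha (eval_root t 0 (Or.inl rfl))
  | zero => simp
  | add v w _ _ hv hw => simp only [map_add, Pi.add_apply, hv, hw, add_zero]
  | smul c v _ hv => simp only [map_smul, Pi.smul_apply, hv, smul_zero]

end Coordinates
end
end EvenHyperelliptic

namespace EvenHyperelliptic
noncomputable section
universe u

/-! ### Linear splittings attached to a base root -/

section Splitting

variable {K : Type u} [Field K] {f : K[X]} {hf : f.Separable}
  {ξ : GenJacobianTwo f →ₗ[ZMod 2] (AlgebraicClosure K → ZMod 2)}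

open Classical in
/-- The family `vec` consists of the classes of the divisors `(α, 0) - (α₀, 0)`, where `α` runs
through the roots of `f`. -/
def IsBasedFamily (f : K[X]) (ξ : GenJacobianTwo f →ₗ[ZMod 2] (AlgebraicClosure K → ZMod 2))
    (α₀ : AlgebraicClosure K) (vec : AlgebraicClosure K → GenJacobianTwo f) : Prop :=
  ∀ α, (fbar f).eval α = 0 → ξ (vec α) = Pi.single α 1 + Pi.single α₀ 1

lemma IsBasedFamily.base {α₀ : AlgebraicClosure K}
    {vec : AlgebraicClosure K → GenJacobianTwo f} (hvec : IsBasedFamily f ξ α₀ vec) (hinj : Function.Injective ξ)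
    (h₀ : (fbar f).eval α₀ = 0) : vec α₀ = 0 :=
  hinj (by rw [hvec _ h₀, CharTwo.add_self_eq_zero, map_zero])

/-- The linear map `Ind_K^{K_f^{(2)}} 𝔽₂ → ∧² J_𝔪[2]`, `e_{αβ} ↦ vec α ∧ vec β`. -/
def pairsToWedge (vec : AlgebraicClosure K → GenJacobianTwo f) :
    ((EtaleSym f →ₐ[K] AlgebraicClosure K) →₀ ZMod 2) →ₗ[ZMod 2]
      ⋀[ZMod 2]^2 (GenJacobianTwo f) :=
  Finsupp.linearCombination (ZMod 2) fun s => exteriorPower.ιMulti (ZMod 2) 2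
    ![vec ((exists_extension s).choose (EtaleTwo.var f 0)),
      vec ((exists_extension s).choose (EtaleTwo.var f 1))]

lemma ιMulti_swap (v w : GenJacobianTwo f) :
    exteriorPower.ιMulti (ZMod 2) 2 ![v, w] = exteriorPower.ιMulti (ZMod 2) 2 ![w, v] := by
  have h := (exteriorPower.ιMulti (ZMod 2) 2).map_swap ![w, v] (zero_ne_one (α := Fin 2))
  have e : ![w, v] ∘ Equiv.swap (0 : Fin 2) 1 = ![v, w] := by ext i; fin_cases i <;> rfl
  rw [e] at h
  rw [h]
  exact ZModModule.neg_eq_self _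

lemma pairsToWedge_pairVector (vec : AlgebraicClosure K → GenJacobianTwo f)
    (t : EtaleTwo f →ₐ[K] AlgebraicClosure K) :
    pairsToWedge vec (pairVector t) = exteriorPower.ιMulti (ZMod 2) 2
      ![vec (t (EtaleTwo.var f 0)), vec (t (EtaleTwo.var f 1))] := by
  refine (Finsupp.linearCombination_single _ _ _).trans ?_
  rw [one_smul]
  exact apply_eq_of_symm (F := fun a b => exteriorPower.ιMulti (ZMod 2) 2 ![vec a, vec b])
    (fun _ _ => ιMulti_swap _ _) t

open Classical in
/-- The linear map `J_𝔪[2] → Ind_K^{K_f^{(2)}} 𝔽₂` that sends the class of `(α, 0) - (α₀, 0)` to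
`e_{α₀ α}`. -/
def jacobianToPairs (hf : f.Separable)
    (ξ : GenJacobianTwo f →ₗ[ZMod 2] (AlgebraicClosure K → ZMod 2)) (α₀ : AlgebraicClosure K) :
    GenJacobianTwo f →ₗ[ZMod 2] ((EtaleSym f →ₐ[K] AlgebraicClosure K) →₀ ZMod 2) :=
  haveI := finite_etaleSym_points hf.ne_zero
  (Finsupp.linearEquivFunOnFinite (ZMod 2) (ZMod 2) _).symm.toLinearMap ∘ₗ
    { toFun := fun v => pairForm f (Pi.single α₀ 1) (ξ v)
      map_add' := fun v w => by
        ext s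
        simp only [pairForm, map_add, Pi.add_apply]
        ring
      map_smul' := fun c v => by
        ext s
        simp only [pairForm, map_smul, Pi.smul_apply, smul_eq_mul, RingHom.id_apply]
        ring }

open Classical in
lemma jacobianToPairs_apply (α₀ : AlgebraicClosure K) (v : GenJacobianTwo f)
    (s : EtaleSym f →ₐ[K] AlgebraicClosure K) :
    jacobianToPairs hf ξ α₀ v s = pairForm f (Pi.single α₀ 1) (ξ v) s := rfl

lemma linearMap_ext_pairVector {A : Type*} [AddCommGroup A] [Module (ZMod 2) A]
    {φ ψ : ((EtaleSym f →ₐ[K] AlgebraicClosure K) →₀ ZMod 2) →ₗ[ZMod 2] A}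
    (h : ∀ t, φ (pairVector t) = ψ (pairVector t)) : φ = ψ := by
  refine Finsupp.lhom_ext' fun s => LinearMap.ext_ring ?_
  obtain ⟨t, rfl⟩ := exists_extension s
  exact h t

end Splitting

/-! ### The exact sequence, invariant lifts and the isomorphism on `H¹` -/

section ExactSequence

variable {K : Type u} [Field K] [NeZero (2 : K)] {f : K[X]} {hf : f.Separable}
  {ξ : GenJacobianTwo f →ₗ[ZMod 2] (AlgebraicClosure K → ZMod 2)}

/-- With indicator functions, `(β + γ) ∧ (γ + α) = β ∧ γ + β ∧ α + γ ∧ γ + γ ∧ α`. The term `γ ∧ γ`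
is twice a product of values, hence zero, and the others are the three edges. -/
lemma wedgeToPairs_rootClass (hξ : IsCoordinates hf ξ)
    {t₁ t₂ t₃ : EtaleTwo f →ₐ[K] AlgebraicClosure K}
    (h₁₂ : t₁ (EtaleTwo.var f 1) = t₂ (EtaleTwo.var f 0))
    (h₂₃ : t₂ (EtaleTwo.var f 1) = t₃ (EtaleTwo.var f 0))
    (h₃₁ : t₃ (EtaleTwo.var f 1) = t₁ (EtaleTwo.var f 0)) :
    wedgeToPairs hf ξ (exteriorPower.ιMulti (ZMod 2) 2 ![rootClass hf t₂, rootClass hf t₃]) =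
      pairVector t₁ + pairVector t₂ + pairVector t₃ := by
  classical
  refine ext_toPair fun t => ?_
  rw [wedgeToPairs_apply, pairForm_toPair, hξ, hξ, Finsupp.add_apply, Finsupp.add_apply,
    pairVector_toPair, pairVector_toPair, pairVector_toPair, h₁₂, h₂₃, h₃₁]
  simp only [Pi.add_apply]
  have h2 : (2 : ZMod 2) = 0 := rfl
  linear_combination (Pi.single (t₃ (EtaleTwo.var f 0)) 1 : AlgebraicClosure K → ZMod 2)
    (t (EtaleTwo.var f 0)) * (Pi.single (t₃ (EtaleTwo.var f 0)) 1 : AlgebraicClosure K → ZMod 2)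
    (t (EtaleTwo.var f 1)) * h2

lemma IsCoordinates.wedgeToPairs_comp (hξ : IsCoordinates hf ξ)
    (hspan : Submodule.span (ZMod 2) (Set.range (rootClass hf)) = ⊤) (σ : GalK K) :
    wedgeToPairs hf ξ ∘ₗ wedgeSquareRep (jacobianTwoRep f) σ =
      indRep (K := K) (EtaleSym f) σ ∘ₗ wedgeToPairs hf ξ := by
  refine exteriorPower.linearMap_ext ?_
  ext m s
  have hm : m = ![m 0, m 1] := by ext i; fin_cases i <;> rfl
  obtain ⟨t, rfl⟩ := exists_extension s
  change wedgeToPairs hf ξ (exteriorPower.map 2 (jacobianTwoRep f σ)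
    (exteriorPower.ιMulti (ZMod 2) 2 m)) (toPair t) =
    indRep (K := K) (EtaleSym f) σ
      (wedgeToPairs hf ξ (exteriorPower.ιMulti (ZMod 2) 2 m)) (toPair t)
  have ht : t = galPoint σ (galPoint σ⁻¹ t) := by
    refine AlgHom.ext fun x => ?_
    change t x = (σ * σ⁻¹) (t x)
    rw [mul_inv_cancel]; rfl
  rw [ht, ← toPair_galPoint, indRep_apply_galPoint, exteriorPower.map_apply_ιMulti, hm]
  have hm' : ⇑(jacobianTwoRep f σ) ∘ ![m 0, m 1] =
      ![jacobianTwoRep f σ (m 0), jacobianTwoRep f σ (m 1)] := by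
    ext i; fin_cases i <;> rfl
  rw [hm', wedgeToPairs_apply, wedgeToPairs_apply, toPair_galPoint, pairForm_toPair,
    pairForm_toPair]
  have h (v : GenJacobianTwo f) (i) : ξ (jacobianTwoRep f σ v)
      (galPoint σ (galPoint σ⁻¹ t) (EtaleTwo.var f i)) =
      ξ v (galPoint σ⁻¹ t (EtaleTwo.var f i)) := hξ.gal hspan σ v _
  rw [h, h, h, h]

/-- The homomorphism of `G_K`-modules `∧² J_𝔪[2] → Ind_K^{K_f^{(2)}} 𝔽₂`. -/
def wedgeToPairsIntertwining (hξ : IsCoordinates hf ξ)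
    (hspan : Submodule.span (ZMod 2) (Set.range (rootClass hf)) = ⊤) :
    (wedgeSquareRep (jacobianTwoRep f)).IntertwiningMap (indRep (K := K) (EtaleSym f)) where
  toLinearMap := wedgeToPairs hf ξ
  isIntertwining' := hξ.wedgeToPairs_comp hspan

lemma pairMap_pairVector (t : EtaleTwo f →ₐ[K] AlgebraicClosure K) :
    (pairMap hf).toLinearMap (pairVector t) = rootClass hf t := by
  refine (Finsupp.linearCombination_single _ _ _).trans ?_
  rw [one_smul, pairClass_eq]

lemma exists_isBasedFamily (hξ : IsCoordinates hf ξ) {α₀ : AlgebraicClosure K}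
    (h₀ : (fbar f).eval α₀ = 0) : ∃ vec, IsBasedFamily f ξ α₀ vec := by
  classical
  have h (α : AlgebraicClosure K) : ∃ v, (fbar f).eval α = 0 →
      ξ v = Pi.single α 1 + Pi.single α₀ 1 := by
    by_cases hα : (fbar f).eval α = 0
    · by_cases hne : α = α₀
      · exact ⟨0, fun _ => by rw [hne, CharTwo.add_self_eq_zero, map_zero]⟩
      · obtain ⟨t, h1, h2⟩ := exists_etaleTwo_point hα h₀ hne
        exact ⟨rootClass hf t, fun _ => by rw [hξ, h1, h2]⟩
    · exact ⟨0, fun h => absurd h hα⟩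
  choose vec hvec using h
  exact ⟨vec, hvec⟩

namespace IsBasedFamily

variable {α₀ : AlgebraicClosure K} {vec : AlgebraicClosure K → GenJacobianTwo f}

lemma rootClass_eq (hvec : IsBasedFamily f ξ α₀ vec) (hinj : Function.Injective ξ)
    (hξ : IsCoordinates hf ξ) (t : EtaleTwo f →ₐ[K] AlgebraicClosure K) :
    rootClass hf t = vec (t (EtaleTwo.var f 0)) + vec (t (EtaleTwo.var f 1)) := by
  refine hinj ?_
  rw [map_add, hξ, hvec _ (eval_root t 0 (Or.inl rfl)), hvec _ (eval_root t 1 (Or.inr rfl)),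
    add_add_add_comm, CharTwo.add_self_eq_zero, add_zero]

lemma span_eq_top (hvec : IsBasedFamily f ξ α₀ vec) (hinj : Function.Injective ξ)
    (hξ : IsCoordinates hf ξ)
    (hspan : Submodule.span (ZMod 2) (Set.range (rootClass hf)) = ⊤) :
    Submodule.span (ZMod 2) (vec '' {α | (fbar f).eval α = 0}) = ⊤ := by
  rw [eq_top_iff, ← hspan, Submodule.span_le]
  rintro _ ⟨t, rfl⟩
  rw [hvec.rootClass_eq hinj hξ]
  exact add_mem (Submodule.subset_span ⟨_, eval_root t 0 (Or.inl rfl), rfl⟩)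
    (Submodule.subset_span ⟨_, eval_root t 1 (Or.inr rfl), rfl⟩)

/-- The exterior square is spanned by the `vec α ∧ vec β`, which vanish when `α = β` or one of them
is `α₀`. The remaining ones belong to triangles through `α₀`, where `wedgeToPairs_rootClass`
applies. -/
lemma wedge_induction (hvec : IsBasedFamily f ξ α₀ vec) (hinj : Function.Injective ξ)
    (hξ : IsCoordinates hf ξ) (h₀ : (fbar f).eval α₀ = 0)
    (hspan : Submodule.span (ZMod 2) (Set.range (rootClass hf)) = ⊤)
    {A : Type*} [AddCommGroup A] [Module (ZMod 2) A]
    {φ ψ : ⋀[ZMod 2]^2 (GenJacobianTwo f) →ₗ[ZMod 2] A}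
    (h : ∀ t₁ t₂ t₃ : EtaleTwo f →ₐ[K] AlgebraicClosure K,
      t₁ (EtaleTwo.var f 1) = t₂ (EtaleTwo.var f 0) →
      t₂ (EtaleTwo.var f 1) = α₀ → t₃ (EtaleTwo.var f 0) = α₀ →
      t₃ (EtaleTwo.var f 1) = t₁ (EtaleTwo.var f 0) →
      φ (exteriorPower.ιMulti (ZMod 2) 2 ![rootClass hf t₂, rootClass hf t₃]) =
        ψ (exteriorPower.ιMulti (ZMod 2) 2 ![rootClass hf t₂, rootClass hf t₃])) : φ = ψ := by
  refine LinearMap.ext_on (exteriorPower.ιMulti_span_of_span (ZMod 2) 2 _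
    (hvec.span_eq_top hinj hξ hspan)) ?_
  rintro _ ⟨m, hm, rfl⟩
  obtain ⟨α, hα, h0⟩ := hm ⟨0, rfl⟩
  obtain ⟨β, hβ, h1⟩ := hm ⟨1, rfl⟩
  have hm' : m = ![vec α, vec β] := by ext i; fin_cases i <;> simp [h0, h1]
  rw [hm']
  have hb := hvec.base hinj h₀
  by_cases hαβ : α = β
  · rw [(exteriorPower.ιMulti (ZMod 2) 2).map_eq_zero_of_eq ![vec α, vec β] (i := 0) (j := 1)
      (by simp [hαβ]) (by decide), map_zero, map_zero]
  by_cases hα₀ : α = α₀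
  · rw [(exteriorPower.ιMulti (ZMod 2) 2).map_coord_zero (m := ![vec α, vec β]) 0
      (by simp [hα₀, hb]), map_zero, map_zero]
  by_cases hβ₀ : β = α₀
  · rw [(exteriorPower.ιMulti (ZMod 2) 2).map_coord_zero (m := ![vec α, vec β]) 1
      (by simp [hβ₀, hb]), map_zero, map_zero]
  obtain ⟨t₁, h10, h11⟩ := exists_etaleTwo_point hβ hα (Ne.symm hαβ)
  obtain ⟨t₂, h20, h21⟩ := exists_etaleTwo_point hα h₀ hα₀
  obtain ⟨t₃, h30, h31⟩ := exists_etaleTwo_point h₀ hβ (Ne.symm hβ₀)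
  have := h t₁ t₂ t₃ (h11.trans h20.symm) h21 h30 (h31.trans h10.symm)
  rwa [hvec.rootClass_eq hinj hξ, hvec.rootClass_eq hinj hξ, h20, h21, h30, h31, hb, add_zero,
    zero_add] at this

/-- For a triangle `α₀, α, β`, the two edges at `α₀` are killed because `vec α₀ = 0`; the third
gives back `vec α ∧ vec β`. -/
lemma pairsToWedge_wedgeToPairs (hvec : IsBasedFamily f ξ α₀ vec) (hinj : Function.Injective ξ)
    (hξ : IsCoordinates hf ξ) (h₀ : (fbar f).eval α₀ = 0)
    (hspan : Submodule.span (ZMod 2) (Set.range (rootClass hf)) = ⊤)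
    (a : ⋀[ZMod 2]^2 (GenJacobianTwo f)) : pairsToWedge vec (wedgeToPairs hf ξ a) = a := by
  suffices h : pairsToWedge vec ∘ₗ wedgeToPairs hf ξ = LinearMap.id from congr($h a)
  refine hvec.wedge_induction hinj hξ h₀ hspan fun t₁ t₂ t₃ h12 h2 h3 h31 => ?_
  have hb := hvec.base hinj h₀
  rw [LinearMap.comp_apply, wedgeToPairs_rootClass hξ h12 (h2.trans h3.symm) h31, map_add, map_add,
    pairsToWedge_pairVector, pairsToWedge_pairVector, pairsToWedge_pairVector, h2, h3, hb,
    (exteriorPower.ιMulti (ZMod 2) 2).map_coord_zero (m := ![_, 0]) 1 rfl,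
    (exteriorPower.ιMulti (ZMod 2) 2).map_coord_zero (m := ![0, _]) 0 rfl, add_zero, add_zero,
    hvec.rootClass_eq hinj hξ, hvec.rootClass_eq hinj hξ, h2, h3, hb, add_zero, zero_add, h12, h31,
    ιMulti_swap, LinearMap.id_apply]

/-- Every vertex of a triangle has even degree. -/
lemma pairMap_wedgeToPairs (hvec : IsBasedFamily f ξ α₀ vec) (hinj : Function.Injective ξ)
    (hξ : IsCoordinates hf ξ) (h₀ : (fbar f).eval α₀ = 0)
    (hspan : Submodule.span (ZMod 2) (Set.range (rootClass hf)) = ⊤)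
    (a : ⋀[ZMod 2]^2 (GenJacobianTwo f)) :
    (pairMap hf).toLinearMap (wedgeToPairs hf ξ a) = 0 := by
  suffices h : (pairMap hf).toLinearMap ∘ₗ wedgeToPairs hf ξ = 0 from congr($h a)
  refine hvec.wedge_induction hinj hξ h₀ hspan fun t₁ t₂ t₃ h12 h2 h3 h31 => ?_
  rw [LinearMap.comp_apply, wedgeToPairs_rootClass hξ h12 (h2.trans h3.symm) h31, map_add, map_add,
    pairMap_pairVector, pairMap_pairVector, pairMap_pairVector, hvec.rootClass_eq hinj hξ,
    hvec.rootClass_eq hinj hξ, hvec.rootClass_eq hinj hξ, h2, h3, h12, h31, hvec.base hinj h₀,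
    add_zero, zero_add, LinearMap.zero_apply, add_assoc, add_comm (vec (t₂ _)),
    ZModModule.add_self]

/-- Modulo `2` the edge `αβ` is the triangle `α₀αβ` plus the path from `α` through `α₀` to `β`; as
minors, `α ∧ β = (α + α₀) ∧ (β + α₀) + α₀ ∧ (α + β)`. -/
lemma wedgeToPairs_pairsToWedge_add (hvec : IsBasedFamily f ξ α₀ vec) (hξ : IsCoordinates hf ξ)
    (b : (EtaleSym f →ₐ[K] AlgebraicClosure K) →₀ ZMod 2) :
    wedgeToPairs hf ξ (pairsToWedge vec b) +
      jacobianToPairs hf ξ α₀ ((pairMap hf).toLinearMap b) = b := by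
  classical
  suffices h : wedgeToPairs hf ξ ∘ₗ pairsToWedge vec +
    jacobianToPairs hf ξ α₀ ∘ₗ (pairMap hf).toLinearMap = LinearMap.id from congr($h b)
  refine linearMap_ext_pairVector fun t => ext_toPair fun t' => ?_
  rw [LinearMap.add_apply, LinearMap.comp_apply, LinearMap.comp_apply, pairsToWedge_pairVector,
    pairMap_pairVector, Finsupp.add_apply, wedgeToPairs_apply, jacobianToPairs_apply,
    pairForm_toPair, pairForm_toPair, LinearMap.id_apply, pairVector_toPair, hξ,
    hvec _ (eval_root t 0 (Or.inl rfl)), hvec _ (eval_root t 1 (Or.inr rfl))]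
  simp only [Pi.add_apply]
  generalize (Pi.single (t (EtaleTwo.var f 0)) 1 : AlgebraicClosure K → ZMod 2)
    (t' (EtaleTwo.var f 0)) = a
  generalize (Pi.single (t (EtaleTwo.var f 0)) 1 : AlgebraicClosure K → ZMod 2)
    (t' (EtaleTwo.var f 1)) = b
  generalize (Pi.single (t (EtaleTwo.var f 1)) 1 : AlgebraicClosure K → ZMod 2)
    (t' (EtaleTwo.var f 0)) = c
  generalize (Pi.single (t (EtaleTwo.var f 1)) 1 : AlgebraicClosure K → ZMod 2)
    (t' (EtaleTwo.var f 1)) = d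
  generalize (Pi.single α₀ 1 : AlgebraicClosure K → ZMod 2) (t' (EtaleTwo.var f 0)) = x
  generalize (Pi.single α₀ 1 : AlgebraicClosure K → ZMod 2) (t' (EtaleTwo.var f 1)) = y
  have h2 : (2 : ZMod 2) = 0 := rfl
  linear_combination (a * y + c * y + x * b + x * d + x * y) * h2

lemma pairMap_jacobianToPairs (hvec : IsBasedFamily f ξ α₀ vec) (hinj : Function.Injective ξ)
    (hξ : IsCoordinates hf ξ) (h₀ : (fbar f).eval α₀ = 0)
    (hspan : Submodule.span (ZMod 2) (Set.range (rootClass hf)) = ⊤) (c : GenJacobianTwo f) :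
    (pairMap hf).toLinearMap (jacobianToPairs hf ξ α₀ c) = c := by
  classical
  suffices h : (pairMap hf).toLinearMap ∘ₗ jacobianToPairs hf ξ α₀ = LinearMap.id from
    congr($h c)
  refine LinearMap.ext_on (hvec.span_eq_top hinj hξ hspan) ?_
  rintro _ ⟨α, hα, rfl⟩
  have hb := hvec.base hinj h₀
  by_cases hα₀ : α = α₀
  · rw [hα₀, hb, map_zero, map_zero]
  obtain ⟨t, h0, h1⟩ := exists_etaleTwo_point h₀ hα (Ne.symm hα₀)
  have e : jacobianToPairs hf ξ α₀ (vec α) = pairVector t := by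
    refine ext_toPair fun t' => ?_
    rw [jacobianToPairs_apply, pairForm_toPair, pairVector_toPair, hvec _ hα, h0, h1]
    simp only [Pi.add_apply]
    have h2 : (2 : ZMod 2) = 0 := rfl
    linear_combination (Pi.single α₀ 1 : AlgebraicClosure K → ZMod 2) (t' (EtaleTwo.var f 0)) *
      (Pi.single α₀ 1 : AlgebraicClosure K → ZMod 2) (t' (EtaleTwo.var f 1)) * h2
  rw [LinearMap.comp_apply, e, pairMap_pairVector, hvec.rootClass_eq hinj hξ, h0, h1, hb, zero_add,
    LinearMap.id_apply]

end IsBasedFamily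

open Classical in
-- The sum runs over all roots other than `γ`. Coordinate vectors of `J_𝔪[2]` have total sum zero,
-- so this equals the coordinate at `γ`; it is checked on the spanning classes.
lemma IsCoordinates.sum_single_mul (hξ : IsCoordinates hf ξ)
    (hspan : Submodule.span (ZMod 2) (Set.range (rootClass hf)) = ⊤)
    [Fintype (EtaleTwo f →ₐ[K] AlgebraicClosure K)]
    (v : GenJacobianTwo f) {γ : AlgebraicClosure K} (hγ : (fbar f).eval γ = 0) :
    ∑ t : EtaleTwo f →ₐ[K] AlgebraicClosure K,
      (Pi.single γ 1 : AlgebraicClosure K → ZMod 2) (t (EtaleTwo.var f 0)) *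
        ξ v (t (EtaleTwo.var f 1)) = ξ v γ := by
  have hv : v ∈ Submodule.span (ZMod 2) (Set.range (rootClass hf)) := hspan ▸ Submodule.mem_top
  induction hv using Submodule.span_induction with
  | mem v hv =>
    obtain ⟨t, rfl⟩ := hv
    rw [hξ]
    simp only [Pi.add_apply, mul_add, Finset.sum_add_distrib]
    rw [sum_single_mul_single hγ (eval_root t 0 (Or.inl rfl)),
      sum_single_mul_single hγ (eval_root t 1 (Or.inr rfl)), add_add_add_comm,
      CharTwo.add_self_eq_zero, zero_add]
  | zero => simp
  | add v w _ _ hv hw => simp only [map_add, Pi.add_apply, mul_add, Finset.sum_add_distrib, hv, hw]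
  | smul c v _ hv =>
    simp only [map_smul, Pi.smul_apply, smul_eq_mul, mul_left_comm _ c, ← Finset.mul_sum, hv]

open Classical in
-- The coordinate at `γ` is the degree of the vertex `γ` modulo `2`. For a single edge, only its two
-- orderings contribute to the sum.
lemma IsCoordinates.pairMap_apply (hξ : IsCoordinates hf ξ)
    [Fintype (EtaleTwo f →ₐ[K] AlgebraicClosure K)]
    (b : (EtaleSym f →ₐ[K] AlgebraicClosure K) →₀ ZMod 2) (γ : AlgebraicClosure K) :
    ξ ((pairMap hf).toLinearMap b) γ = ∑ t : EtaleTwo f →ₐ[K] AlgebraicClosure K,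
      (Pi.single γ 1 : AlgebraicClosure K → ZMod 2) (t (EtaleTwo.var f 0)) * b (toPair t) := by
  let ψ : ((EtaleSym f →ₐ[K] AlgebraicClosure K) →₀ ZMod 2) →ₗ[ZMod 2] ZMod 2 :=
    ∑ t : EtaleTwo f →ₐ[K] AlgebraicClosure K,
      (Pi.single γ 1 : AlgebraicClosure K → ZMod 2) (t (EtaleTwo.var f 0)) •
        Finsupp.lapply (toPair t)
  have hψ (b) : ψ b = ∑ t : EtaleTwo f →ₐ[K] AlgebraicClosure K,
      (Pi.single γ 1 : AlgebraicClosure K → ZMod 2) (t (EtaleTwo.var f 0)) * b (toPair t) := by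
    simp [ψ, LinearMap.sum_apply]
  suffices h : LinearMap.proj γ ∘ₗ ξ ∘ₗ (pairMap hf).toLinearMap = ψ from
    congr($h b).trans (hψ b)
  refine linearMap_ext_pairVector fun t => ?_
  rw [hψ, LinearMap.comp_apply, LinearMap.comp_apply, pairMap_pairVector, hξ, LinearMap.proj_apply,
    Pi.add_apply]
  have hne : t ≠ t.comp (EtaleTwo.swap f) := fun h =>
    EtaleTwo.ne t (by simpa using congr($h (EtaleTwo.var f 0)))
  have hmem (t') (h : t' ≠ t) (h' : t' ≠ t.comp (EtaleTwo.swap f)) :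
      pairVector t (toPair t') = 0 :=
    Finsupp.single_eq_of_ne fun e => (toPair_eq_iff.1 e).elim h h'
  have hself : pairVector t (toPair t) = 1 := Finsupp.single_eq_same
  have hswap : pairVector t (toPair (t.comp (EtaleTwo.swap f))) = 1 := by
    rw [toPair_eq_iff.2 (Or.inr rfl), hself]
  rw [Fintype.sum_eq_add t (t.comp (EtaleTwo.swap f)) hne fun t' h => by
    rw [hmem t' h.1 h.2, mul_zero], hself, hswap, mul_one, mul_one, AlgHom.comp_apply,
    EtaleTwo.swap_zero]
  simp only [Pi.single_apply, eq_comm]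

/-- The lift is the complete graph on the support of `c`, with coefficient `c(α) c(β)` at `{α, β}`.
It inherits invariance from `c`. -/
lemma IsCoordinates.exists_invariant_lift (hξ : IsCoordinates hf ξ) (hinj : Function.Injective ξ)
    (hspan : Submodule.span (ZMod 2) (Set.range (rootClass hf)) = ⊤) {c : GenJacobianTwo f}
    (hc : ∀ σ, jacobianTwoRep f σ c = c) :
    ∃ b, (∀ σ, indRep (K := K) (EtaleSym f) σ b = b) ∧ (pairMap hf).toLinearMap b = c := by
  classical
  have := finite_etaleSym_points hf.ne_zero
  have := finite_etaleTwo_points hf.ne_zero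
  have := Fintype.ofFinite (EtaleTwo f →ₐ[K] AlgebraicClosure K)
  let b : (EtaleSym f →ₐ[K] AlgebraicClosure K) →₀ ZMod 2 :=
    Finsupp.equivFunOnFinite.symm fun s =>
      ξ c ((exists_extension s).choose (EtaleTwo.var f 0)) *
        ξ c ((exists_extension s).choose (EtaleTwo.var f 1))
  have hb (t) : b (toPair t) = ξ c (t (EtaleTwo.var f 0)) * ξ c (t (EtaleTwo.var f 1)) :=
    apply_eq_of_symm (F := fun x y => ξ c x * ξ c y) (fun _ _ => mul_comm _ _) t
  refine ⟨b, fun σ => ext_toPair fun t => ?_, hinj (funext fun γ => ?_)⟩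
  · have ht : t = galPoint σ (galPoint σ⁻¹ t) := by
      refine AlgHom.ext fun x => ?_
      change t x = (σ * σ⁻¹) (t x)
      rw [mul_inv_cancel]; rfl
    have h (i) : ξ c (galPoint σ (galPoint σ⁻¹ t) (EtaleTwo.var f i)) =
        ξ c (galPoint σ⁻¹ t (EtaleTwo.var f i)) := by
      have := hξ.gal hspan σ c (galPoint σ⁻¹ t (EtaleTwo.var f i))
      rwa [hc] at this
    rw [ht, ← toPair_galPoint, indRep_apply_galPoint, toPair_galPoint, hb, hb, h, h]
  · by_cases hγ : (fbar f).eval γ = 0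
    · have h (t : EtaleTwo f →ₐ[K] AlgebraicClosure K) :
          (Pi.single γ 1 : AlgebraicClosure K → ZMod 2) (t (EtaleTwo.var f 0)) *
            (ξ c (t (EtaleTwo.var f 0)) * ξ c (t (EtaleTwo.var f 1))) =
          ξ c γ * ((Pi.single γ 1 : AlgebraicClosure K → ZMod 2) (t (EtaleTwo.var f 0)) *
            ξ c (t (EtaleTwo.var f 1))) := by
        rw [Pi.single_apply]
        split_ifs with h
        · rw [h, one_mul, one_mul]
        · rw [zero_mul, zero_mul, mul_zero]
      simp only [hξ.pairMap_apply, hb, h]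
      -- The neighbours of `γ` contribute `c(γ)` times the sum of `c` over the other roots, that is
      -- `c(γ) * c(γ)`, and every element of `𝔽₂` is idempotent.
      rw [← Finset.mul_sum, hξ.sum_single_mul hspan c hγ]
      generalize ξ c γ = z
      revert z
      decide
    · rw [hξ.apply_eq_zero hspan _ hγ, hξ.apply_eq_zero hspan _ hγ]

/-- The map induced on `H¹` by `∧² J_𝔪[2] → Ind_K^{K_f^{(2)}} 𝔽₂` is an isomorphism onto the kernel
of the map induced by `Ind_K^{K_f^{(2)}} 𝔽₂ → J_𝔪[2]`. -/
theorem IsBasedFamily.exists_H1_equiv_ker {α₀ : AlgebraicClosure K}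
    {vec : AlgebraicClosure K → GenJacobianTwo f} (hvec : IsBasedFamily f ξ α₀ vec)
    (hinj : Function.Injective ξ) (hξ : IsCoordinates hf ξ) (h₀ : (fbar f).eval α₀ = 0)
    (hspan : Submodule.span (ZMod 2) (Set.range (rootClass hf)) = ⊤) :
    ∃ Φ : H1 (wedgeSquareRep (jacobianTwoRep f)) ≃ₗ[ZMod 2] LinearMap.ker (H1map (pairMap hf)),
      ∀ c, (Φ c : H1 (indRep (K := K) (EtaleSym f))) =
        H1map (wedgeToPairsIntertwining hξ hspan) c := by
  have hr : ∀ a, pairsToWedge vec ((wedgeToPairsIntertwining hξ hspan).toLinearMap a) = a :=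
    hvec.pairsToWedge_wedgeToPairs hinj hξ h₀ hspan
  have hrs : ∀ b, (wedgeToPairsIntertwining hξ hspan).toLinearMap (pairsToWedge vec b) +
      jacobianToPairs hf ξ α₀ ((pairMap hf).toLinearMap b) = b :=
    hvec.wedgeToPairs_pairsToWedge_add hξ
  have hφι : ∀ a, (pairMap hf).toLinearMap
      ((wedgeToPairsIntertwining hξ hspan).toLinearMap a) = 0 :=
    hvec.pairMap_wedgeToPairs hinj hξ h₀ hspan
  have hs := hvec.pairMap_jacobianToPairs hinj hξ h₀ hspan
  have hC : ∀ c, (∀ g, jacobianTwoRep f g c = c) → ∃ b,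
      (∀ g, indRep (K := K) (EtaleSym f) g b = b) ∧ (pairMap hf).toLinearMap b = c :=
    fun _ hc => hξ.exists_invariant_lift hinj hspan hc
  have hB := isLocallyConstant_indRep (f := f)
  exact EvenHyperelliptic.exists_H1_equiv_ker hr hrs hφι hs hB hC

end ExactSequence
end
end EvenHyperelliptic


theorem mainTheorem6 {K : Type*} [Field K] [NeZero (2 : K)] (f : K[X]) (hf : f.Separable)
    (hpos : 0 < f.natDegree) (heven : Even f.natDegree) :
    ∃ ι : (wedgeSquareRep (jacobianTwoRep f)).IntertwiningMap (indRep (K := K) (EtaleSym f)),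
      (∀ t₁ t₂ t₃ : EtaleTwo f →ₐ[K] AlgebraicClosure K,
        t₁ (EtaleTwo.var f 1) = t₂ (EtaleTwo.var f 0) →
        t₂ (EtaleTwo.var f 1) = t₃ (EtaleTwo.var f 0) →
        t₃ (EtaleTwo.var f 1) = t₁ (EtaleTwo.var f 0) →
        ι.toLinearMap (exteriorPower.ιMulti (ZMod 2) 2 ![rootClass hf t₂, rootClass hf t₃]) =
          pairVector t₁ + pairVector t₂ + pairVector t₃) ∧
      ∃ Φ : H1 (wedgeSquareRep (jacobianTwoRep f)) ≃ₗ[ZMod 2] LinearMap.ker (H1map (pairMap hf)),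
        ∀ c, (Φ c : H1 (indRep (K := K) (EtaleSym f))) = H1map ι c := by
  refine Exists.elim (exists_coordinates heven hf hpos) fun ξ h => ?_
  have hξ : IsCoordinates hf ξ := h.2
  have hspan := span_rootClass heven hf hpos
  -- The root `α₀` need not lie in `K`: it enters only through the linear splittings, while `ι` is
  -- built from all the roots symmetrically.
  refine Exists.elim (exists_root_fbar hpos) fun α₀ h₀ =>
    Exists.elim (exists_isBasedFamily hξ h₀) fun vec hvec => ?_
  exact ⟨wedgeToPairsIntertwining hξ hspan, fun _ _ _ => wedgeToPairs_rootClass hξ,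
    hvec.exists_H1_equiv_ker h.1 hξ h₀ hspan⟩
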